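/- A straight-line drawing of a graph represents its vertices by distinct points of the plane and each edge by the closed straight-line segment joining the points of its two endpoints, such that this segment passes through no other vertex of the graph (edges may cross). The slope of an edge is the angle $\theta\in[0,\pi)$ such that its segment is parallel to the vector $(\cos\theta,\sin\theta)$. **Theorem.** Every finite simple cubic (that is, $3$-regular) graph, connected or not, has a straight-line drawing in which the slope of every edge belongs to $\{0,\pi/4,\pi/2,3\pi/4\}$. -/

import Mathlib

/-- A straight-line drawing of a graph in the Euclidean plane: vertices are distinct points, the
edge `uv` is the closed segment between the points of `u` and `v`, and it passes through no other
vertex. Edges may cross. -/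
structure StraightLineDrawing {V : Type*} (G : SimpleGraph V) where
  /-- The point that represents a vertex. -/
  pos : V → EuclideanSpace ℝ (Fin 2)
  pos_injective : Function.Injective pos
  not_mem_segment : ∀ ⦃u v w : V⦄, G.Adj u v → w ≠ u → w ≠ v →
    pos w ∉ segment ℝ (pos u) (pos v)

/-- The segment between the distinct points `p` and `q` has slope `θ`, an angle: it is parallel to
the direction `(cos θ, sin θ)`. The angle is determined modulo `π`. -/
def HasSlope (p q : EuclideanSpace ℝ (Fin 2)) (θ : ℝ) : Prop :=
  p ≠ q ∧ ∃ t : ℝ, q - p = t • !₂[Real.cos θ, Real.sin θ]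

/-- Every edge of the drawing has one of the slopes in `S`. -/
def StraightLineDrawing.UsesOnlySlopes {V : Type*} {G : SimpleGraph V}
    (D : StraightLineDrawing G) (S : Set ℝ) : Prop :=
  ∀ ⦃u v : V⦄, G.Adj u v → ∃ θ ∈ S, HasSlope (D.pos u) (D.pos v) θ

/-- The four basic slopes: horizontal, vertical and the two diagonal directions. -/
noncomputable def basicSlopes : Set ℝ :=
  {0, Real.pi / 4, Real.pi / 2, 3 * Real.pi / 4}

/-! The proof is an induction on the number of vertices, carried by subsets `W` of one vertex type
that are closed under adjacency, and split according to edge cuts.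

Suppose no nontrivial cut has fewer than two edges. By Tutte's theorem there is a perfect matching
(Petersen), and the remaining edges form disjoint cycles. Draw matching edges vertically, each in a
column of its own. With prescribed columns, a path is drawn by diagonal edges that climb
monotonically, so it cannot run into itself. Closing it to a cycle costs one degree of freedom: the
column of one vertex, the lowest one, is determined by the others (`exists_closed_chain`).

If there are at least two cycles, they are stacked, each placed upside down above the previous ones,
so that its uncontrolled vertex `p` is topmost. This `p` is chosen with its partner in a later
cycle, which then adopts the column of `p`. That column must not collide with the other columns
still in use, so the invariant `IsLatest` keeps it at least three times as far from the origin. Its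
growth is ensured in two ways: the new cycle contains the partner of the latest vertex, whose far
column pushes its own free vertex at least as far out (`join`), or it has no edges to the drawn part
and its columns are free (`leaf`). An order of the cycles in which one of these always applies is a
greedy search run backwards (`Visited`). The last cycle is entered through the partner of the latest
vertex as its free vertex. Both ends are then extremal in height, so this edge may be diagonal, with
its slope tuned by a vertical shift (`finish`).

If there is only one cycle, a suitable chord takes the rightmost column, and two chains are hung
between its ends (`exists_two_chains`). A suitable chord exists unless the graph is $K_4$ or
$K_{3,3}$, which are drawn by hand.

If a cut has no edges, the two sides are drawn separately. If it is a bridge, each side loses it and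
has one vertex `s` of degree two. Such a side has a drawing in which `s` sees upwards and its two
edges leave to the left and to the right; two of these, one turned upside down, are joined by a
vertical bridge. The stronger shape, the cap of `CapDrawing`, makes the induction in
`exists_capDrawing` work: nonadjacent neighbours of `s` allow `s` to be replaced by an edge, a
triangle at `s` is contracted to a point and later cut off from the cap, and a diamond is put on top
of the rest. -/

/-- The segment from `(a, b)` to `(c, d)` is horizontal, vertical or diagonal. -/
def SlopeOK (a b c d : ℝ) : Prop :=
  a = c ∨ b = d ∨ d - b = c - a ∨ d - b = -(c - a)

/-- The point of `w` lies on the closed segment between the points of `u` and `v`. -/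
def OnSeg {V : Type*} (x y : V → ℝ) (u v w : V) : Prop :=
  ∃ t : ℝ, 0 ≤ t ∧ t ≤ 1 ∧ x w = x u + t * (x v - x u) ∧ y w = y u + t * (y v - y u)

/-- The coordinates `x`, `y` give a straight-line drawing with basic slopes of the relation `A`
restricted to `W`. -/
structure ValidOn {V : Type*} (A : V → V → Prop) (W : Set V) (x y : V → ℝ) : Prop where
  inj : ∀ u ∈ W, ∀ v ∈ W, x u = x v → y u = y v → u = v
  slope : ∀ u ∈ W, ∀ v ∈ W, A u v → SlopeOK (x u) (y u) (x v) (y v)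
  noSeg : ∀ u ∈ W, ∀ v ∈ W, ∀ w ∈ W, A u v → w ≠ u → w ≠ v → ¬ OnSeg x y u v w

/-! ### Coordinate drawings: symmetries and stacking -/

section Basic

variable {V : Type*}

theorem SlopeOK.symm {a b c d : ℝ} (h : SlopeOK a b c d) : SlopeOK c d a b := by
  rcases h with h | h | h | h
  · exact Or.inl h.symm
  · exact Or.inr (Or.inl h.symm)
  · exact Or.inr (Or.inr (Or.inl (by linarith)))
  · exact Or.inr (Or.inr (Or.inr (by linarith)))

theorem slopeOK_of_abs {a b c d : ℝ} (h : |d - b| = |c - a|) : SlopeOK a b c d := by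
  rcases abs_eq_abs.1 h with h | h
  · exact Or.inr (Or.inr (Or.inl h))
  · exact Or.inr (Or.inr (Or.inr h))

theorem OnSeg.symm {x y : V → ℝ} {u v w : V} (h : OnSeg x y u v w) : OnSeg x y v u w := by
  obtain ⟨t, h0, h1, hx, hy⟩ := h
  exact ⟨1 - t, by linarith, by linarith, by rw [hx]; ring, by rw [hy]; ring⟩

theorem OnSeg.x_mem {x y : V → ℝ} {u v w : V} (h : OnSeg x y u v w) :
    min (x u) (x v) ≤ x w ∧ x w ≤ max (x u) (x v) := by
  obtain ⟨t, h0, h1, hx, -⟩ := h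
  rcases le_total (x u) (x v) with h | h
  · rw [min_eq_left h, max_eq_right h, hx]
    constructor <;> nlinarith
  · rw [min_eq_right h, max_eq_left h, hx]
    constructor <;> nlinarith

theorem OnSeg.y_mem {x y : V → ℝ} {u v w : V} (h : OnSeg x y u v w) :
    min (y u) (y v) ≤ y w ∧ y w ≤ max (y u) (y v) := by
  obtain ⟨t, h0, h1, hx, hy⟩ := h
  exact OnSeg.x_mem (x := y) (y := x) ⟨t, h0, h1, hy, hx⟩

theorem OnSeg.le_y {x y : V → ℝ} {u v w : V} (h : OnSeg x y u v w) {b : ℝ}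
    (hu : b ≤ y u) (hv : b ≤ y v) : b ≤ y w := (le_min hu hv).trans h.y_mem.1

theorem OnSeg.y_le {x y : V → ℝ} {u v w : V} (h : OnSeg x y u v w) {b : ℝ}
    (hu : y u ≤ b) (hv : y v ≤ b) : y w ≤ b := h.y_mem.2.trans (max_le hu hv)

theorem OnSeg.le_x {x y : V → ℝ} {u v w : V} (h : OnSeg x y u v w) {b : ℝ}
    (hu : b ≤ x u) (hv : b ≤ x v) : b ≤ x w := (le_min hu hv).trans h.x_mem.1

theorem OnSeg.x_le {x y : V → ℝ} {u v w : V} (h : OnSeg x y u v w) {b : ℝ}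
    (hu : x u ≤ b) (hv : x v ≤ b) : x w ≤ b := h.x_mem.2.trans (max_le hu hv)

/-- A linear equation satisfied by both ends of a segment is satisfied on the segment. -/
theorem OnSeg.linear {x y : V → ℝ} {u v w : V} (h : OnSeg x y u v w) {a b c : ℝ}
    (hu : a * x u + b * y u = c) (hv : a * x v + b * y v = c) : a * x w + b * y w = c := by
  obtain ⟨t, -, -, hx, hy⟩ := h
  rw [hx, hy]
  linear_combination (1 - t) * hu + t * hv

theorem OnSeg.congr {x y x' y' : V → ℝ} {u v w : V} (h : OnSeg x y u v w)
    (hxu : x u = x' u) (hyu : y u = y' u) (hxv : x v = x' v) (hyv : y v = y' v)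
    (hxw : x w = x' w) (hyw : y w = y' w) : OnSeg x' y' u v w := by
  obtain ⟨t, h0, h1, hx, hy⟩ := h
  exact ⟨t, h0, h1, by rw [← hxu, ← hxv, ← hxw, hx], by rw [← hyu, ← hyv, ← hyw, hy]⟩

theorem ValidOn.congr {A : V → V → Prop} {W : Set V} {x y x' y' : V → ℝ} (h : ValidOn A W x y)
    (hx : ∀ v ∈ W, x' v = x v) (hy : ∀ v ∈ W, y' v = y v) : ValidOn A W x' y' where
  inj u hu v hv h1 h2 := h.inj u hu v hv (by rw [← hx u hu, ← hx v hv, h1])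
    (by rw [← hy u hu, ← hy v hv, h2])
  slope u hu v hv huv := by
    rw [hx u hu, hy u hu, hx v hv, hy v hv]; exact h.slope u hu v hv huv
  noSeg u hu v hv w hw huv hwu hwv hs := h.noSeg u hu v hv w hw huv hwu hwv
    (hs.congr (hx u hu) (hy u hu) (hx v hv) (hy v hv) (hx w hw) (hy w hw))

theorem ValidOn.mono {A B : V → V → Prop} {W U : Set V} {x y : V → ℝ} (h : ValidOn A W x y)
    (hU : U ⊆ W) (hAB : ∀ u ∈ U, ∀ v ∈ U, B u v → A u v) : ValidOn B U x y where
  inj u hu v hv := h.inj u (hU hu) v (hU hv)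
  slope u hu v hv huv := h.slope u (hU hu) v (hU hv) (hAB u hu v hv huv)
  noSeg u hu v hv w hw huv := h.noSeg u (hU hu) v (hU hv) w (hU hw) (hAB u hu v hv huv)

/-- An injective linear map that preserves the set of basic slopes preserves drawings. -/
theorem ValidOn.linearMap {A : V → V → Prop} {W : Set V} {x y : V → ℝ} (h : ValidOn A W x y)
    {a b c d e f : ℝ} (hdet : a * d - b * c ≠ 0)
    (hs : ∀ p q, p = 0 ∨ q = 0 ∨ q = p ∨ q = -p →
      a * p + b * q = 0 ∨ c * p + d * q = 0 ∨ c * p + d * q = a * p + b * q ∨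
        c * p + d * q = -(a * p + b * q)) :
    ValidOn A W (fun v => a * x v + b * y v + e) (fun v => c * x v + d * y v + f) where
  inj u hu v hv h1 h2 := by
    refine h.inj u hu v hv ?_ ?_
    · have : (a * d - b * c) * (x u - x v) = 0 := by linear_combination d * h1 - b * h2
      rcases mul_eq_zero.1 this with h | h
      · exact absurd h hdet
      · linarith
    · have : (a * d - b * c) * (y u - y v) = 0 := by linear_combination a * h2 - c * h1
      rcases mul_eq_zero.1 this with h | h
      · exact absurd h hdet
      · linarith
  slope u hu v hv huv := by
    have h1 : x v - x u = 0 ∨ y v - y u = 0 ∨ y v - y u = x v - x u ∨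
        y v - y u = -(x v - x u) := by
      rcases h.slope u hu v hv huv with h | h | h | h
      · exact Or.inl (by linarith)
      · exact Or.inr (Or.inl (by linarith))
      · exact Or.inr (Or.inr (Or.inl h))
      · exact Or.inr (Or.inr (Or.inr h))
    rcases hs _ _ h1 with h | h | h | h
    · exact Or.inl (by linarith)
    · exact Or.inr (Or.inl (by linarith))
    · exact Or.inr (Or.inr (Or.inl (by linarith)))
    · exact Or.inr (Or.inr (Or.inr (by linarith)))
  noSeg u hu v hv w hw huv hwu hwv := by
    rintro ⟨t, h0, h1, hx, hy⟩
    simp only at hx hy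
    refine h.noSeg u hu v hv w hw huv hwu hwv ⟨t, h0, h1, ?_, ?_⟩
    · have : (a * d - b * c) * (x w - (x u + t * (x v - x u))) = 0 := by
        linear_combination d * hx - b * hy
      rcases mul_eq_zero.1 this with h | h
      · exact absurd h hdet
      · linarith
    · have : (a * d - b * c) * (y w - (y u + t * (y v - y u))) = 0 := by
        linear_combination a * hy - c * hx
      rcases mul_eq_zero.1 this with h | h
      · exact absurd h hdet
      · linarith

theorem ValidOn.translate {A : V → V → Prop} {W : Set V} {x y : V → ℝ} (h : ValidOn A W x y)
    (e f : ℝ) : ValidOn A W (fun v => x v + e) (fun v => y v + f) := by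
  have := h.linearMap (a := 1) (b := 0) (c := 0) (d := 1) (e := e) (f := f) (by norm_num)
    (by intro p q h; simpa using h)
  simpa using this

/-- Reflection in a horizontal line. -/
theorem ValidOn.flip {A : V → V → Prop} {W : Set V} {x y : V → ℝ} (h : ValidOn A W x y)
    (f : ℝ) : ValidOn A W x (fun v => f - y v) := by
  have := h.linearMap (a := 1) (b := 0) (c := 0) (d := -1) (e := 0) (f := f) (by norm_num)
    (by
      intro p q h
      rcases h with h | h | h | h
      · left; linarith
      · right; left; linarith
      · right; right; right; linarith
      · right; right; left; linarith)
  refine this.congr (fun v _ => by ring) (fun v _ => by ring)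

/-- Rotation by half of a right angle, scaled. -/
theorem ValidOn.rotate {A : V → V → Prop} {W : Set V} {x y : V → ℝ} (h : ValidOn A W x y) :
    ValidOn A W (fun v => x v - y v) (fun v => x v + y v) := by
  have := h.linearMap (a := 1) (b := -1) (c := 1) (d := 1) (e := 0) (f := 0) (by norm_num)
    (by
      intro p q h
      rcases h with h | h | h | h
      · right; right; right; rw [h]; ring
      · right; right; left; rw [h]; ring
      · left; rw [h]; ring
      · right; left; rw [h]; ring)
  refine this.congr (fun v _ => by ring) (fun v _ => by ring)

/-- Two drawings in disjoint horizontal strips, joined by vertical edges or by edges between a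
topmost and a bottommost vertex. -/
theorem ValidOn.stack {A : V → V → Prop} (hA : ∀ u v, A u v → A v u) {P C : Set V} {x y : V → ℝ}
    (hP : ValidOn A P x y) (hC : ValidOn A C x y) (hPC : ∀ u ∈ P, ∀ v ∈ C, y u < y v)
    (hcross : ∀ u ∈ P, ∀ v ∈ C, A u v →
      (x u = x v ∧ (∀ w ∈ P, w ≠ u → x w = x u → y w < y u) ∧
        (∀ w ∈ C, w ≠ v → x w = x v → y v < y w)) ∨
      (SlopeOK (x u) (y u) (x v) (y v) ∧ (∀ w ∈ P, y w ≤ y u) ∧ (∀ w ∈ C, y v ≤ y w))) :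
    ValidOn A (P ∪ C) x y := by
  -- A vertex on a vertical joining edge has its column and lies between its ends, against
  -- visibility. On an edge from a topmost to a bottommost vertex, a vertex of either strip must
  -- have the height of an end, which forces the parameter to be 0 or 1.
  have key : ∀ u ∈ P, ∀ v ∈ C, A u v → ∀ w ∈ P ∪ C, w ≠ u → w ≠ v → ¬ OnSeg x y u v w := by
    intro u hu v hv huv w hw hwu hwv hs
    have huv' := hPC u hu v hv
    have hyu : y u ≤ y w := hs.le_y le_rfl huv'.le
    have hyv : y w ≤ y v := hs.y_le huv'.le le_rfl
    rcases hcross u hu v hv huv with ⟨h1, h2, h3⟩ | ⟨-, h2, h3⟩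
    · have hxw : x w = x u := by
        have := hs.linear (a := 1) (b := 0) (c := x u) (by ring) (by rw [h1]; ring)
        linarith
      rcases hw with hw | hw
      · have := h2 w hw hwu hxw; linarith
      · have := h3 w hw hwv (hxw.trans h1); linarith
    · obtain ⟨t, h0, h1, hx, hy⟩ := hs
      rcases hw with hw | hw
      · have h4 := h2 w hw
        have : t * (y v - y u) = 0 := by linarith
        rcases mul_eq_zero.1 this with h | h
        · exact hwu (hP.inj w hw u hu (by rw [hx, h]; ring) (by rw [hy, h]; ring))
        · linarith
      · have h4 := h3 w hw
        have : (1 - t) * (y v - y u) = 0 := by linarith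
        rcases mul_eq_zero.1 this with h | h
        · have : t = 1 := by linarith
          exact hwv (hC.inj w hw v hv (by rw [hx, this]; ring) (by rw [hy, this]; ring))
        · linarith
  refine ⟨?_, ?_, ?_⟩
  · rintro u (hu | hu) v (hv | hv) h1 h2
    · exact hP.inj u hu v hv h1 h2
    · have := hPC u hu v hv; linarith
    · have := hPC v hv u hu; linarith
    · exact hC.inj u hu v hv h1 h2
  · rintro u (hu | hu) v (hv | hv) huv
    · exact hP.slope u hu v hv huv
    · rcases hcross u hu v hv huv with ⟨h, -⟩ | ⟨h, -⟩
      · exact Or.inl h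
      · exact h
    · rcases hcross v hv u hu (hA _ _ huv) with ⟨h, -⟩ | ⟨h, -⟩
      · exact Or.inl h.symm
      · exact h.symm
    · exact hC.slope u hu v hv huv
  · rintro u (hu | hu) v (hv | hv) w hw huv hwu hwv hs
    · rcases hw with hw | hw
      · exact hP.noSeg u hu v hv w hw huv hwu hwv hs
      · have := hs.y_le (b := max (y u) (y v)) (le_max_left _ _) (le_max_right _ _)
        have h1 := hPC u hu w hw
        have h2 := hPC v hv w hw
        exact absurd (max_lt h1 h2) (not_lt.2 this)
    · exact key u hu v hv huv w hw hwu hwv hs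
    · exact key v hv u hu (hA _ _ huv) w hw hwv hwu hs.symm
    · rcases hw with hw | hw
      · have := hs.le_y (b := min (y u) (y v)) (min_le_left _ _) (min_le_right _ _)
        have h1 := hPC w hw u hu
        have h2 := hPC w hw v hv
        exact absurd (lt_min h1 h2) (not_lt.2 this)
      · exact hC.noSeg u hu v hv w hw huv hwu hwv hs

/-- Coordinates of a finite set are bounded. -/
theorem exists_abs_le [Finite V] (f : V → ℝ) : ∃ B : ℝ, 0 < B ∧ ∀ v, |f v| ≤ B := by
  classical
  cases nonempty_fintype V
  refine ⟨1 + ∑ v, |f v|, ?_, fun v => ?_⟩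
  · have := Finset.sum_nonneg (s := Finset.univ) (f := fun v => |f v|) (fun _ _ => abs_nonneg _)
    linarith
  · have := Finset.single_le_sum (s := Finset.univ) (f := fun v => |f v|)
      (fun _ _ => abs_nonneg _) (Finset.mem_univ v)
    linarith

end Basic

/-! ### Monotone diagonal chains and their closing edge -/

section Geometry

variable {V : Type*}

/-- Lets a drawing be verified with each edge listed in one direction only. -/
theorem ValidOn.symmetrize {A : V → V → Prop} {W : Set V} {x y : V → ℝ} (h : ValidOn A W x y) :
    ValidOn (fun u v => A u v ∨ A v u) W x y where
  inj := h.inj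
  slope u hu v hv huv := huv.elim (h.slope u hu v hv) fun h' => (h.slope v hv u hu h').symm
  noSeg u hu v hv w hw huv hwu hwv hs := huv.elim
    (fun h' => h.noSeg u hu v hv w hw h' hwu hwv hs)
    fun h' => h.noSeg v hv u hu w hw h' hwv hwu hs.symm

theorem ValidOn.comap {I : Type*} {A : I → I → Prop} {W : Set I} {X Y : I → ℝ}
    (h : ValidOn A W X Y) {B : V → V → Prop} {C : Set V} {f : V → I} (hf : ∀ v ∈ C, f v ∈ W)
    (hinj : ∀ u ∈ C, ∀ v ∈ C, f u = f v → u = v)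
    (hB : ∀ u ∈ C, ∀ v ∈ C, B u v → A (f u) (f v)) :
    ValidOn B C (fun v => X (f v)) (fun v => Y (f v)) where
  inj u hu v hv h1 h2 := hinj u hu v hv (h.inj _ (hf u hu) _ (hf v hv) h1 h2)
  slope u hu v hv huv := h.slope _ (hf u hu) _ (hf v hv) (hB u hu v hv huv)
  noSeg u hu v hv w hw huv hwu hwv hs := h.noSeg _ (hf u hu) _ (hf v hv) _ (hf w hw)
    (hB u hu v hv huv) (fun h' => hwu (hinj w hw u hu h')) (fun e => hwv (hinj w hw v hv e)) hs

/-- The total variation of a sequence between two indices. -/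
noncomputable def totalVar (a : ℕ → ℝ) (i j : ℕ) : ℝ := ∑ l ∈ Finset.Ico i j, |a (l + 1) - a l|

theorem totalVar_self (a : ℕ → ℝ) (i : ℕ) : totalVar a i i = 0 := by simp [totalVar]

theorem totalVar_nonneg (a : ℕ → ℝ) (i j : ℕ) : 0 ≤ totalVar a i j :=
  Finset.sum_nonneg fun _ _ => abs_nonneg _

theorem totalVar_add (a : ℕ → ℝ) {i j k : ℕ} (hij : i ≤ j) (hjk : j ≤ k) :
    totalVar a i j + totalVar a j k = totalVar a i k :=
  Finset.sum_Ico_consecutive _ hij hjk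

theorem totalVar_succ (a : ℕ → ℝ) (i : ℕ) : totalVar a i (i + 1) = |a (i + 1) - a i| := by
  simp [totalVar]

theorem abs_sub_le_totalVar (a : ℕ → ℝ) {i j : ℕ} (hij : i ≤ j) :
    |a j - a i| ≤ totalVar a i j := by
  induction j, hij using Nat.le_induction with
  | base => simp [totalVar]
  | succ j hij ih =>
    rw [← totalVar_add a hij (Nat.le_succ j), totalVar_succ]
    have := abs_add_le (a (j + 1) - a j) (a j - a i)
    have h2 : a (j + 1) - a j + (a j - a i) = a (j + 1) - a i := by ring
    rw [h2] at this
    linarith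

theorem totalVar_pos {a : ℕ → ℝ} {i j : ℕ} (hij : i < j) (h : a i ≠ a (i + 1)) :
    0 < totalVar a i j := by
  rw [← totalVar_add a (Nat.le_succ i) hij, totalVar_succ]
  have := totalVar_nonneg a (i + 1) j
  have h2 : 0 < |a (i + 1) - a i| := abs_pos.2 (sub_ne_zero.2 h.symm)
  linarith

/-- Directed edges of the cycle `0, 1, …, k - 1`. -/
def CycStep (k i j : ℕ) : Prop := j = i + 1 ∨ (i = k - 1 ∧ j = 0)

/-- A monotone polygonal chain `1, …, m` of diagonal segments, closed up by a bottom vertex `0`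
whose horizontal position is determined. -/
theorem exists_closed_chain (a : ℕ → ℝ) (m : ℕ) (hm : 2 ≤ m)
    (ha : ∀ i, 1 ≤ i → i < m → a i ≠ a (i + 1)) :
    ∃ (b : ℝ) (Y : ℕ → ℝ), ValidOn (CycStep (m + 1)) {i | i < m + 1} (Function.update a 0 b) Y ∧
      (∀ i, i ≤ m → Y 0 ≤ Y i) ∧ (∀ i, 1 ≤ i → i ≤ m → a i ≠ b) ∧
      (∀ j, 2 ≤ j → j ≤ m → (∀ i, 1 ≤ i → i ≤ m → i ≠ j → 3 * |a i| ≤ |a j|) → |a j| ≤ |b|) ∧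
      (∀ τ, 0 < τ → a m = τ → a (m - 1) = -τ → 3 * τ ≤ |b|) := by
  obtain ⟨n, rfl⟩ : ∃ n, m = n + 2 := ⟨m - 2, by omega⟩
  -- The sign `s` is the direction of the last step of the chain. The closing edge keeps this
  -- direction while it descends.
  obtain ⟨s, hs, hs1⟩ : ∃ s : ℝ, (s = 1 ∨ s = -1) ∧ 0 < s * (a (n + 2) - a (n + 1)) := by
    rcases lt_or_gt_of_ne (ha (n + 1) (by omega) (by omega)) with h | h
    · exact ⟨1, Or.inl rfl, by linarith⟩
    · exact ⟨-1, Or.inr rfl, by linarith⟩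
  have hss : s * s = 1 := by rcases hs with rfl | rfl <;> norm_num
  have habs : |s| = 1 := by rcases hs with rfl | rfl <;> norm_num
  set T := totalVar a 1 (n + 2) with hT
  -- Height equals variation, so every chain edge climbs exactly as much as it moves sideways. The
  -- empty sum gives `0` height 0, the height of `1`, so the edge between them is horizontal.
  set Y : ℕ → ℝ := fun i => totalVar a 1 i with hY
  have hY0 : Y 0 = 0 := by simp [hY, totalVar]
  have hY1 : Y 1 = 0 := totalVar_self a 1
  have hsle : ∀ z : ℝ, s * z ≤ |z| := fun z => by
    calc s * z ≤ |s * z| := le_abs_self _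
      _ = |z| := by rw [abs_mul, habs, one_mul]
  have hlast : s * (a (n + 2) - a (n + 1)) = |a (n + 2) - a (n + 1)| := by
    rw [← abs_of_pos hs1, abs_mul, habs, one_mul]
  have hmono : ∀ i j, 1 ≤ i → i < j → j ≤ n + 2 → Y i < Y j := by
    intro i j hi hij hj
    have h1 := totalVar_add a hi hij.le
    have h2 := totalVar_pos (a := a) hij (ha i hi (by omega))
    simp only [hY]; linarith
  have hTpos : 0 < T := by
    have := hmono 1 (n + 2) le_rfl (by omega) le_rfl
    rw [hY1] at this; exact this
  -- no chain vertex reaches the closing diagonal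
  have hstar : ∀ l, 1 ≤ l → l ≤ n + 1 → s * (a l - a (n + 2)) < T - Y l := by
    intro l hl hl'
    have h1 := totalVar_add a hl (show l ≤ n + 2 by omega)
    have h2 := totalVar_add a hl' (show n + 1 ≤ n + 2 by omega)
    have h3 := abs_sub_le_totalVar a hl'
    rw [totalVar_succ] at h2
    have h4 := hsle (a l - a (n + 1))
    rw [abs_sub_comm] at h4
    -- Up to `n + 1` the sideways motion is at most the climb. The last step moves in direction `s`
    -- and makes the inequality strict.
    have h5 : s * (a l - a (n + 2)) =
        s * (a l - a (n + 1)) - s * (a (n + 2) - a (n + 1)) := by ring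
    simp only [hY]
    rw [h5]
    linarith
  -- A diagonal that descends from height `T` to height 0 moves sideways by `T`.
  set b := a (n + 2) + s * T with hb
  have hfar : ∀ i, 1 ≤ i → i ≤ n + 2 → 0 < s * (b - a i) := by
    intro i hi hi'
    have h5 : s * (b - a i) = T - s * (a i - a (n + 2)) := by
      rw [hb]; linear_combination T * hss
    rcases Nat.lt_or_ge i (n + 2) with h | h
    · have h1 := hstar i hi (by omega)
      have h2 : 0 ≤ Y i := totalVar_nonneg _ _ _
      linarith
    · have : i = n + 2 := by omega
      subst this
      rw [h5]; simpa using hTpos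
  have hne : ∀ i, 1 ≤ i → i ≤ n + 2 → a i ≠ b := by
    intro i hi hi' h
    have := hfar i hi hi'
    rw [h] at this; simp at this
  have hup : ∀ i, 1 ≤ i → Function.update a 0 b i = a i := fun i hi =>
    Function.update_of_ne (by omega) _ _
  have hup0 : Function.update a 0 b 0 = b := Function.update_self _ _ _
  refine ⟨b, Y, ⟨?_, ?_, ?_⟩, ?_, hne, ?_, ?_⟩
  · intro i hi j hj h1 h2
    simp only [Set.mem_ofPred_eq] at hi hj
    rcases Nat.eq_zero_or_pos i with rfl | hi0 <;> rcases Nat.eq_zero_or_pos j with rfl | hj0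
    · rfl
    · rw [hup0, hup j hj0] at h1
      exact absurd h1.symm (hne j hj0 (by omega))
    · rw [hup0, hup i hi0] at h1
      exact absurd h1 (hne i hi0 (by omega))
    · rcases lt_trichotomy i j with h | h | h
      · have := hmono i j hi0 h (by omega); linarith
      · exact h
      · have := hmono j i hj0 h (by omega); linarith
  · rintro i hi j hj (rfl | ⟨rfl, rfl⟩)
    · simp only [Set.mem_ofPred_eq] at hi hj
      rcases Nat.eq_zero_or_pos i with rfl | hi0
      · exact Or.inr (Or.inl (by rw [hY0, hY1]))
      · rw [hup i hi0, hup (i + 1) (by omega)]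
        apply slopeOK_of_abs
        have : Y (i + 1) - Y i = |a (i + 1) - a i| := by
          have := totalVar_add a hi0 (Nat.le_succ i)
          rw [totalVar_succ] at this
          simp only [hY]; linarith
        rw [this, abs_abs]
    · simp only [Nat.add_sub_cancel]
      rw [hup (n + 2) (by omega), hup0, hY0]
      apply slopeOK_of_abs
      rw [hb, show a (n + 2) + s * T - a (n + 2) = s * T by ring, abs_mul, habs, one_mul,
        zero_sub, abs_neg]
  · rintro i hi j hj l hl (rfl | ⟨rfl, rfl⟩) hli hlj hseg
    · simp only [Set.mem_ofPred_eq] at hi hj hl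
      rcases Nat.eq_zero_or_pos i with rfl | hi0
      · have h1 := hseg.y_le (b := 0) hY0.le hY1.le
        have := hmono 1 l le_rfl (by omega) (by omega)
        linarith
      · have hm1 := hmono i (i + 1) hi0 (by omega) (by omega)
        rcases Nat.eq_zero_or_pos l with rfl | hl0
        · obtain ⟨t, h0, h1, hx, hy⟩ := hseg
          have hi1 : Y i ≤ 0 := by
            rw [hY0] at hy
            have : 0 ≤ t * (Y (i + 1) - Y i) := mul_nonneg h0 (by linarith)
            linarith
          have hi2 : i = 1 := by
            by_contra hne1
            have := hmono 1 i le_rfl (by omega) (by omega)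
            linarith
          subst hi2
          rw [hY0, hY1] at hy
          have ht : t = 0 := by
            rcases mul_eq_zero.1 (show t * (Y 2 - 0) = 0 by linarith) with h | h
            · exact h
            · rw [hY1] at hm1; linarith
          rw [hup0, hup 1 le_rfl, ht] at hx
          exact hne 1 le_rfl (by omega) (by linarith)
        · have h1 := hseg.le_y (b := Y i) le_rfl hm1.le
          have h2 := hseg.y_le (b := Y (i + 1)) hm1.le le_rfl
          rcases Nat.lt_or_ge l i with h | h
          · have := hmono l i hl0 h (by omega); linarith
          · have := hmono (i + 1) l (by omega) (by omega) (by omega); linarith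
    · simp only [Set.mem_ofPred_eq, Nat.add_sub_cancel] at hi hj hl hli hseg
      have hl0 : 1 ≤ l := by omega
      have h1 := hseg.linear (a := 1) (b := s) (c := a (n + 2) + s * T)
        (by rw [hup (n + 2) (by omega)]; ring) (by rw [hup0, hY0, hb]; ring)
      rw [hup l hl0] at h1
      have h2 := hstar l hl0 (by omega)
      have h3 : s * (a l - a (n + 2)) = T - Y l := by
        linear_combination s * h1 + (T - Y l) * hss
      linarith
  · intro i hi
    rw [hY0]; exact totalVar_nonneg _ _ _
  · intro j hj hjm hdom
    -- For `j` before the end, the chain goes out to `a j` and back, so `T ≥ 2|a j| - |a 1| - |a (n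
    -- + 2)|`, and `|b|` is at least `T - |a (n + 2)|`. Three columns of size at most a third of `|a
    -- j|` are lost, whence the factor 3. If `j` is the end, the last step already points outwards.
    -- The way out from `1` is needed, so `j = 1` is not covered.
    have h1 := hdom 1 le_rfl (by omega) (by omega)
    rcases Nat.lt_or_ge j (n + 2) with h | h
    · have h2 := hdom (n + 2) (by omega) le_rfl (by omega)
      have h3 := abs_sub_le_totalVar a (show 1 ≤ j by omega)
      have h4 := abs_sub_le_totalVar a h.le
      have h5 := totalVar_add a (show 1 ≤ j by omega) h.le
      have h6 : |a j| - |a 1| ≤ |a j - a 1| := abs_sub_abs_le_abs_sub _ _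
      have h7 : |a j| - |a (n + 2)| ≤ |a (n + 2) - a j| := by
        rw [abs_sub_comm]; exact abs_sub_abs_le_abs_sub _ _
      have h8 : |s * T| - |a (n + 2)| ≤ |b| := by
        have := abs_sub_abs_le_abs_sub (s * T) (-a (n + 2))
        rw [abs_neg, sub_neg_eq_add, add_comm (s * T)] at this
        exact this
      rw [abs_mul, habs, one_mul, abs_of_pos hTpos] at h8
      linarith
    · have : j = n + 2 := by omega
      subst this
      have h2 := hdom (n + 1) (by omega) (by omega) (by omega)
      have hsa : s * a (n + 2) = |a (n + 2)| := by
        have h3 := hsle (-a (n + 1))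
        rw [abs_neg] at h3
        have h4 : 0 < s * a (n + 2) + s * -a (n + 1) := by linarith
        have h5 : |s * a (n + 2)| = |a (n + 2)| := by rw [abs_mul, habs, one_mul]
        rcases abs_cases (s * a (n + 2)) with ⟨h6, h7⟩ | ⟨h6, h7⟩
        · rw [← h6, h5]
        · have := abs_nonneg (a (n + 2)); linarith
      have h3 := hsle b
      have h4 : s * b = s * a (n + 2) + T := by rw [hb]; linear_combination T * hss
      linarith
  -- The last step has length `2 * τ` and goes to the right, so `b = τ + T` with `T ≥ 2 * τ`.
  · intro τ hτ h1 h2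
    rw [show n + 2 - 1 = n + 1 by omega] at h2
    have h3 := abs_sub_le_totalVar a (show n + 1 ≤ n + 2 by omega)
    have h4 := totalVar_add a (show 1 ≤ n + 1 by omega) (show n + 1 ≤ n + 2 by omega)
    have h5 := totalVar_nonneg a 1 (n + 1)
    rw [h1, h2, abs_of_pos (by linarith)] at h3
    have hs' : s = 1 := by
      rcases hs with h | h
      · exact h
      · rw [h, h1, h2] at hs1; linarith
    rw [hb, hs', h1]
    have := le_abs_self (τ + 1 * T)
    linarith

end Geometry

/-! ### Periodic enumeration of cycles -/

section Cyclic

variable {V : Type*}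

/-- `c` enumerates the vertices of the cycle `C` of `F` periodically, with period `k`. -/
structure CycEnum (F : SimpleGraph V) (C : Set V) (k : ℕ) (c : ℕ → V) : Prop where
  three_le : 3 ≤ k
  eq_iff : ∀ i j, c i = c j ↔ i ≡ j [MOD k]
  mem_iff : ∀ v, v ∈ C ↔ ∃ i, i < k ∧ c i = v
  adj_iff : ∀ i w, F.Adj (c i) w ↔ w = c (i + 1) ∨ w = c (i + (k - 1))

namespace CycEnum

variable {F : SimpleGraph V} {C : Set V} {k : ℕ} {c : ℕ → V}

theorem mem (h : CycEnum F C k c) (i : ℕ) : c i ∈ C := by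
  rw [h.mem_iff]
  refine ⟨i % k, Nat.mod_lt _ (by have := h.three_le; omega), ?_⟩
  rw [h.eq_iff]; exact Nat.mod_modEq _ _

theorem inj (h : CycEnum F C k c) {i j : ℕ} (hi : i < k) (hj : j < k) (hij : c i = c j) :
    i = j := by
  rw [h.eq_iff] at hij
  exact Nat.ModEq.eq_of_lt_of_lt hij hi hj

theorem shift (h : CycEnum F C k c) (b : ℕ) : CycEnum F C k (fun i => c (i + b)) where
  three_le := h.three_le
  eq_iff i j := by
    rw [h.eq_iff]
    exact ⟨fun h' => Nat.ModEq.add_right_cancel' b h', fun h' => h'.add_right b⟩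
  mem_iff v := by
    constructor
    · intro hv
      obtain ⟨i, hi, rfl⟩ := (h.mem_iff v).1 hv
      have hk : 0 < k := by have := h.three_le; omega
      -- Adding `(k - 1) * b` subtracts `b` modulo `k` and avoids truncated subtraction.
      refine ⟨(i + (k - 1) * b) % k, Nat.mod_lt _ hk, ?_⟩
      rw [h.eq_iff]
      have h1 : (i + (k - 1) * b) % k + b ≡ i + (k - 1) * b + b [MOD k] :=
        (Nat.mod_modEq _ _).add_right b
      refine h1.trans ?_
      obtain ⟨k', rfl⟩ : ∃ k', k = k' + 1 := ⟨k - 1, by omega⟩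
      have : i + (k' + 1 - 1) * b + b = i + (k' + 1) * b := by
        rw [Nat.add_sub_cancel]; ring
      rw [this]
      exact (Nat.modEq_iff_dvd' (by omega)).2 ⟨b, by rw [Nat.add_sub_cancel_left]⟩ |>.symm
    · rintro ⟨i, -, rfl⟩
      exact h.mem _
  adj_iff i w := by
    rw [h.adj_iff, show i + 1 + b = i + b + 1 by ring,
      show i + (k - 1) + b = i + b + (k - 1) by ring]

/-- Multiplication by `k - 1` is negation modulo `k`. It keeps `c 0` and exchanges `c 1` with `c (k
- 1)`. -/
theorem reverse (h : CycEnum F C k c) : CycEnum F C k (fun i => c ((k - 1) * i)) := by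
  obtain ⟨k', rfl⟩ : ∃ k', k = k' + 1 := ⟨k - 1, by have := h.three_le; omega⟩
  simp only [Nat.add_sub_cancel]
  have hz : ∀ i j : ℕ, i ≡ j [MOD k' + 1] ↔ (i : ZMod (k' + 1)) = j := fun i j =>
    (ZMod.natCast_eq_natCast_iff i j (k' + 1)).symm
  have hk : ((k' : ℕ) : ZMod (k' + 1)) = -1 := by
    have := ZMod.natCast_self (k' + 1)
    push_cast at this
    linear_combination this
  refine ⟨h.three_le, ?_, ?_, ?_⟩
  · intro i j
    rw [h.eq_iff, hz, hz]
    push_cast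
    rw [hk]
    constructor
    · intro h'; linear_combination -h'
    · intro h'; rw [h']
  · intro v
    constructor
    · intro hv
      obtain ⟨i, hi, rfl⟩ := (h.mem_iff v).1 hv
      refine ⟨(k' * i) % (k' + 1), Nat.mod_lt _ (by omega), ?_⟩
      rw [h.eq_iff, hz]
      push_cast [ZMod.natCast_mod]
      rw [hk]; ring
    · rintro ⟨i, -, rfl⟩
      exact h.mem _
  · intro i w
    rw [h.adj_iff, Nat.add_sub_cancel, or_comm]
    have h1 : c (k' * i + k') = c (k' * (i + 1)) := by rw [mul_add, mul_one]
    have h2 : c (k' * i + 1) = c (k' * (i + k')) := by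
      rw [h.eq_iff, hz]
      push_cast
      rw [hk]; ring
    rw [h1, h2]

theorem exists_index (h : CycEnum F C k c) : ∃ f : V → ℕ, (∀ v ∈ C, f v < k ∧ c (f v) = v) ∧
    ∀ i, i < k → f (c i) = i := by
  have hex : ∀ v, ∃ i, v ∈ C → i < k ∧ c i = v := fun v => by
    by_cases hv : v ∈ C
    · obtain ⟨i, hi⟩ := (h.mem_iff v).1 hv; exact ⟨i, fun _ => hi⟩
    · exact ⟨0, fun h' => absurd h' hv⟩
  choose f hf using hex
  exact ⟨f, hf, fun i hi => h.inj (hf _ (h.mem i)).1 hi (hf _ (h.mem i)).2⟩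

/-- A drawing of the standard cycle is a drawing of every enumerated cycle. -/
theorem validOn_of_cycStep (h : CycEnum F C k c) {X Y : ℕ → ℝ}
    (hval : ValidOn (CycStep k) {i | i < k} X Y) {f : V → ℕ} (hf : ∀ v ∈ C, f v < k ∧ c (f v) = v) :
    ValidOn F.Adj C (fun v => X (f v)) (fun v => Y (f v)) := by
  have h3 := h.three_le
  refine hval.symmetrize.comap (fun v hv => (hf v hv).1) ?_ ?_
  · intro u hu v hv huv
    rw [← (hf u hu).2, ← (hf v hv).2, huv]
  · intro u hu v hv huv
    have hi := (hf u hu).1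
    have hj := (hf v hv).1
    rw [← (hf u hu).2, h.adj_iff, ← (hf v hv).2, h.eq_iff, h.eq_iff] at huv
    simp only [CycStep]
    rcases huv with h' | h'
    · by_cases hik : f u + 1 < k
      · have := Nat.ModEq.eq_of_lt_of_lt h' hj hik; omega
      · have h2 : f u + 1 = k := by omega
        rw [h2] at h'
        have := Nat.ModEq.eq_of_lt_of_lt
          (h'.trans (Nat.modEq_zero_iff_dvd.2 dvd_rfl)) hj (by omega)
        omega
    · by_cases h0 : f u = 0
      · rw [h0, zero_add] at h'
        have := Nat.ModEq.eq_of_lt_of_lt h' hj (by omega); omega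
      · have h2 : f u + (k - 1) = f u - 1 + k := by omega
        rw [h2] at h'
        have := Nat.ModEq.eq_of_lt_of_lt (h'.trans (Nat.add_modEq_right)) hj (by omega)
        omega

/-- Drawing a cycle with prescribed horizontal positions of all vertices but one. -/
theorem exists_drawing (h : CycEnum F C k c) (ξ : V → ℝ)
    (hξ : ∀ u ∈ C, ∀ v ∈ C, F.Adj u v → u ≠ c 0 → v ≠ c 0 → ξ u ≠ ξ v) [DecidableEq V] :
    ∃ (b : ℝ) (y : V → ℝ), ValidOn F.Adj C (Function.update ξ (c 0) b) y ∧
      (∀ v ∈ C, y (c 0) ≤ y v) ∧ (∀ v ∈ C, v ≠ c 0 → ξ v ≠ b) ∧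
      (∀ q ∈ C, q ≠ c 0 → q ≠ c 1 →
        (∀ v ∈ C, v ≠ c 0 → v ≠ q → 3 * |ξ v| ≤ |ξ q|) → |ξ q| ≤ |b|) ∧
      (∀ τ, 0 < τ → ξ (c (k - 1)) = τ → ξ (c (k - 2)) = -τ → 3 * τ ≤ |b|) := by
  classical
  have h3 := h.three_le
  obtain ⟨f, hf, hfc⟩ := h.exists_index
  have hf0 : ∀ v ∈ C, v ≠ c 0 → 1 ≤ f v := by
    intro v hv hv0
    rcases Nat.eq_zero_or_pos (f v) with h0 | h0
    · exact absurd (by rw [← (hf v hv).2, h0]) hv0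
    · exact h0
  have hc0 : ∀ i, 1 ≤ i → i < k → c i ≠ c 0 := fun i hi hik h' => by
    have := h.inj hik (by omega) h'; omega
  obtain ⟨b, Y, hval, hlow, hne, hdom, hleaf⟩ := exists_closed_chain (fun i => ξ (c i)) (k - 1)
    (by omega) (by
      intro i hi hik
      exact hξ _ (h.mem i) _ (h.mem _) ((h.adj_iff i _).2 (Or.inl rfl)) (hc0 i hi (by omega))
        (hc0 _ (by omega) (by omega)))
  rw [show k - 1 + 1 = k by omega] at hval
  refine ⟨b, fun v => Y (f v), ?_, ?_, ?_, ?_, ?_⟩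
  · have h1 := h.validOn_of_cycStep hval hf
    refine h1.congr (fun v hv => ?_) (fun v hv => rfl)
    by_cases hv0 : v = c 0
    · subst hv0; simp [hfc 0 (by omega)]
    · have := hf0 v hv hv0
      rw [Function.update_of_ne hv0, Function.update_of_ne (by omega), (hf v hv).2]
  · intro v hv
    have := (hf v hv).1
    simp only [hfc 0 (by omega)]
    exact hlow _ (by omega)
  · intro v hv hv0
    have := hne (f v) (hf0 v hv hv0) (by have := (hf v hv).1; omega)
    rwa [(hf v hv).2] at this
  · intro q hq hq0 hq1 hd
    have h1 := hf0 q hq hq0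
    have h2 : f q ≠ 1 := fun h' => hq1 (by rw [← (hf q hq).2, h'])
    have h4 := (hf q hq).1
    have := hdom (f q) (by omega) (by omega) (by
      intro i hi hik hiq
      simp only [(hf q hq).2]
      refine hd (c i) (h.mem i) (hc0 i hi (by omega)) fun h' => hiq ?_
      rw [← h', hfc i (by omega)])
    simpa only [(hf q hq).2] using this
  · intro τ hτ h1 h2
    exact hleaf τ hτ h1 (by rw [show k - 1 - 1 = k - 2 by omega]; exact h2)

end CycEnum

end Cyclic

/-! ### Stacking the cycles of a two-factor -/

section Machine

variable {V : Type*}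

/-- A decomposition of the cubic graph `G` into a two-factor `F` and the perfect matching
given by the fixed-point-free involution `π`. -/
structure CubicFactor (G F : SimpleGraph V) (π : V → V) : Prop where
  adj_iff : ∀ u v, G.Adj u v ↔ F.Adj u v ∨ v = π u
  invol : ∀ v, π (π v) = v
  not_adj : ∀ v, ¬ F.Adj v (π v)
  cyc : ∀ v, ∃ k c, c 0 = v ∧
    CycEnum F {w | F.connectedComponentMk w = F.connectedComponentMk v} k c

/-- A drawing of the part `P` in which every vertex with partner outside of `P` sees upwards. -/
structure PartialDrawing (G : SimpleGraph V) (π : V → V) (P : Set V) (x y : V → ℝ) : Prop where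
  valid : ValidOn G.Adj P x y
  north : ∀ v ∈ P, π v ∉ P → ∀ w ∈ P, w ≠ v → x w = x v → y w < y v

/-- The vertex `q` is topmost, has its partner outside of `P`, and its column is far away from
the other active columns. -/
structure IsLatest (π : V → V) (P : Set V) (x y : V → ℝ) (q : V) : Prop where
  mem : q ∈ P
  active : π q ∉ P
  top : ∀ w ∈ P, y w ≤ y q
  ne_zero : x q ≠ 0
  far : ∀ v ∈ P, π v ∉ P → v ≠ q → 3 * |x v| ≤ |x q|

/-- Injective families of small positive numbers that avoid a finite set. -/
theorem exists_small_injective (α : Type*) [Finite α] {S : Set ℝ} (hS : S.Finite) {ε : ℝ}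
    (hε : 0 < ε) : ∃ η : α → ℝ, Function.Injective η ∧ ∀ e, 0 < η e ∧ η e < ε ∧ η e ∉ S := by
  have hinf : (Set.Ioo 0 ε \ S).Infinite := (Set.Ioo_infinite hε).sdiff hS
  obtain ⟨n, ⟨e⟩⟩ := Finite.exists_equiv_fin α
  refine ⟨fun a => hinf.natEmbedding _ (e a : ℕ), ?_, fun a => ?_⟩
  · intro a b hab
    have := (hinf.natEmbedding _).injective (Subtype.ext hab)
    exact e.injective (Fin.ext this)
  · have := (hinf.natEmbedding _ (e a : ℕ)).2
    exact ⟨this.1.1, this.1.2, this.2⟩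

namespace CubicFactor

variable {G F : SimpleGraph V} {π : V → V}

theorem ne (h : CubicFactor G F π) (v : V) : π v ≠ v := fun h' =>
  G.irrefl ((h.adj_iff v v).2 (Or.inr h'.symm))

/-- Chords of cycles are drawn in columns of their own. -/
theorem validOn_of_factor (h : CubicFactor G F π) {C : Set V} {x y : V → ℝ}
    (hC : ValidOn F.Adj C x y) (hinj : ∀ u ∈ C, ∀ v ∈ C, x u = x v → u = v ∨ v = π u)
    (hchord : ∀ v ∈ C, π v ∈ C → x (π v) = x v) : ValidOn G.Adj C x y where
  inj := hC.inj
  slope u hu v hv huv := by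
    rcases (h.adj_iff u v).1 huv with h' | rfl
    · exact hC.slope u hu v hv h'
    · exact Or.inl (hchord u hu hv).symm
  noSeg u hu v hv w hw huv hwu hwv hs := by
    rcases (h.adj_iff u v).1 huv with h' | rfl
    · exact hC.noSeg u hu v hv w hw h' hwu hwv hs
    · have hxw : x w = x u := by
        have := hs.linear (a := 1) (b := 0) (c := x u) (by ring) (by rw [hchord u hu hv]; ring)
        linarith
      rcases hinj u hu w hw hxw.symm with h' | h'
      · exact hwu h'.symm
      · exact absurd h' hwv

/-- Columns of a new component are columns of old partners and fresh ones. -/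
theorem columns_injective (h : CubicFactor G F π) {P C : Set V} {x y : V → ℝ}
    (hP : PartialDrawing G π P x y) (hPC : ∀ v ∈ C, v ∉ P) {η : Sym2 V → ℝ} {ξ : V → ℝ}
    (hη : ∀ u ∈ C, ∀ v ∈ C, π u ∉ P → π v ∉ P → η s(u, π u) = η s(v, π v) →
      s(u, π u) = s(v, π v))
    (hηx : ∀ u ∈ C, π u ∉ P → ∀ v ∈ P, π v ∉ P → η s(u, π u) ≠ x v)
    (hξP : ∀ v ∈ C, π v ∈ P → ξ v = x (π v)) (hξη : ∀ v ∈ C, π v ∉ P → ξ v = η s(v, π v))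
    {u v : V} (hu : u ∈ C) (hv : v ∈ C) (huv : ξ u = ξ v) : u = v ∨ v = π u := by
  have key : ∀ w ∈ C, π (π w) ∉ P := fun w hw => by rw [h.invol]; exact hPC w hw
  by_cases hu' : π u ∈ P <;> by_cases hv' : π v ∈ P
  · rw [hξP u hu hu', hξP v hv hv'] at huv
    left
    by_contra hne
    have hne' : π u ≠ π v := fun h' => hne (by rw [← h.invol u, h', h.invol])
    -- Two distinct active vertices in one column would each lie strictly above the other.
    have h1 := hP.north _ hu' (key u hu) _ hv' hne'.symm huv.symm
    have h2 := hP.north _ hv' (key v hv) _ hu' hne' huv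
    linarith
  · rw [hξP u hu hu', hξη v hv hv'] at huv
    exact absurd huv.symm (hηx v hv hv' _ hu' (key u hu))
  · rw [hξη u hu hu', hξP v hv hv'] at huv
    exact absurd huv (hηx u hu hu' _ hv' (key v hv))
  · rw [hξη u hu hu', hξη v hv hv'] at huv
    have := hη u hu v hv hu' hv' huv
    rw [Sym2.eq_iff] at this
    rcases this with ⟨h', -⟩ | ⟨-, h'⟩
    · exact Or.inl h'
    · exact Or.inr h'.symm

end CubicFactor

open Classical in
/-- The function equal to `f` on `C` and to `g` elsewhere. -/
noncomputable def glue (C : Set V) (f g : V → ℝ) : V → ℝ := fun v => if v ∈ C then f v else g v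

theorem glue_mem {C : Set V} {f g : V → ℝ} {v : V} (hv : v ∈ C) : glue C f g v = f v := if_pos hv

theorem glue_notMem {C : Set V} {f g : V → ℝ} {v : V} (hv : v ∉ C) : glue C f g v = g v :=
  if_neg hv

namespace CubicFactor

variable {G F : SimpleGraph V} {π : V → V} [Finite V]

/-- Placing a new component above a partial drawing. -/
theorem extend (h : CubicFactor G F π) {P C : Set V} {x y ξ yC : V → ℝ}
    (hP : PartialDrawing G π P x y) (hPC : ∀ v ∈ C, v ∉ P)
    (hF : ∀ u ∈ P, ∀ v ∈ C, ¬ F.Adj u v) (hC : ValidOn F.Adj C ξ yC)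
    (hinj : ∀ u ∈ C, ∀ v ∈ C, ξ u = ξ v → u = v ∨ v = π u)
    (hchord : ∀ v ∈ C, π v ∈ C → ξ (π v) = ξ v) (hξP : ∀ v ∈ C, π v ∈ P → ξ v = x (π v))
    (havoid : ∀ u ∈ C, ∀ v ∈ P, π v ∉ P → π v ∉ C → ξ u ≠ x v)
    {p : V} (hp : p ∈ C) (hpP : π p ∉ P) (hpC : π p ∉ C) (hlow : ∀ v ∈ C, yC p ≤ yC v)
    (hp0 : ξ p ≠ 0) (hfarP : ∀ v ∈ P, π v ∉ P → π v ∉ C → 3 * |x v| ≤ |ξ p|)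
    (hfarC : ∀ v ∈ C, π v ∉ P → π v ∉ C → v ≠ p → 3 * |ξ v| ≤ |ξ p|) :
    ∃ x' y', PartialDrawing G π (P ∪ C) x' y' ∧ IsLatest π (P ∪ C) x' y' p := by
  obtain ⟨B, -, hB⟩ := exists_abs_le y
  obtain ⟨B', -, hB'⟩ := exists_abs_le yC
  set x' := glue C ξ x with hx'
  -- The component is turned upside down, which makes its lowest vertex `p` topmost, and is lifted
  -- above all of `P`. Vertical edges down to `P` stay free because a column of `C` holds only
  -- vertices of a single matching edge.
  set y' := glue C (fun v => (B + B' + 1) - yC v) y with hy'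
  have hPx : ∀ v ∈ P, x' v = x v := fun v hv => glue_notMem fun h' => hPC v h' hv
  have hPy : ∀ v ∈ P, y' v = y v := fun v hv => glue_notMem fun h' => hPC v h' hv
  have hCx : ∀ v ∈ C, x' v = ξ v := fun v hv => glue_mem hv
  have hCy : ∀ v ∈ C, y' v = (B + B' + 1) - yC v := fun v hv => glue_mem hv
  have hlt : ∀ u ∈ P, ∀ v ∈ C, y' u < y' v := by
    intro u hu v hv
    rw [hPy u hu, hCy v hv]
    have h1 := (abs_le.1 (hB u)).2
    have h2 := (abs_le.1 (hB' v)).2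
    linarith
  have hmem : ∀ v, π v ∉ P ∪ C ↔ π v ∉ P ∧ π v ∉ C := fun v => by simp
  refine ⟨x', y', ⟨?_, ?_⟩, ⟨Or.inr hp, ?_, ?_, ?_, ?_⟩⟩
  · refine ValidOn.stack (fun _ _ => SimpleGraph.Adj.symm) (hP.valid.congr hPx hPy)
      (((h.validOn_of_factor hC hinj hchord).flip _).congr hCx hCy) hlt ?_
    intro u hu v hv huv
    rcases (h.adj_iff u v).1 huv with h' | rfl
    · exact absurd h' (hF u hu v hv)
    · have h1 : π (π u) ∈ P := by rwa [h.invol]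
      left
      refine ⟨?_, ?_, ?_⟩
      · rw [hPx u hu, hCx _ hv, hξP _ hv h1, h.invol]
      · intro w hw hwu hxw
        rw [hPx u hu, hPx w hw] at hxw
        rw [hPy u hu, hPy w hw]
        exact hP.north u hu (hPC _ hv) w hw hwu hxw
      · intro w hw hwu hxw
        rw [hCx w hw, hCx _ hv] at hxw
        rcases hinj _ hv w hw hxw.symm with h' | h'
        · exact absurd h'.symm hwu
        · exact absurd (h' ▸ h1) (hPC w hw)
  · intro v hv hv' w hw hwv hxw
    rw [hmem] at hv'
    rcases hv with hv | hv <;> rcases hw with hw | hw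
    · rw [hPx v hv, hPx w hw] at hxw
      rw [hPy v hv, hPy w hw]
      exact hP.north v hv hv'.1 w hw hwv hxw
    · rw [hPx v hv, hCx w hw] at hxw
      exact absurd hxw (havoid w hw v hv hv'.1 hv'.2)
    · exact hlt w hw v hv
    · rw [hCx v hv, hCx w hw] at hxw
      rcases hinj v hv w hw hxw.symm with h' | h'
      · exact absurd h'.symm hwv
      · exact absurd (h' ▸ hw) hv'.2
  · rw [hmem]; exact ⟨hpP, hpC⟩
  · rintro w (hw | hw)
    · exact (hlt w hw p hp).le
    · rw [hCy w hw, hCy p hp]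
      have := hlow w hw
      linarith
  · rwa [hCx p hp]
  · intro v hv hv' hvp
    rw [hmem] at hv'
    rcases hv with hv | hv
    · rw [hPx v hv, hCx p hp]; exact hfarP v hv hv'.1 hv'.2
    · rw [hCx v hv, hCx p hp]; exact hfarC v hv hv'.1 hv'.2 hvp

/-- Adding a component that is joined to the latest vertex of a partial drawing. -/
theorem join (h : CubicFactor G F π) {P : Set V} {x y : V → ℝ} (hP : PartialDrawing G π P x y)
    {q : V} (hq : IsLatest π P x y q) {C : Set V} (hPC : ∀ v ∈ C, v ∉ P)
    (hF : ∀ u ∈ P, ∀ v ∈ C, ¬ F.Adj u v) (hqC : π q ∈ C) {k : ℕ} {c : ℕ → V}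
    (hc : CycEnum F C k c) (hpP : π (c 0) ∉ P) (hpC : π (c 0) ∉ C) :
    ∃ x' y', PartialDrawing G π (P ∪ C) x' y' ∧ IsLatest π (P ∪ C) x' y' (c 0) := by
  classical
  -- The growth estimate for the free column does not cover `c 1`. If the partner of `q` is there,
  -- the cycle is run in the other direction.
  wlog h1 : π q ≠ c 1 generalizing c with H
  · have h3 := hc.three_le
    have := H hc.reverse (by simpa using hpP) (by simpa using hpC) (by
      intro h'
      rw [not_not.1 h1] at h'
      have := hc.inj (by omega) (by omega) h'
      omega)
    simpa using this
  have hxq : 0 < |x q| := abs_pos.2 hq.ne_zero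
  -- Fresh columns stay below `|x q| / 3` to keep the latest column dominant, and avoid all old
  -- columns. They are indexed by unordered pairs, so that both ends of a chord receive the same
  -- one.
  obtain ⟨η, hη, hη'⟩ := exists_small_injective (Sym2 V) (Set.finite_range x)
    (show 0 < |x q| / 3 by linarith)
  set ξ : V → ℝ := fun v => if π v ∈ P then x (π v) else η s(v, π v) with hξ
  have hξP : ∀ v ∈ C, π v ∈ P → ξ v = x (π v) := fun v _ hv => if_pos hv
  have hξη : ∀ v ∈ C, π v ∉ P → ξ v = η s(v, π v) := fun v _ hv => if_neg hv
  have hinj : ∀ u ∈ C, ∀ v ∈ C, ξ u = ξ v → u = v ∨ v = π u := fun u hu v hv huv =>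
    h.columns_injective hP hPC (fun _ _ _ _ _ _ h' => hη h')
      (fun u _ _ v _ _ h' => (hη' _).2.2 ⟨v, h'.symm⟩) hξP hξη hu hv huv
  obtain ⟨b, yC, hval, hlow, hne, hdom, -⟩ := hc.exists_drawing ξ (by
    intro u hu v hv huv _ _ h'
    rcases hinj u hu v hv h' with rfl | rfl
    · exact F.irrefl huv
    · exact h.not_adj _ huv)
  have hq0 : π q ≠ c 0 := fun h' => hpP (by rw [← h', h.invol]; exact hq.mem)
  have hξq : ξ (π q) = x q := by
    rw [hξP _ hqC (by rw [h.invol]; exact hq.mem), h.invol]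
  have hsmall : ∀ v ∈ C, v ≠ π q → 3 * |ξ v| ≤ |x q| := by
    intro v hv hvq
    by_cases hvP : π v ∈ P
    · rw [hξP v hv hvP]
      exact hq.far _ hvP (by rw [h.invol]; exact hPC v hv)
        fun h' => hvq (by rw [← h', h.invol])
    · rw [hξη v hv hvP]
      have := hη' s(v, π v)
      rw [abs_of_pos this.1]; linarith
  have hb : |x q| ≤ |b| := by
    have := hdom (π q) hqC hq0 h1 (by
      intro v hv _ hvq
      rw [hξq]; exact hsmall v hv hvq)
    rwa [hξq] at this
  have hup0 : Function.update ξ (c 0) b (c 0) = b := Function.update_self _ _ _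
  have hup : ∀ v, v ≠ c 0 → Function.update ξ (c 0) b v = ξ v := fun v hv =>
    Function.update_of_ne hv _ _
  refine h.extend hP hPC hF hval ?_ ?_ ?_ ?_ (hc.mem 0) hpP hpC hlow ?_ ?_ ?_
  · intro u hu v hv huv
    by_cases hu0 : u = c 0 <;> by_cases hv0 : v = c 0
    · exact Or.inl (hu0.trans hv0.symm)
    · rw [hu0, hup0, hup v hv0] at huv
      exact absurd huv.symm (hne v hv hv0)
    · rw [hv0, hup0, hup u hu0] at huv
      exact absurd huv (hne u hu hu0)
    · rw [hup u hu0, hup v hv0] at huv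
      exact hinj u hu v hv huv
  · intro v hv hv'
    have h2 : v ≠ c 0 := fun h' => hpC (h' ▸ hv')
    have h3 : π v ≠ c 0 := fun h' => hpC (by rw [← h', h.invol]; exact hv)
    rw [hup v h2, hup _ h3, hξη v hv (hPC _ hv'), hξη _ hv' (by rw [h.invol]; exact hPC v hv),
      h.invol, Sym2.eq_swap]
  · intro v hv hv'
    rw [hup v fun h' => hpP (h' ▸ hv'), hξP v hv hv']
  · intro u hu v hv hvP hvC h'
    by_cases hu0 : u = c 0
    · rw [hu0, hup0] at h'
      have h2 := hq.far v hv hvP fun h'' => hvC (h'' ▸ hqC)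
      rw [← h'] at h2
      linarith
    · rw [hup u hu0] at h'
      by_cases huP : π u ∈ P
      · rw [hξP u hu huP] at h'
        have hne' : π u ≠ v := fun h'' => hvC (by rw [← h'', h.invol]; exact hu)
        have h2 := hP.north _ huP (by rw [h.invol]; exact hPC u hu) v hv hne'.symm h'.symm
        have h3 := hP.north v hv hvP _ huP hne' h'
        linarith
      · rw [hξη u hu huP] at h'
        exact (hη' _).2.2 ⟨v, h'.symm⟩
  · rw [hup0]
    intro h'
    rw [h', abs_zero] at hb
    linarith
  · intro v hv hvP hvC
    rw [hup0]
    exact (hq.far v hv hvP fun h'' => hvC (h'' ▸ hqC)).trans hb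
  · intro v hv hvP hvC hv0
    rw [hup0, hup v hv0]
    exact (hsmall v hv fun h' => hvP (by rw [h', h.invol]; exact hq.mem)).trans hb

/-- Adding a component without edges to a partial drawing. -/
theorem leaf (h : CubicFactor G F π) {P : Set V} {x y : V → ℝ} (hP : PartialDrawing G π P x y)
    {C : Set V} (hPC : ∀ v ∈ C, v ∉ P) (hF : ∀ u ∈ P, ∀ v ∈ C, ¬ F.Adj u v)
    (hπ : ∀ v ∈ C, π v ∉ P) {k : ℕ} {c : ℕ → V} (hc : CycEnum F C k c) (hpC : π (c 0) ∉ C) :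
    ∃ x' y', PartialDrawing G π (P ∪ C) x' y' ∧ IsLatest π (P ∪ C) x' y' (c 0) := by
  classical
  have h3 := hc.three_le
  obtain ⟨B, hB0, hB⟩ := exists_abs_le x
  obtain ⟨η₀, hη, hη'⟩ := exists_small_injective (Sym2 V) (Set.finite_range x) hB0
  -- The value `τ` exceeds every old column. With the last two chain vertices at `-τ` and `τ`, the
  -- free vertex lands at distance at least `3 * τ`, three times any other active column, old or
  -- new.
  set τ := B + 1 with hτ
  set e₁ : Sym2 V := s(c (k - 1), π (c (k - 1))) with he₁
  set e₂ : Sym2 V := s(c (k - 2), π (c (k - 2))) with he₂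
  have hadj : F.Adj (c (k - 2)) (c (k - 1)) := (hc.adj_iff _ _).2
    (Or.inl (by rw [show k - 2 + 1 = k - 1 by omega]))
  have he : e₂ ≠ e₁ := by
    intro h'
    rw [he₁, he₂, Sym2.eq_iff] at h'
    rcases h' with ⟨h', -⟩ | ⟨-, h'⟩
    · exact hadj.ne h'
    · exact h.not_adj _ (h' ▸ hadj)
  set η : Sym2 V → ℝ := fun e => if e = e₁ then τ else if e = e₂ then -τ else η₀ e with hηdef
  have hη1 : η e₁ = τ := if_pos rfl
  have hη2 : η e₂ = -τ := by simp only [hηdef, if_neg he, if_true]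
  have hη3 : ∀ e, e ≠ e₁ → e ≠ e₂ → η e = η₀ e := fun e h1 h2 => by
    simp only [hηdef]; rw [if_neg h1, if_neg h2]
  have hηabs : ∀ e, |η e| ≤ τ := by
    intro e
    by_cases h1 : e = e₁
    · rw [h1, hη1, abs_of_pos (by linarith)]
    · by_cases h2 : e = e₂
      · rw [h2, hη2, abs_neg, abs_of_pos (by linarith)]
      · rw [hη3 e h1 h2, abs_of_pos (hη' e).1]
        have := (hη' e).2.1; linarith
  have hηinj : Function.Injective η := by
    intro d e hde
    have hpos := hη' d
    have hpos' := hη' e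
    by_cases h1 : d = e₁ <;> by_cases h2 : e = e₁
    · exact h1.trans h2.symm
    · rw [h1, hη1] at hde
      by_cases h4 : e = e₂
      · rw [h4, hη2] at hde; linarith
      · rw [hη3 e h2 h4] at hde; linarith
    · rw [h2, hη1] at hde
      by_cases h4 : d = e₂
      · rw [h4, hη2] at hde; linarith
      · rw [hη3 d h1 h4] at hde; linarith
    · by_cases h4 : d = e₂ <;> by_cases h5 : e = e₂
      · exact h4.trans h5.symm
      · rw [h4, hη2, hη3 e h2 h5] at hde; linarith
      · rw [h5, hη2, hη3 d h1 h4] at hde; linarith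
      · rw [hη3 d h1 h4, hη3 e h2 h5] at hde; exact hη hde
  have hηx : ∀ e v, η e ≠ x v := by
    intro e v h'
    have := abs_le.1 (hB v)
    by_cases h1 : e = e₁
    · rw [h1, hη1] at h'; linarith
    · by_cases h2 : e = e₂
      · rw [h2, hη2] at h'; linarith
      · rw [hη3 e h1 h2] at h'
        exact (hη' e).2.2 ⟨v, h'.symm⟩
  set ξ : V → ℝ := fun v => η s(v, π v) with hξ
  have hinj : ∀ u ∈ C, ∀ v ∈ C, ξ u = ξ v → u = v ∨ v = π u := fun u hu v hv huv =>
    h.columns_injective hP hPC (fun _ _ _ _ _ _ h' => hηinj h')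
      (fun u _ _ v _ _ => hηx _ _) (fun v hv hv' => absurd hv' (hπ v hv)) (fun _ _ _ => rfl)
      hu hv huv
  obtain ⟨b, yC, hval, hlow, hne, -, hleaf⟩ := hc.exists_drawing ξ (by
    intro u hu v hv huv _ _ h'
    rcases hinj u hu v hv h' with rfl | rfl
    · exact F.irrefl huv
    · exact h.not_adj _ huv)
  have hb : 3 * τ ≤ |b| := hleaf τ (by linarith) hη1 hη2
  have hup0 : Function.update ξ (c 0) b (c 0) = b := Function.update_self _ _ _
  have hup : ∀ v, v ≠ c 0 → Function.update ξ (c 0) b v = ξ v := fun v hv =>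
    Function.update_of_ne hv _ _
  refine h.extend hP hPC hF hval ?_ ?_ ?_ ?_ (hc.mem 0) (hπ _ (hc.mem 0)) hpC hlow ?_ ?_ ?_
  · intro u hu v hv huv
    by_cases hu0 : u = c 0 <;> by_cases hv0 : v = c 0
    · exact Or.inl (hu0.trans hv0.symm)
    · rw [hu0, hup0, hup v hv0] at huv
      exact absurd huv.symm (hne v hv hv0)
    · rw [hv0, hup0, hup u hu0] at huv
      exact absurd huv (hne u hu hu0)
    · rw [hup u hu0, hup v hv0] at huv
      exact hinj u hu v hv huv
  · intro v hv hv'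
    have h2 : v ≠ c 0 := fun h' => hpC (h' ▸ hv')
    have h3 : π v ≠ c 0 := fun h' => hpC (by rw [← h', h.invol]; exact hv)
    rw [hup v h2, hup _ h3]
    simp only [hξ]
    rw [h.invol, Sym2.eq_swap]
  · intro v hv hv'
    exact absurd hv' (hπ v hv)
  · intro u hu v hv hvP hvC h'
    by_cases hu0 : u = c 0
    · rw [hu0, hup0] at h'
      have := hB v
      rw [← h'] at this
      linarith
    · rw [hup u hu0] at h'
      exact hηx _ _ h'
  · rw [hup0]
    intro h'
    rw [h', abs_zero] at hb
    linarith
  · intro v hv hvP hvC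
    rw [hup0]
    have := hB v
    linarith
  · intro v hv hvP hvC hv0
    rw [hup0, hup v hv0]
    have := hηabs s(v, π v)
    simp only [hξ]
    linarith

/-- Completing the drawing with the last component. -/
theorem finish (h : CubicFactor G F π) {P : Set V} {x y : V → ℝ} (hP : PartialDrawing G π P x y)
    {q : V} (hq : IsLatest π P x y q) {C : Set V} (hPC : ∀ v ∈ C, v ∉ P)
    (hF : ∀ u ∈ P, ∀ v ∈ C, ¬ F.Adj u v) {k : ℕ} {c : ℕ → V}
    (hc : CycEnum F C k c) (hqc : π q = c 0) :
    ∃ x' y', ValidOn G.Adj (P ∪ C) x' y' := by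
  classical
  obtain ⟨η, hη, hη'⟩ := exists_small_injective (Sym2 V) (Set.finite_range x) one_pos
  set ξ : V → ℝ := fun v => if π v ∈ P then x (π v) else η s(v, π v) with hξ
  have hξP : ∀ v ∈ C, π v ∈ P → ξ v = x (π v) := fun v _ hv => if_pos hv
  have hξη : ∀ v ∈ C, π v ∉ P → ξ v = η s(v, π v) := fun v _ hv => if_neg hv
  have hinj : ∀ u ∈ C, ∀ v ∈ C, ξ u = ξ v → u = v ∨ v = π u := fun u hu v hv huv =>
    h.columns_injective hP hPC (fun _ _ _ _ _ _ h' => hη h')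
      (fun u _ _ v _ _ h' => (hη' _).2.2 ⟨v, h'.symm⟩) hξP hξη hu hv huv
  obtain ⟨b, yC, hval, hlow, hne, -, -⟩ := hc.exists_drawing ξ (by
    intro u hu v hv huv _ _ h'
    rcases hinj u hu v hv h' with rfl | rfl
    · exact F.irrefl huv
    · exact h.not_adj _ huv)
  have hc0P : π (c 0) ∈ P := by rw [← hqc, h.invol]; exact hq.mem
  have hup0 : Function.update ξ (c 0) b (c 0) = b := Function.update_self _ _ _
  have hup : ∀ v, v ≠ c 0 → Function.update ξ (c 0) b v = ξ v := fun v hv =>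
    Function.update_of_ne hv _ _
  have hinj' : ∀ u ∈ C, ∀ v ∈ C, Function.update ξ (c 0) b u = Function.update ξ (c 0) b v →
      u = v ∨ v = π u := by
    intro u hu v hv huv
    by_cases hu0 : u = c 0 <;> by_cases hv0 : v = c 0
    · exact Or.inl (hu0.trans hv0.symm)
    · rw [hu0, hup0, hup v hv0] at huv
      exact absurd huv.symm (hne v hv hv0)
    · rw [hv0, hup0, hup u hu0] at huv
      exact absurd huv (hne u hu hu0)
    · rw [hup u hu0, hup v hv0] at huv
      exact hinj u hu v hv huv
  have hval' : ValidOn G.Adj C (Function.update ξ (c 0) b) yC := by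
    refine h.validOn_of_factor hval hinj' ?_
    intro v hv hv'
    have h2 : v ≠ c 0 := fun h' => hPC _ hv' (h' ▸ hc0P)
    have h3 : π v ≠ c 0 := fun h' => hPC v hv (by rw [← h.invol v, h']; exact hc0P)
    rw [hup v h2, hup _ h3, hξη v hv (hPC _ hv'), hξη _ hv' (by rw [h.invol]; exact hPC v hv),
      h.invol, Sym2.eq_swap]
  -- The columns of `q` and `c 0` are both fixed by now, but the vertical gap `t` is not. A gap
  -- equal to the horizontal distance makes the edge diagonal; in equal columns any positive gap
  -- does.
  obtain ⟨t, ht, hts⟩ : ∃ t : ℝ, 0 < t ∧ SlopeOK (x q) (y q) b (y q + t) := by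
    by_cases hbq : x q = b
    · exact ⟨1, one_pos, Or.inl hbq⟩
    · refine ⟨|b - x q|, abs_pos.2 (sub_ne_zero.2 (Ne.symm hbq)), slopeOK_of_abs ?_⟩
      rw [add_sub_cancel_left, abs_abs]
  set x' := glue C (Function.update ξ (c 0) b) x with hx'
  set y' := glue C (fun v => yC v + (y q + t - yC (c 0))) y with hy'
  have hPx : ∀ v ∈ P, x' v = x v := fun v hv => glue_notMem fun h' => hPC v h' hv
  have hPy : ∀ v ∈ P, y' v = y v := fun v hv => glue_notMem fun h' => hPC v h' hv
  have hCx : ∀ v ∈ C, x' v = Function.update ξ (c 0) b v := fun v hv => glue_mem hv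
  have hCy : ∀ v ∈ C, y' v = yC v + (y q + t - yC (c 0)) := fun v hv => glue_mem hv
  refine ⟨x', y', ValidOn.stack (fun _ _ => SimpleGraph.Adj.symm) (hP.valid.congr hPx hPy)
    ((hval'.translate 0 _).congr (fun v hv => by rw [hCx v hv, add_zero]) hCy) ?_ ?_⟩
  · intro u hu v hv
    rw [hPy u hu, hCy v hv]
    have h1 := hq.top u hu
    have h2 := hlow v hv
    linarith
  · intro u hu v hv huv
    rcases (h.adj_iff u v).1 huv with h' | rfl
    · exact absurd h' (hF u hu v hv)
    by_cases huq : u = q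
    · subst huq
      right
      refine ⟨?_, ?_, ?_⟩
      · rw [hPx u hu, hPy u hu, hCx _ hv, hCy _ hv, hqc, hup0]
        convert hts using 1; ring
      · intro w hw
        rw [hPy u hu, hPy w hw]; exact hq.top w hw
      · intro w hw
        rw [hCy _ hv, hCy w hw, hqc]
        have := hlow w hw
        linarith
    · left
      have h1 : π (π u) ∈ P := by rwa [h.invol]
      have hu0 : π u ≠ c 0 := fun h' => huq (by rw [← h.invol u, h', ← hqc, h.invol])
      refine ⟨?_, ?_, ?_⟩
      · rw [hPx u hu, hCx _ hv, hup _ hu0, hξP _ hv h1, h.invol]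
      · intro w hw hwu hxw
        rw [hPx u hu, hPx w hw] at hxw
        rw [hPy u hu, hPy w hw]
        exact hP.north u hu (hPC _ hv) w hw hwu hxw
      · intro w hw hwu hxw
        rw [hCx w hw, hCx _ hv] at hxw
        rcases hinj' _ hv w hw hxw.symm with h' | h'
        · exact absurd h'.symm hwu
        · exact absurd (h' ▸ h1) (hPC w hw)

end CubicFactor

end Machine

/-! ### The order in which the cycles are drawn -/

section Visiting

variable {V : Type*}

namespace CubicFactor

variable {G F : SimpleGraph V} {π : V → V}

/-- Some matching edge joins the components `c` and `d` of `F`. -/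
def Linked (F : SimpleGraph V) (π : V → V) (c d : F.ConnectedComponent) : Prop :=
  ∃ v, F.connectedComponentMk v = c ∧ F.connectedComponentMk (π v) = d

/-- The set `L` of components can be visited by a greedy search that ends in the given
component. -/
inductive Visited (F : SimpleGraph V) (π : V → V) :
    F.ConnectedComponent → Set F.ConnectedComponent → Prop
  | base (g : F.ConnectedComponent) : Visited F π g {g}
  | step {c d : F.ConnectedComponent} {L : Set F.ConnectedComponent} : Visited F π c L → d ∉ L →
      (Linked F π c d ∨ ((∀ e, e ∉ L → ¬ Linked F π c e) ∧ ∃ b ∈ L, Linked F π b d)) →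
      Visited F π d (insert d L)

theorem Visited.mem {c : F.ConnectedComponent} {L : Set F.ConnectedComponent}
    (h : Visited F π c L) : c ∈ L := by
  cases h with
  | base g => rfl
  | step _ _ _ => exact Set.mem_insert _ _

theorem Linked.symm (h : CubicFactor G F π) {c d : F.ConnectedComponent}
    (hcd : Linked F π c d) : Linked F π d c := by
  obtain ⟨v, hv, hv'⟩ := hcd
  exact ⟨π v, hv', by rw [h.invol, hv]⟩

/-- An edge that leaves a union of components of `F` is not in `F`, so it belongs to the matching.
-/
theorem exists_linked (h : CubicFactor G F π)
    (hconn : ∀ Z : Set V, Z.Nonempty → Zᶜ.Nonempty → ∃ u ∈ Z, ∃ v ∉ Z, G.Adj u v)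
    {L : Set F.ConnectedComponent} (hL : L.Nonempty) (hL' : Lᶜ.Nonempty) :
    ∃ b ∈ L, ∃ d ∉ L, Linked F π b d := by
  obtain ⟨c, hc⟩ := hL
  obtain ⟨d, hd⟩ := hL'
  induction c using SimpleGraph.ConnectedComponent.ind with | _ a
  induction d using SimpleGraph.ConnectedComponent.ind with | _ b
  obtain ⟨u, hu, v, hv, huv⟩ := hconn {w | F.connectedComponentMk w ∈ L} ⟨a, hc⟩ ⟨b, hd⟩
  rcases (h.adj_iff u v).1 huv with h' | rfl
  · have : F.connectedComponentMk u = F.connectedComponentMk v :=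
      SimpleGraph.ConnectedComponent.sound h'.reachable
    exact absurd (this ▸ hu : F.connectedComponentMk v ∈ L) hv
  · exact ⟨_, hu, _, hv, u, rfl, rfl⟩

/-- A maximal visited set is everything: the search goes on from its last component if that has a
link to the outside, and otherwise from any component that has one, which connectivity provides. -/
theorem exists_visited_univ [Finite V] (h : CubicFactor G F π)
    (hconn : ∀ Z : Set V, Z.Nonempty → Zᶜ.Nonempty → ∃ u ∈ Z, ∃ v ∉ Z, G.Adj u v)
    (g : F.ConnectedComponent) : ∃ c, Visited F π c Set.univ := by
  have hfin : Finite F.ConnectedComponent := Quot.finite _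
  obtain ⟨L, ⟨c, hc⟩, hmax⟩ := (Set.toFinite {L | ∃ c, Visited F π c L}).exists_maximal
    ⟨{g}, g, Visited.base g⟩
  by_cases hL : L = Set.univ
  · exact ⟨c, hL ▸ hc⟩
  exfalso
  have hmax' : ∀ d, d ∉ L → ¬ Visited F π d (insert d L) := fun d hd hvis =>
    hd (hmax ⟨d, hvis⟩ (Set.subset_insert _ _) (Set.mem_insert _ _))
  by_cases hcd : ∃ d, d ∉ L ∧ Linked F π c d
  · obtain ⟨d, hd, hcd⟩ := hcd
    exact hmax' d hd (hc.step hd (Or.inl hcd))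
  · push Not at hcd
    obtain ⟨b, hb, d, hd, hbd⟩ := h.exists_linked hconn ⟨c, hc.mem⟩
      (Set.nonempty_compl.2 hL)
    exact hmax' d hd (hc.step hd (Or.inr ⟨hcd, b, hb, hbd⟩))

/-- The search is drawn backwards: the components outside `L` are already placed, and the one
visited last in `L` comes next. Either it contains the partner of the latest vertex, or it has no
link to what is drawn. The new free vertex is chosen on the link by which the search entered the
component, and the two alternatives of `Visited.step` reproduce this dichotomy. At the very end
connectivity excludes the second case. -/
theorem exists_validOn_of_visited [Finite V] (h : CubicFactor G F π)
    (hconn : ∀ Z : Set V, Z.Nonempty → Zᶜ.Nonempty → ∃ u ∈ Z, ∃ v ∉ Z, G.Adj u v)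
    (htwo : ∀ g : F.ConnectedComponent, ∃ d, d ≠ g)
    {c : F.ConnectedComponent} {L : Set F.ConnectedComponent} (hvis : Visited F π c L) :
    ∀ x y, PartialDrawing G π {v | F.connectedComponentMk v ∉ L} x y →
      ((∃ q, IsLatest π {v | F.connectedComponentMk v ∉ L} x y q ∧
        F.connectedComponentMk (π q) = c) ∨ ∀ e, e ∉ L → ¬ Linked F π c e) →
      ∃ x' y', ValidOn G.Adj Set.univ x' y' := by
  have hFadj : ∀ (g : F.ConnectedComponent) (M : Set F.ConnectedComponent), g ∈ M →
      ∀ u ∈ {v | F.connectedComponentMk v ∉ M}, ∀ v ∈ {v | F.connectedComponentMk v = g},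
        ¬ F.Adj u v := by
    intro g M hg u hu v hv huv
    have : F.connectedComponentMk u = F.connectedComponentMk v :=
      SimpleGraph.ConnectedComponent.sound huv.reachable
    simp only [Set.mem_ofPred_eq] at hu hv
    exact hu (by rw [this, hv]; exact hg)
  induction hvis with
  | base g =>
    intro x y hP hst
    rcases hst with ⟨q, hq, hqg⟩ | hno
    · obtain ⟨k, c, hc0, hc⟩ := h.cyc (π q)
      rw [hqg] at hc
      obtain ⟨x', y', hval⟩ := h.finish hP hq (fun v hv hv' => hv' hv)
        (hFadj g _ rfl) hc hc0.symm
      refine ⟨x', y', hval.mono (fun v _ => ?_) fun _ _ _ _ h' => h'⟩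
      by_cases hv : F.connectedComponentMk v = g
      · exact Or.inr hv
      · exact Or.inl hv
    · exfalso
      obtain ⟨d, hd⟩ := htwo g
      obtain ⟨b, hb, e, he, hbe⟩ := h.exists_linked hconn (L := {g}) ⟨g, rfl⟩ ⟨d, hd⟩
      rw [Set.mem_singleton_iff] at hb
      exact hno e he (hb ▸ hbe)
  | @step c d L hvis hd hcd ih =>
    intro x y hP hst
    have key : ∀ p, F.connectedComponentMk p = d → F.connectedComponentMk (π p) ∈ L →
        ∃ x' y', PartialDrawing G π {v | F.connectedComponentMk v ∉ L} x' y' ∧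
          IsLatest π {v | F.connectedComponentMk v ∉ L} x' y' p := by
      intro p hp hpL
      obtain ⟨k, c', hc0, hc⟩ := h.cyc p
      rw [hp] at hc
      have hunion : {v | F.connectedComponentMk v ∉ insert d L} ∪
          {v | F.connectedComponentMk v = d} = {v | F.connectedComponentMk v ∉ L} := by
        ext v
        simp only [Set.mem_union, Set.mem_ofPred_eq, Set.mem_insert_iff]
        constructor
        · rintro (h' | h')
          · exact fun h'' => h' (Or.inr h'')
          · rw [h']; exact hd
        · intro h'
          by_cases hv : F.connectedComponentMk v = d
          · exact Or.inr hv
          · exact Or.inl fun h'' => h''.elim hv h'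
      have hpP : π (c' 0) ∉ {v | F.connectedComponentMk v ∉ insert d L} := by
        rw [hc0]; exact fun h' => h' (Or.inr hpL)
      have hpC : π (c' 0) ∉ {v | F.connectedComponentMk v = d} := by
        rw [hc0]; intro h'
        rw [Set.mem_ofPred_eq] at h'
        exact hd (h' ▸ hpL)
      have hdisj : ∀ v ∈ {v | F.connectedComponentMk v = d},
          v ∉ {v | F.connectedComponentMk v ∉ insert d L} := fun v hv hv' => hv' (Or.inl hv)
      rw [← hunion, ← hc0]
      rcases hst with ⟨q, hq, hqd⟩ | hno
      · exact h.join hP hq hdisj (hFadj d _ (Set.mem_insert _ _)) hqd hc hpP hpC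
      · exact h.leaf hP hdisj (hFadj d _ (Set.mem_insert _ _))
          (fun v hv hv' => hno _ hv' ⟨v, hv, rfl⟩) hc hpC
    rcases hcd with hcd | ⟨hno, b, hb, hbd⟩
    · obtain ⟨p, hp, hpc⟩ := Linked.symm h hcd
      obtain ⟨x', y', hP', hp'⟩ := key p hp (hpc ▸ hvis.mem)
      exact ih x' y' hP' (Or.inl ⟨p, hp', hpc⟩)
    · obtain ⟨p, hp, hpc⟩ := Linked.symm h hbd
      obtain ⟨x', y', hP', hp'⟩ := key p hp (hpc ▸ hb)
      exact ih x' y' hP' (Or.inr hno)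

/-- Connected graphs with a two-factor of at least two cycles can be drawn. -/
theorem exists_validOn_of_two_components [Finite V] (h : CubicFactor G F π)
    (hconn : ∀ Z : Set V, Z.Nonempty → Zᶜ.Nonempty → ∃ u ∈ Z, ∃ v ∉ Z, G.Adj u v)
    {u v : V} (huv : F.connectedComponentMk u ≠ F.connectedComponentMk v) :
    ∃ x y, ValidOn G.Adj Set.univ x y := by
  obtain ⟨c, hc⟩ := h.exists_visited_univ hconn (F.connectedComponentMk u)
  -- With all components visited, nothing is drawn yet. The coordinates 0 are irrelevant, and the
  -- first component has no links to the empty drawing.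
  refine h.exists_validOn_of_visited hconn ?_ hc 0 0 ⟨⟨?_, ?_, ?_⟩, ?_⟩ (Or.inr ?_)
  · intro g
    by_cases hg : F.connectedComponentMk u = g
    · exact ⟨_, fun h' => huv (hg.trans h'.symm)⟩
    · exact ⟨_, hg⟩
  all_goals simp

end CubicFactor

end Visiting

/-! ### Two-factors that consist of a single cycle -/

section Hamiltonian

/-- Drawing of the cycle `0, 1, …, m` with equal columns for `0` and `j`, and prescribed columns
for the other vertices. -/
theorem exists_two_chains (a : ℕ → ℝ) (m j : ℕ) (hj : 3 ≤ j) (hjm : j < m)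
    (ha : ∀ i, 1 ≤ i → i < m → i + 1 ≠ j → i ≠ j → a i ≠ a (i + 1))
    (hmax : ∀ i, a i ≤ a (j + 1)) (hlast : a (j - 2) < a (j - 1)) :
    ∃ (X Y : ℕ → ℝ), ValidOn (CycStep (m + 1)) {i | i < m + 1} X Y ∧ X 0 = X j ∧
      ∀ i, i ≠ 0 → i ≠ j → X i = a i ∧ X i < X 0 := by
  obtain ⟨j, rfl⟩ : ∃ j', j = j' + 2 := ⟨j - 2, by omega⟩
  simp only [Nat.add_sub_cancel, show j + 2 - 1 = j + 1 by omega, show j + 2 + 1 = j + 3 by omega]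
    at *
  -- After the shift of `j`, the special vertices are `0` and `j + 2`. The first chain runs from `1`
  -- to `j + 1`, the second from `j + 3` to `m`; `A` and `B` are their climbs.
  set A := totalVar a 1 (j + 1) with hA
  set B := totalVar a (j + 3) m with hB
  -- The height of `j + 2`: the diagonal from the top of the first chain, at height `b - a 1 + A`,
  -- descends to the right by `b - a (j + 1)`.
  set h := A + a (j + 1) - a 1 with hh
  have hhpos : 0 < h := by
    have h1 := totalVar_add a (show 1 ≤ j by omega) (show j ≤ j + 1 by omega)
    have h2 := abs_sub_le_totalVar a (show 1 ≤ j by omega)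
    rw [totalVar_succ, abs_of_pos (by linarith)] at h1
    have h3 := neg_abs_le (a j - a 1)
    linarith
  have hBnn : 0 ≤ B := totalVar_nonneg _ _ _
  -- The diagonal from `(b, h)` down to the left reaches the column of `j + 3` at height `-B`, where
  -- the second chain starts.
  set b := h + B + a (j + 3) with hb
  have hab : ∀ i, a i < b := fun i => by have := hmax i; linarith
  set X : ℕ → ℝ := fun i => if i = 0 ∨ i = j + 2 then b else a i with hX
  -- From `0` at `(b, 0)` a diagonal goes up to the left to `1`, and the first chain climbs from
  -- there, above height 0. The second chain climbs from `-B` to 0 and ends with a horizontal edge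
  -- to `0`. Only `0` and `j + 2` are in the rightmost column `b`.
  set Y : ℕ → ℝ := fun i => if i = 0 then 0 else if i < j + 2 then b - a 1 + totalVar a 1 i
    else if i = j + 2 then h else - totalVar a i m with hY
  have hX0 : X 0 = b := by simp [hX]
  have hXj : X (j + 2) = b := by simp [hX]
  have hXa : ∀ i, i ≠ 0 → i ≠ j + 2 → X i = a i := fun i h1 h2 => by simp [hX, h1, h2]
  have hY0 : Y 0 = 0 := by simp [hY]
  have hYj : Y (j + 2) = h := by simp [hY]
  have hYI : ∀ i, 1 ≤ i → i < j + 2 → Y i = b - a 1 + totalVar a 1 i := fun i h1 h2 => by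
    simp only [hY]; rw [if_neg (by omega), if_pos h2]
  have hYII : ∀ i, j + 2 < i → Y i = - totalVar a i m := fun i h1 => by
    simp only [hY]; rw [if_neg (by omega), if_neg (by omega), if_neg (by omega)]
  have hmonoI : ∀ i l, 1 ≤ i → i < l → l < j + 2 → Y i < Y l := by
    intro i l hi hil hl
    rw [hYI i hi (by omega), hYI l (by omega) hl]
    have h1 := totalVar_add a hi hil.le
    have h2 := totalVar_pos (a := a) hil (ha i hi (by omega) (by omega) (by omega))
    linarith
  have hmonoII : ∀ i l, j + 2 < i → i < l → l ≤ m → Y i < Y l := by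
    intro i l hi hil hl
    rw [hYII i hi, hYII l (by omega)]
    have h1 := totalVar_add a hil.le hl
    have h2 := totalVar_pos (a := a) hil (ha i (by omega) (by omega) (by omega) (by omega))
    linarith
  have hY1 : Y 1 = b - a 1 := by rw [hYI 1 le_rfl (by omega), totalVar_self, add_zero]
  have hYm : Y m = 0 := by rw [hYII m (by omega), totalVar_self, neg_zero]
  have hYIlow : ∀ i, 1 ≤ i → i < j + 2 → b - a 1 ≤ Y i := fun i h1 h2 => by
    rw [hYI i h1 h2]; have := totalVar_nonneg a 1 i; linarith
  have hYIpos : ∀ i, 1 ≤ i → i < j + 2 → 0 < Y i := fun i h1 h2 => by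
    have := hYIlow i h1 h2; have := hab 1; linarith
  have hYIIle : ∀ i, j + 2 < i → Y i ≤ 0 := fun i h1 => by
    rw [hYII i h1]; have := totalVar_nonneg a i m; linarith
  have hYIend : Y (j + 1) = b + h - a (j + 1) := by
    rw [hYI _ (by omega) (by omega), hh]; ring
  have hXlt : ∀ i, i ≠ 0 → i ≠ j + 2 → X i < b := fun i h1 h2 => by
    rw [hXa i h1 h2]; exact hab i
  have hcases : ∀ i, i = 0 ∨ (1 ≤ i ∧ i < j + 2) ∨ i = j + 2 ∨ j + 2 < i := fun i => by omega
  refine ⟨X, Y, ⟨?_, ?_, ?_⟩, by rw [hX0, hXj], fun i h1 h2 => ⟨hXa i h1 h2, ?_⟩⟩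
  · intro i hi l hl hx hy
    rw [Set.mem_ofPred_eq] at hi hl
    wlog hil : i ≤ l generalizing i l
    · exact (this l hl i hi hx.symm hy.symm (by omega)).symm
    rcases hil.eq_or_lt with hil | hil
    · exact hil
    exfalso
    rcases hcases i with rfl | ⟨h1, h2⟩ | rfl | h1
    · rcases hcases l with rfl | ⟨h3, h4⟩ | rfl | h3
      · omega
      · have := hXlt l (by omega) (by omega); linarith
      · linarith
      · have := hXlt l (by omega) (by omega); linarith
    · rcases hcases l with rfl | ⟨h3, h4⟩ | rfl | h3
      · omega
      · have := hmonoI i l h1 hil h4; linarith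
      · have := hXlt i (by omega) (by omega); linarith
      · have := hYIpos i h1 h2; have := hYIIle l h3; linarith
    · have := hXlt l (by omega) (by omega); linarith
    · have := hmonoII i l h1 hil (by omega); linarith
  · rintro i hi l hl (rfl | ⟨rfl, rfl⟩)
    · rw [Set.mem_ofPred_eq] at hi hl
      rcases hcases i with rfl | ⟨h1, h2⟩ | rfl | h1
      · rw [hX0, hY0, zero_add, hXa 1 (by omega) (by omega), hY1]
        exact Or.inr (Or.inr (Or.inr (by ring)))
      · by_cases h3 : i = j + 1
        · subst h3
          rw [hXa (j + 1) (by omega) (by omega), hXj, hYj, hYIend]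
          exact Or.inr (Or.inr (Or.inr (by ring)))
        · apply slopeOK_of_abs
          rw [hXa i (by omega) (by omega), hXa (i + 1) (by omega) (by omega), hYI i h1 h2,
            hYI (i + 1) (by omega) (by omega), ← totalVar_add a h1 (Nat.le_succ i), totalVar_succ,
            add_sub_add_left_eq_sub, add_sub_cancel_left, abs_abs]
      · rw [hXj, hYj, hXa _ (by omega) (by omega), hYII _ (by omega)]
        exact Or.inr (Or.inr (Or.inl (by rw [hb, hB]; ring)))
      · apply slopeOK_of_abs
        rw [hXa i (by omega) (by omega), hXa (i + 1) (by omega) (by omega), hYII i h1,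
          hYII (i + 1) (by omega), ← totalVar_add a (Nat.le_succ i) (show i + 1 ≤ m by omega),
          totalVar_succ]
        rw [show -totalVar a (i + 1) m - -(|a (i + 1) - a i| + totalVar a (i + 1) m)
          = |a (i + 1) - a i| by ring, abs_abs]
    · rw [hYm, hY0]
      exact Or.inr (Or.inl rfl)
  · rintro i hi l hl w hw (rfl | ⟨rfl, rfl⟩) hwi hwl hs
    · rw [Set.mem_ofPred_eq] at hi hl hw
      rcases hcases i with rfl | ⟨h1, h2⟩ | rfl | h1
      · rw [zero_add] at hs hwl
        have hY1pos := hYIpos 1 le_rfl (by omega)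
        have e1 := hs.le_y hY0.ge hY1pos.le
        have e2 := hs.y_le (b := Y 1) (by rw [hY0]; exact hY1pos.le) le_rfl
        have e3 := hs.linear (a := 1) (b := 1) (c := b) (by rw [hX0, hY0]; ring)
          (by rw [hXa 1 (by omega) (by omega), hY1]; ring)
        rcases hcases w with rfl | ⟨h3, h4⟩ | rfl | h3
        · exact hwi rfl
        · have := hmonoI 1 w le_rfl (by omega) h4; linarith
        · rw [hXj, hYj] at e3; linarith
        · have := hXlt w (by omega) (by omega)
          have := hYIIle w h3
          linarith
      · by_cases h3 : i = j + 1
        · subst h3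
          rw [show j + 1 + 1 = j + 2 by omega] at hs hwl
          have e0 := hab (j + 1)
          have e1 := hs.le_y (b := h) (by rw [hYIend]; linarith) (by rw [hYj])
          have e3 := hs.linear (a := 1) (b := 1) (c := b + h)
            (by rw [hXa (j + 1) (by omega) (by omega), hYIend]; ring) (by rw [hXj, hYj]; ring)
          rcases hcases w with rfl | ⟨h4, h5⟩ | rfl | h4
          · rw [hY0] at e1; linarith
          -- The sum of the coordinates never decreases along a climbing chain, and it grows
          -- strictly in the last step, which goes to the right. So earlier vertices are off this
          -- diagonal.
          · rw [hXa w (by omega) (by omega), hYI w h4 h5] at e3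
            have f1 := totalVar_add a h4 (show w ≤ j by omega)
            have f2 := totalVar_add a (show 1 ≤ j by omega) (show j ≤ j + 1 by omega)
            have f3 := abs_sub_le_totalVar a (show w ≤ j by omega)
            rw [totalVar_succ, abs_of_pos (by linarith)] at f2
            have f4 := neg_abs_le (a j - a w)
            linarith
          · exact hwl rfl
          · have := hYIIle w h4; linarith
        · have e0 := hmonoI i (i + 1) h1 (by omega) (by omega)
          have e1 := hs.le_y le_rfl e0.le
          have e2 := hs.y_le e0.le le_rfl
          have e3 := hs.x_le (b := max (X i) (X (i + 1))) (le_max_left _ _) (le_max_right _ _)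
          have e4 := max_lt (hXlt i (by omega) (by omega)) (hXlt (i + 1) (by omega) (by omega))
          rcases hcases w with rfl | ⟨h4, h5⟩ | rfl | h4
          · linarith
          · rcases Nat.lt_or_ge w i with h6 | h6
            · have := hmonoI w i h4 h6 h2; linarith
            · have := hmonoI (i + 1) w (by omega) (by omega) h5; linarith
          · linarith
          · have := hYIIle w h4
            have := hYIpos i h1 h2
            linarith
      · have hYII1 : Y (j + 2 + 1) = -B := hYII _ (by omega)
        have hXII1 := hXa (j + 2 + 1) (by omega) (by omega)
        have e2 := hs.y_le (b := h) hYj.le (by rw [hYII1]; linarith)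
        have e3 := hs.linear (a := 1) (b := -1) (c := b - h) (by rw [hXj, hYj]; ring)
          (by rw [hXII1, hYII1, hb]; ring)
        rcases hcases w with rfl | ⟨h4, h5⟩ | rfl | h4
        · rw [hX0, hY0] at e3; linarith
        · have f1 := hYIlow w h4 h5
          have f2 := hXlt w (by omega) (by omega)
          have f3 := hmax 1
          linarith
        · exact hwi rfl
        -- Later vertices of the second chain have a smaller remaining climb and, by maximality of
        -- `a (j + 3)`, no larger column, so `X w - Y w` is too small for this diagonal.
        · rw [hXa w (by omega) (by omega), hYII w h4] at e3
          have f1 := totalVar_add a (show j + 3 ≤ w by omega) (show w ≤ m by omega)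
          have f2 := totalVar_pos (a := a) (show j + 3 < w by omega)
            (ha _ (by omega) (by omega) (by omega) (by omega))
          have f3 := hmax w
          linarith
      · have e0 := hmonoII i (i + 1) h1 (by omega) (by omega)
        have e1 := hs.le_y le_rfl e0.le
        have e2 := hs.y_le e0.le le_rfl
        have e3 := hs.x_le (b := max (X i) (X (i + 1))) (le_max_left _ _) (le_max_right _ _)
        have e4 := max_lt (hXlt i (by omega) (by omega)) (hXlt (i + 1) (by omega) (by omega))
        rcases hcases w with rfl | ⟨h4, h5⟩ | rfl | h4
        · linarith
        · have := hYIIle (i + 1) (by omega)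
          have := hYIpos w h4 h5
          linarith
        · linarith
        · rcases Nat.lt_or_ge w i with h6 | h6
          · have := hmonoII w i h4 h6 (by omega); linarith
          · have := hmonoII (i + 1) w (by omega) (by omega) (by omega); linarith
    · rw [Set.mem_ofPred_eq] at hw
      have e1 := hs.le_y hYm.ge hY0.ge
      have e2 := hs.y_le hYm.le hY0.le
      rcases hcases w with rfl | ⟨h4, h5⟩ | rfl | h4
      · exact hwl rfl
      · have := hYIpos w h4 h5; linarith
      · linarith
      · have := hmonoII w _ h4 (by omega) le_rfl; linarith
  · rw [hX0]; exact hXlt i h1 h2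

/-- A unit square with both diagonals: $K_4$, with one crossing. Turned by half a right angle it
also carries the diamond at a vertex of degree two. -/
theorem validOn_square : ValidOn (fun _ _ : Fin 4 => True) Set.univ
    ![(0 : ℝ), 1, 1, 0] ![(0 : ℝ), 0, 1, 1] where
  inj u _ v _ h1 h2 := by
    fin_cases u <;> fin_cases v <;> simp_all
  slope u _ v _ _ := by
    fin_cases u <;> fin_cases v <;> simp [SlopeOK]
  noSeg u _ v _ w _ _ hwu hwv := by
    rintro ⟨t, h0, h1, hx, hy⟩
    fin_cases u <;> fin_cases v <;> fin_cases w <;> simp at hx hy hwu hwv <;> linarith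

/-- Adjacency by parity, listed from even to odd, is $K_{3,3}$: the six-cycle with its three long
chords. -/
theorem validOn_utility : ValidOn (fun i j : Fin 6 => i.val % 2 = 0 ∧ j.val % 2 = 1) Set.univ
    ![(0 : ℝ), 2, 1, 3, 3, 0] ![(0 : ℝ), 2, 2, 0, 1, 1] where
  inj u _ v _ h1 h2 := by
    fin_cases u <;> fin_cases v <;> simp_all
  slope u _ v _ h := by
    fin_cases u <;> fin_cases v <;> simp at h <;> norm_num [SlopeOK]
  noSeg u _ v _ w _ h hwu hwv := by
    rintro ⟨t, h0, h1, hx, hy⟩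
    fin_cases u <;> fin_cases v <;> simp at h <;> fin_cases w <;> simp at hx hy hwu hwv <;> linarith

namespace CubicFactor

variable {V : Type*} {G F : SimpleGraph V} {π : V → V} [Finite V] {n : ℕ} {c : ℕ → V}

/-- The chord from `0` to `j` takes the rightmost column. The matching edge at `j + 1` gets the
largest remaining column and that at `j - 1` the next one, so the first chain ends with a step to
the right. This only fails if `j - 2` shares the column of `j + 1`, which `hj2` excludes. -/
theorem exists_validOn_of_chord (h : CubicFactor G F π) (hc : CycEnum F Set.univ n c) {j : ℕ}
    (hj : 3 ≤ j) (hjn : j + 1 < n) (hj0 : π (c 0) = c j) (hj2 : π (c (j - 2)) ≠ c (j + 1)) :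
    ∃ x y, ValidOn G.Adj Set.univ x y := by
  classical
  obtain ⟨η, hη, hη'⟩ := exists_small_injective (Sym2 V) Set.finite_empty one_pos
  set e₁ : Sym2 V := s(c (j + 1), π (c (j + 1))) with he₁
  set e₂ : Sym2 V := s(c (j - 1), π (c (j - 1))) with he₂
  set ζ : Sym2 V → ℝ := fun e => if e = e₁ then 2 else if e = e₂ then 1 else η e with hζ
  have hζ1 : ζ e₁ = 2 := if_pos rfl
  have hζ2 : e₂ ≠ e₁ → ζ e₂ = 1 := fun he => by simp only [hζ, if_neg he, if_true]
  have hζ3 : ∀ e, e ≠ e₁ → e ≠ e₂ → ζ e = η e := fun e h1 h2 => by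
    simp only [hζ]; rw [if_neg h1, if_neg h2]
  have hζinj : Function.Injective ζ := by
    intro d e hde
    have hd := (hη' d).2.1
    have he := (hη' e).2.1
    by_cases h1 : d = e₁ <;> by_cases h2 : e = e₁
    · exact h1.trans h2.symm
    · rw [h1, hζ1] at hde
      by_cases h4 : e = e₂
      · rw [h4] at hde h2; rw [hζ2 h2] at hde; norm_num at hde
      · rw [hζ3 e h2 h4] at hde; linarith
    · rw [h2, hζ1] at hde
      by_cases h4 : d = e₂
      · rw [h4] at hde h1; rw [hζ2 h1] at hde; norm_num at hde
      · rw [hζ3 d h1 h4] at hde; linarith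
    · by_cases h4 : d = e₂ <;> by_cases h5 : e = e₂
      · exact h4.trans h5.symm
      · rw [h4] at hde h1; rw [hζ2 h1, hζ3 e h2 h5] at hde; linarith
      · rw [h5] at hde h2; rw [hζ2 h2, hζ3 d h1 h4] at hde; linarith
      · rw [hζ3 d h1 h4, hζ3 e h2 h5] at hde; exact hη hde
  have hζle : ∀ e, ζ e ≤ 2 := by
    intro e
    by_cases h1 : e = e₁
    · rw [h1, hζ1]
    · by_cases h2 : e = e₂
      · rw [h2] at h1 ⊢; rw [hζ2 h1]; norm_num
      · rw [hζ3 e h1 h2]; have := (hη' e).2.1; linarith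
  have hedge : ∀ u v, s(u, π u) = s(v, π v) → u = v ∨ v = π u := by
    intro u v huv
    rw [Sym2.eq_iff] at huv
    rcases huv with ⟨h', -⟩ | ⟨-, h'⟩
    · exact Or.inl h'
    · exact Or.inr h'.symm
  have hstep : ∀ i, F.Adj (c i) (c (i + 1)) := fun i => (hc.adj_iff _ _).2 (Or.inl rfl)
  have hedgeF : ∀ i, s(c i, π (c i)) ≠ s(c (i + 1), π (c (i + 1))) := by
    intro i h'
    rcases hedge _ _ h' with h' | h'
    · exact (hstep i).ne h'
    · exact h.not_adj _ (h' ▸ hstep i)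
  have hlast : ζ s(c (j - 2), π (c (j - 2))) < ζ s(c (j - 1), π (c (j - 1))) := by
    have h2 : s(c (j - 2), π (c (j - 2))) ≠ e₂ := by
      have := hedgeF (j - 2)
      rwa [show j - 2 + 1 = j - 1 by omega] at this
    have h1 : s(c (j - 2), π (c (j - 2))) ≠ e₁ := by
      intro h'
      rcases hedge _ _ h' with h' | h'
      · have := hc.inj (by omega) (by omega) h'; omega
      · exact hj2 h'.symm
    rw [hζ3 _ h1 h2]
    have h3 := (hη' s(c (j - 2), π (c (j - 2)))).2.1
    by_cases he : e₂ = e₁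
    · rw [← he₂, he, hζ1]; linarith
    · rw [← he₂, hζ2 he]; linarith
  obtain ⟨X, Y, hval, hXj, hXa⟩ := exists_two_chains (fun i => ζ s(c i, π (c i))) (n - 1) j hj
    (by omega) (fun i _ _ _ _ h' => hedgeF i (hζinj h')) (fun i => by
      change _ ≤ ζ e₁
      rw [hζ1]; exact hζle _) hlast
  rw [show n - 1 + 1 = n by omega] at hval
  obtain ⟨f, hf, hfc⟩ := hc.exists_index
  refine ⟨_, _, h.validOn_of_factor (hc.validOn_of_cycStep hval hf) ?_ ?_⟩
  · intro u hu v hv huv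
    have hu' := (hf u hu).2
    have hv' := (hf v hv).2
    by_cases hu0 : f u = 0 ∨ f u = j <;> by_cases hv0 : f v = 0 ∨ f v = j
    · have hpi : π (c j) = c 0 := by rw [← hj0, h.invol]
      rcases hu0 with h1 | h1 <;> rcases hv0 with h2 | h2 <;> rw [h1] at hu' <;> rw [h2] at hv'
      · exact Or.inl (hu'.symm.trans hv')
      · exact Or.inr (by rw [← hu', ← hv', hj0])
      · exact Or.inr (by rw [← hu', ← hv', hpi])
      · exact Or.inl (hu'.symm.trans hv')
    · push Not at hv0
      have h1 := (hXa _ hv0.1 hv0.2).2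
      have h2 : X (f u) = X 0 := by rcases hu0 with h' | h' <;> rw [h']; exact hXj.symm
      linarith
    · push Not at hu0
      have h1 := (hXa _ hu0.1 hu0.2).2
      have h2 : X (f v) = X 0 := by rcases hv0 with h' | h' <;> rw [h']; exact hXj.symm
      linarith
    · push Not at hu0 hv0
      simp only [(hXa _ hu0.1 hu0.2).1, (hXa _ hv0.1 hv0.2).1, hu', hv'] at huv
      exact hedge _ _ (hζinj huv)
  · intro v hv hv'
    by_cases hv0 : v = c 0
    · rw [hv0, hj0, hfc j (by omega), hfc 0 (by omega), hXj]
    by_cases hvj : v = c j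
    · rw [hvj, ← hj0, h.invol, hj0, hfc j (by omega), hfc 0 (by omega), hXj]
    have key : ∀ w, w ≠ c 0 → w ≠ c j → X (f w) = ζ s(w, π w) := by
      intro w h0 h1
      have hw := hf w (Set.mem_univ w)
      rw [(hXa (f w) (fun h' => h0 (by rw [← hw.2, h'])) fun h' => h1 (by rw [← hw.2, h'])).1, hw.2]
    rw [key v hv0 hvj, key (π v), h.invol, Sym2.eq_swap]
    · intro h'; exact hvj (by rw [← hj0, ← h', h.invol])
    · intro h'; exact hv0 (by rw [← h.invol v, h', ← hj0, h.invol])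

/-- Hamiltonian cubic graphs can be drawn. -/
theorem exists_validOn_of_hamiltonian (h : CubicFactor G F π) (hc : CycEnum F Set.univ n c) :
    ∃ x y, ValidOn G.Adj Set.univ x y := by
  have h3 := hc.three_le
  have hcong : ∀ i j m, c i = c j → c (i + m) = c (j + m) := fun i j m hij => by
    rw [hc.eq_iff] at hij ⊢; exact hij.add_right m
  by_cases hex : ∃ i, π (c i) ≠ c (i + 2) ∧ π (c i) ≠ c (i + 3)
  · obtain ⟨i, hi2, hi3⟩ := hex
    -- The chord at `c (i + 2)` is used, with the enumeration restarted at its other end. Then `i`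
    -- and `i + 3` play the roles of `j - 2` and `j + 1`, and the choice of `i` rules out `j = 2`
    -- and the forbidden matching edge.
    obtain ⟨l, hl, hlr⟩ := (hc.mem_iff (π (c (i + 2)))).1 (Set.mem_univ _)
    have hc' := hc.shift l
    obtain ⟨j, hj, hjr⟩ := (hc'.mem_iff (c (i + 2))).1 (Set.mem_univ _)
    have hπ : π (c l) = c (j + l) := by rw [hlr, h.invol]; exact hjr.symm
    have hnadj := h.not_adj (c l)
    rw [hπ, hc.adj_iff, not_or] at hnadj
    have hj0 : j ≠ 0 := fun h' => h.ne (c l) (by rw [hπ, h', zero_add])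
    have hj1 : j ≠ 1 := fun h' => hnadj.1 (by rw [h', add_comm])
    have hjn : j ≠ n - 1 := fun h' => hnadj.2 (by rw [h', add_comm])
    have hi : c (j - 2 + l) = c i := by
      rw [hc.eq_iff] at hjr ⊢
      rw [show j + l = j - 2 + l + 2 by omega] at hjr
      exact Nat.ModEq.add_right_cancel' 2 hjr
    have hj2 : j ≠ 2 := by
      intro h'
      rw [h', Nat.sub_self, zero_add, hlr] at hi
      exact hi2 (by rw [← hi, h.invol])
    refine h.exists_validOn_of_chord hc' (j := j) (by omega) (by omega) ?_ ?_
    · simp only [zero_add]; exact hπ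
    · rw [hi, show j + 1 + l = j + l + 1 by ring, hcong (j + l) (i + 2) 1 hjr]
      exact hi3
  -- Every partner is now two or three steps ahead. If one is two steps ahead, the way back shows
  -- that `n` divides 4 or 5, and 5 is impossible. If all are three steps ahead, `n` divides 6 and
  -- is not 3.
  · push Not at hex
    have hex' : ∀ i, π (c i) = c (i + 2) ∨ π (c i) = c (i + 3) := fun i => by
      by_cases h' : π (c i) = c (i + 2)
      · exact Or.inl h'
      · exact Or.inr (hex i h')
    obtain ⟨f, hf, hfc⟩ := hc.exists_index
    have hfinj : ∀ u v, f u = f v → u = v := fun u v huv => by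
      rw [← (hf u trivial).2, ← (hf v trivial).2, huv]
    by_cases hsmall : ∃ i, π (c i) = c (i + 2)
    · obtain ⟨i, hi⟩ := hsmall
      have h4 : n = 4 := by
        have hmod : ∀ a b, c (i + a) = c (i + b) ↔ a ≡ b [MOD n] := fun a b => by
          rw [hc.eq_iff]
          exact ⟨fun h' => Nat.ModEq.add_left_cancel' i h', fun h' => h'.add_left i⟩
        have hpi2 : π (c (i + 2)) = c (i + 0) := by rw [← hi, h.invol, add_zero]
        have h2 := hex' (i + 2)
        rw [hpi2, add_assoc, add_assoc, hmod, hmod, Nat.ModEq.comm, Nat.modEq_zero_iff_dvd,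
          Nat.ModEq.comm, Nat.modEq_zero_iff_dvd] at h2
        rcases h2 with h2 | h2
        · have := Nat.le_of_dvd (by norm_num) h2
          interval_cases n <;> omega
        · have := Nat.le_of_dvd (by norm_num) h2
          have h5 : n = 5 := by interval_cases n <;> omega
          exfalso
          subst h5
          have e1 : π (c (i + 3)) = c (i + 1) := by
            rcases hex' (i + 3) with h' | h'
            · exfalso
              rw [add_assoc, (hmod 5 0).2 (by decide), add_zero] at h'
              have : c (i + 3) = c (i + 2) := by rw [← hi, ← h', h.invol]
              rw [hmod] at this
              exact absurd this (by decide)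
            · rw [h', add_assoc, (hmod 6 1).2 (by decide)]
          have e2 : π (c (i + 1)) = c (i + 3) := by rw [← e1, h.invol]
          rcases hex' (i + 4) with h' | h'
          · rw [add_assoc, (hmod 6 1).2 (by decide)] at h'
            have : c (i + 4) = c (i + 3) := by rw [← e2, ← h', h.invol]
            rw [hmod] at this
            exact absurd this (by decide)
          · rw [add_assoc, (hmod 7 2).2 (by decide)] at h'
            have : c (i + 4) = c (i + 0) := by rw [← hpi2, ← h', h.invol]
            rw [hmod] at this
            exact absurd this (by decide)
      subst h4
      exact ⟨_, _, validOn_square.comap (f := fun v => (⟨f v, (hf v trivial).1⟩ : Fin 4))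
        (fun _ _ => trivial) (fun u _ v _ huv => hfinj u v (congrArg Fin.val huv))
        fun _ _ _ _ _ => trivial⟩
    · push Not at hsmall
      have hpi : ∀ i, π (c i) = c (i + 3) := fun i => (hex' i).resolve_left (hsmall i)
      have h6 : n = 6 := by
        have h1 : c (0 + 3 + 3) = c 0 := by rw [← hpi, ← hpi, h.invol]
        rw [hc.eq_iff, Nat.modEq_zero_iff_dvd] at h1
        have := Nat.le_of_dvd (by norm_num) h1
        have hn3 : n ≠ 3 := by
          rintro rfl
          refine h.ne (c 0) ?_
          rw [hpi, hc.eq_iff]; decide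
        interval_cases n <;> omega
      subst h6
      refine ⟨_, _, validOn_utility.symmetrize.comap
        (f := fun v => (⟨f v, (hf v trivial).1⟩ : Fin 6))
        (fun _ _ => trivial) (fun u _ v _ huv => hfinj u v (congrArg Fin.val huv)) ?_⟩
      intro u _ v _ huv
      simp only
      have hu := hf u trivial
      have hv := hf v trivial
      rw [h.adj_iff, ← hu.2, ← hv.2, hc.adj_iff, hpi, hc.eq_iff, hc.eq_iff, hc.eq_iff] at huv
      simp only [Nat.ModEq] at huv
      omega

end CubicFactor

end Hamiltonian

/-! ### Petersen's theorem and the two-factor -/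

section Factor

variable {V : Type*} [Finite V] {G : SimpleGraph V}

theorem SimpleGraph.IsCycles.exists_cycEnum {F : SimpleGraph V} (hF : F.IsCycles) {v : V}
    (hv : (F.neighborSet v).Nonempty) : ∃ k c, c 0 = v ∧
      CycEnum F {w | F.connectedComponentMk w = F.connectedComponentMk v} k c := by
  classical
  have := Fintype.ofFinite V
  obtain ⟨p, hp, hverts⟩ :=
    hF.exists_cycle_toSubgraph_verts_eq_connectedComponentSupp (v := v)
      (c := F.connectedComponentMk v) rfl hv
  set k := p.length with hk
  have h3 : 3 ≤ k := hp.three_le_length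
  set c : ℕ → V := fun i => p.getVert (i % k) with hc
  have heq : ∀ i j, c i = c j ↔ i ≡ j [MOD k] := by
    intro i j
    constructor
    · intro h
      exact hp.getVert_injOn' (by
        have := Nat.mod_lt i (show 0 < k by omega)
        simp only [Set.mem_ofPred_eq]; omega) (by
        have := Nat.mod_lt j (show 0 < k by omega)
        simp only [Set.mem_ofPred_eq]; omega) h
    · intro h; simp only [hc]; rw [h]
  have hget : ∀ j, j ≤ k → p.getVert j = c j := by
    intro j hj
    rcases hj.eq_or_lt with rfl | hj
    · simp [hc, hk]
    · simp only [hc]; rw [Nat.mod_eq_of_lt hj]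
  have hmem : ∀ w, F.connectedComponentMk w = F.connectedComponentMk v ↔ w ∈ p.support := by
    intro w
    rw [← SimpleGraph.Walk.mem_verts_toSubgraph, hverts]; rfl
  refine ⟨k, c, by simp [hc], h3, heq, ?_, ?_⟩
  · intro w
    rw [Set.mem_ofPred_eq, hmem, SimpleGraph.Walk.mem_support_iff_exists_getVert]
    constructor
    · rintro ⟨j, rfl, hj⟩
      refine ⟨j % k, Nat.mod_lt _ (by omega), ?_⟩
      rw [hget j hj, heq]; exact Nat.mod_modEq _ _
    · rintro ⟨j, hj, rfl⟩
      exact ⟨j, hget j hj.le, hj.le⟩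
  · intro i w
    have hlt := Nat.mod_lt i (show 0 < k by omega)
    have hi : c i ∈ p.toSubgraph.verts := by
      rw [SimpleGraph.Walk.mem_verts_toSubgraph]
      exact p.getVert_mem_support _
    rw [← hp.adj_toSubgraph_iff_of_isCycles hF hi w, ← SimpleGraph.Subgraph.mem_neighborSet]
    have hci : c i = p.getVert (i % k) := rfl
    by_cases h0 : i % k = 0
    · have hi0 : 0 ≡ i [MOD k] := by rw [Nat.ModEq, h0, Nat.zero_mod]
      have : c i = v := by rw [hci, h0, p.getVert_zero]
      rw [this, hp.neighborSet_toSubgraph_endpoint, Set.mem_insert_iff, Set.mem_singleton_iff,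
        SimpleGraph.Walk.snd, SimpleGraph.Walk.penultimate, hget 1 (by omega),
        hget (p.length - 1) (by omega)]
      have h1 : c 1 = c (i + 1) := by
        rw [heq]; simpa only [zero_add] using hi0.add_right 1
      have h2 : c (p.length - 1) = c (i + (k - 1)) := by
        rw [heq]; simpa only [zero_add] using hi0.add_right (k - 1)
      rw [h1, h2]
    · rw [hci, hp.neighborSet_toSubgraph_internal h0 hlt, Set.mem_insert_iff,
        Set.mem_singleton_iff, hget _ (by omega), hget _ (by omega)]
      have h1 : c (i % k + 1) = c (i + 1) := by
        rw [heq]; exact (Nat.mod_modEq _ _).add_right 1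
      have h2 : c (i % k - 1) = c (i + (k - 1)) := by
        rw [heq]
        apply Nat.ModEq.add_right_cancel' 1
        rw [show i % k - 1 + 1 = i % k by omega, show i + (k - 1) + 1 = i + k by omega]
        exact (Nat.mod_modEq _ _).trans Nat.add_modEq_right.symm
      rw [h1, h2, or_comm]

/-- Removal of a perfect matching leaves a two-regular graph, whose components are cycles. -/
theorem exists_cubicFactor (hG : ∀ v, (G.neighborSet v).ncard = 3) {M : G.Subgraph}
    (hM : M.IsPerfectMatching) : ∃ F π, CubicFactor G F π := by
  choose π hπ hπ' using fun v => hM.1 (hM.2 v)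
  have hinv : ∀ v, π (π v) = v := fun v => (hπ' (π v) v (hπ v).symm).symm
  have hadj : ∀ v, G.Adj v (π v) := fun v => (hπ v).adj_sub
  let F : SimpleGraph V :=
    { Adj := fun u v => G.Adj u v ∧ v ≠ π u
      symm := ⟨fun u v h => ⟨h.1.symm, fun h' => h.2 (by rw [h', hinv])⟩⟩
      loopless := ⟨fun u h => G.irrefl h.1⟩ }
  have hN : ∀ v, (F.neighborSet v).ncard = 2 := by
    intro v
    have h1 : F.neighborSet v = G.neighborSet v \ {π v} := by
      ext w; simp [F]
    rw [h1, Set.ncard_sdiff_singleton_of_mem (show π v ∈ G.neighborSet v from hadj v), hG]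
  refine ⟨F, π, ?_, hinv, fun v h => h.2 rfl, fun v => ?_⟩
  · intro u v
    constructor
    · intro h
      by_cases h' : v = π u
      · exact Or.inr h'
      · exact Or.inl ⟨h, h'⟩
    · rintro (h | rfl)
      · exact h.1
      · exact hadj u
  · refine SimpleGraph.IsCycles.exists_cycEnum (fun w _ => hN w) ?_
    rw [← Set.ncard_pos, hN]; norm_num

/-- Ordered edges from `Z` to its complement. -/
def cutEdges {V : Type*} (G : SimpleGraph V) (Z : Set V) : Set (V × V) :=
  {e | e.1 ∈ Z ∧ e.2 ∉ Z ∧ G.Adj e.1 e.2}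

theorem ncard_edges_from (hG : ∀ v, (G.neighborSet v).ncard = 3) (Z : Set V) :
    {e : V × V | e.1 ∈ Z ∧ G.Adj e.1 e.2}.ncard = 3 * Z.ncard := by
  classical
  have := Fintype.ofFinite V
  rw [Set.ncard_eq_toFinset_card', Set.ncard_eq_toFinset_card' Z]
  rw [Finset.card_eq_sum_card_fiberwise (f := Prod.fst) (t := Z.toFinset)]
  · rw [Finset.sum_const_nat (m := 3), mul_comm]
    intro v hv
    rw [Set.mem_toFinset] at hv
    rw [← hG v, Set.ncard_eq_toFinset_card']
    refine Finset.card_bij (fun e _ => e.2) ?_ ?_ ?_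
    · intro e he
      simp only [Finset.mem_filter, Set.mem_toFinset, Set.mem_ofPred_eq] at he
      simp only [Set.mem_toFinset, SimpleGraph.mem_neighborSet]
      rw [← he.2]; exact he.1.2
    · intro e he e' he' h
      simp only [Finset.mem_filter, Set.mem_toFinset, Set.mem_ofPred_eq] at he he'
      exact Prod.ext (he.2.trans he'.2.symm) h
    · intro w hw
      simp only [Set.mem_toFinset, SimpleGraph.mem_neighborSet] at hw
      exact ⟨(v, w), by simp [hv, hw], rfl⟩
  · intro e he
    simp only [Set.coe_toFinset, Set.mem_ofPred_eq] at he ⊢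
    exact he.1

/-- The ordered edges that start in `Z` number `3 * Z.ncard`, which is odd. Those that also end in
`Z` are paired off by reversal. -/
theorem odd_ncard_cutEdges (hG : ∀ v, (G.neighborSet v).ncard = 3) {Z : Set V}
    (hZ : Odd Z.ncard) : Odd (cutEdges G Z).ncard := by
  classical
  have := Fintype.ofFinite V
  have h1 := ncard_edges_from hG Z
  set I : Set (V × V) := {e | e.1 ∈ Z ∧ e.2 ∈ Z ∧ G.Adj e.1 e.2} with hI
  have h2 : {e : V × V | e.1 ∈ Z ∧ G.Adj e.1 e.2} = I ∪ cutEdges G Z := by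
    ext e
    simp only [hI, cutEdges, Set.mem_ofPred_eq, Set.mem_union]
    tauto
  have h3 : Disjoint I (cutEdges G Z) := by
    rw [Set.disjoint_left]
    intro e he he'
    exact he'.2.1 he.2.1
  rw [h2, Set.ncard_union_eq h3] at h1
  have h4 : Even I.ncard := by
    have : (∑ _e ∈ I.toFinset, (1 : ZMod 2)) = 0 := by
      refine Finset.sum_involution (fun e _ => e.swap) ?_ ?_ ?_ ?_
      · intro e _; decide
      · intro e he _ h'
        rw [Set.mem_toFinset] at he
        have : e.1 = e.2 := (congrArg Prod.fst h').symm
        exact he.2.2.ne this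
      · intro e he
        rw [Set.mem_toFinset] at he ⊢
        exact ⟨he.2.1, he.1, he.2.2.symm⟩
      · intro e _; exact Prod.swap_swap e
    rw [Finset.sum_const, nsmul_eq_mul, mul_one, ZMod.natCast_eq_zero_iff_even,
      ← Set.ncard_eq_toFinset_card'] at this
    exact this
  have h5 : Odd (3 * Z.ncard) := (by decide : Odd 3).mul hZ
  rw [← h1, Nat.odd_add] at h5
  by_contra h6
  rw [Nat.not_odd_iff_even] at h6
  exact (Nat.not_even_iff_odd.2 (h5.2 h6)) h4

/-- Petersen: cubic graphs without small cuts have perfect matchings. -/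
theorem exists_isPerfectMatching (hG : ∀ v, (G.neighborSet v).ncard = 3)
    (hcut : ∀ Z : Set V, Z.Nonempty → Zᶜ.Nonempty → 2 ≤ (cutEdges G Z).ncard) :
    ∃ M : G.Subgraph, M.IsPerfectMatching := by
  classical
  have := Fintype.ofFinite V
  rw [SimpleGraph.tutte]
  intro u hu
  rw [SimpleGraph.IsTutteViolator] at hu
  set H := ((⊤ : G.Subgraph).deleteVerts u).coe with hH
  set Z : H.ConnectedComponent → Set V := fun K => Subtype.val '' K.supp with hZ
  have hcutu : ∀ K, ∀ e ∈ cutEdges G (Z K), e.2 ∈ u := by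
    rintro K ⟨a, b⟩ ⟨⟨a', ha', rfl⟩, hb, hab⟩
    by_contra hbu
    simp only at hb hab hbu
    refine hb ⟨⟨b, by simp, hbu⟩, ?_, rfl⟩
    rw [SimpleGraph.ConnectedComponent.mem_supp_iff] at ha' ⊢
    rw [← ha']
    refine SimpleGraph.ConnectedComponent.sound (SimpleGraph.Adj.reachable ?_)
    simp only [hH, SimpleGraph.Subgraph.coe_adj, SimpleGraph.Subgraph.deleteVerts_adj]
    have := a'.2.2
    simp [hbu, this, hab.symm]
  -- Parity improves the bound two to three.
  have hthree : ∀ K ∈ H.oddComponents, 3 ≤ (cutEdges G (Z K)).ncard := by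
    intro K hK
    have h1 : Odd (Z K).ncard := by
      rw [Set.ncard_image_of_injective _ Subtype.val_injective]; exact hK
    have h2 := odd_ncard_cutEdges hG h1
    have h3 : (cutEdges G (Z K)).Nonempty := Set.nonempty_of_ncard_ne_zero h2.pos.ne'
    obtain ⟨e, he⟩ := h3
    have h4 := hcut (Z K) ⟨e.1, he.1⟩ ⟨e.2, he.2.1⟩
    obtain ⟨m, hm⟩ := h2
    omega
  have hfin : Finite H.ConnectedComponent := Quot.finite _
  have := Fintype.ofFinite H.ConnectedComponent
  have h1 := ncard_edges_from hG u
  -- The edges that leave different odd components are distinct and all end in `u`, which has only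
  -- `3 * u.ncard` edge ends. Hence there are at most `u.ncard` odd components, as Tutte's condition
  -- demands.
  have h2 : ∑ K ∈ H.oddComponents.toFinset, (cutEdges G (Z K)).ncard ≤ 3 * u.ncard := by
    rw [← h1]
    simp only [Set.ncard_eq_toFinset_card']
    rw [← Finset.card_biUnion]
    · refine Finset.card_le_card_of_injOn Prod.swap ?_ (Prod.swap_injective.injOn)
      intro e he
      simp only [Finset.coe_biUnion, Set.mem_iUnion, Set.coe_toFinset] at he
      obtain ⟨K, -, he⟩ := he
      simp only [Set.coe_toFinset]
      exact ⟨hcutu K e he, he.2.2.symm⟩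
    · intro K _ K' _ hKK'
      refine Finset.disjoint_left.2 ?_
      intro e he he'
      rw [Set.mem_toFinset] at he he'
      obtain ⟨a, ha, hae⟩ := he.1
      obtain ⟨b, hb, hbe⟩ := he'.1
      have : a = b := Subtype.ext (hae.trans hbe.symm)
      subst this
      rw [SimpleGraph.ConnectedComponent.mem_supp_iff] at ha hb
      exact hKK' (ha.symm.trans hb)
  have h3 : 3 * H.oddComponents.ncard ≤
      ∑ K ∈ H.oddComponents.toFinset, (cutEdges G (Z K)).ncard := by
    rw [Set.ncard_eq_toFinset_card', mul_comm, ← smul_eq_mul]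
    refine Finset.card_nsmul_le_sum _ _ _ fun K hK => hthree K (by simpa using hK)
  omega

/-- Cubic graphs without bridges can be drawn. -/
theorem exists_validOn_of_cut (hG : ∀ v, (G.neighborSet v).ncard = 3)
    (hcut : ∀ Z : Set V, Z.Nonempty → Zᶜ.Nonempty → 2 ≤ (cutEdges G Z).ncard) :
    ∃ x y, ValidOn G.Adj Set.univ x y := by
  obtain ⟨M, hM⟩ := exists_isPerfectMatching hG hcut
  obtain ⟨F, π, h⟩ := exists_cubicFactor hG hM
  by_cases hcomp : ∃ u v, F.connectedComponentMk u ≠ F.connectedComponentMk v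
  · obtain ⟨u, v, huv⟩ := hcomp
    refine h.exists_validOn_of_two_components (fun Z h1 h2 => ?_) huv
    have h3 := hcut Z h1 h2
    obtain ⟨e, he⟩ := Set.nonempty_of_ncard_ne_zero (show (cutEdges G Z).ncard ≠ 0 by omega)
    exact ⟨e.1, he.1, e.2, he.2.1, he.2.2⟩
  · push Not at hcomp
    rcases isEmpty_or_nonempty V with hV | ⟨⟨v⟩⟩
    · exact ⟨0, 0, fun u => isEmptyElim u, fun u => isEmptyElim u, fun u => isEmptyElim u⟩
    · obtain ⟨k, c, -, hc⟩ := h.cyc v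
      have : {w | F.connectedComponentMk w = F.connectedComponentMk v} = Set.univ := by
        ext w; exact iff_of_true (hcomp w v) trivial
      rw [this] at hc
      exact h.exists_validOn_of_hamiltonian hc

end Factor

/-! ### Vertices of degree two: suppression and caps -/

section Caps

variable {V : Type*}

/-- Every vertex of `W` has three neighbours, all of them in `W`. -/
structure CubicOn (G : SimpleGraph V) (W : Set V) : Prop where
  three : ∀ v ∈ W, (G.neighborSet v).ncard = 3
  closed : ∀ v ∈ W, ∀ w, G.Adj v w → w ∈ W

/-- The vertex `s` of `W` has two neighbours, the others have three, all of them in `W`. -/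
structure NearCubicOn (G : SimpleGraph V) (W : Set V) (s : V) : Prop where
  mem : s ∈ W
  two : (G.neighborSet s).ncard = 2
  three : ∀ v ∈ W, v ≠ s → (G.neighborSet v).ncard = 3
  closed : ∀ v ∈ W, ∀ w, G.Adj v w → w ∈ W

/-- A drawing in which `s` sees upwards and its two edges form a flat or a right-angled cap. -/
structure CapDrawing (G : SimpleGraph V) (W : Set V) (s : V) (x y : V → ℝ) : Prop where
  valid : ValidOn G.Adj W x y
  north : ∀ w ∈ W, w ≠ s → x w = x s → y w < y s
  cap : ∃ (κ : ℝ) (p q : V), (κ = 0 ∨ κ = 1) ∧ (∀ w, G.Adj s w ↔ w = p ∨ w = q) ∧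
    x p < x s ∧ x s < x q ∧ y s - y p = κ * (x s - x p) ∧ y s - y q = κ * (x q - x s)

theorem pos_of_mul_pos_of_nonneg {a b : ℝ} (hab : 0 < a * b) (ha : 0 ≤ a) : 0 < b := by
  by_contra hb
  exact absurd hab (not_lt.2 (mul_nonpos_of_nonneg_of_nonpos ha (not_lt.1 hb)))

theorem onSeg_of_horizontal {x y : V → ℝ} {u v w : V} (hu : y w = y u) (hv : y w = y v)
    (h1 : x u ≤ x w) (h2 : x w ≤ x v) (huv : x u < x v) : OnSeg x y u v w := by
  refine ⟨(x w - x u) / (x v - x u), div_nonneg (by linarith) (by linarith),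
    (div_le_one (by linarith)).2 (by linarith), ?_, ?_⟩
  · rw [div_mul_cancel₀ _ (by linarith)]; ring
  · rw [← hu, ← hv]; ring

/-- A drawing can be turned to make a given edge horizontal. -/
theorem ValidOn.exists_horizontal {A : V → V → Prop} {W : Set V} {x y : V → ℝ}
    (h : ValidOn A W x y) {a b : V} (hs : SlopeOK (x a) (y a) (x b) (y b)) :
    ∃ x' y', ValidOn A W x' y' ∧ y' a = y' b := by
  rcases hs with hs | hs | hs | hs
  · exact ⟨_, _, h.rotate.rotate, by linarith⟩
  · exact ⟨_, _, h, hs⟩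
  · exact ⟨_, _, h.rotate.rotate.rotate, by linarith⟩
  · exact ⟨_, _, h.rotate, by linarith⟩

/-- The graph obtained by replacing the path `a s b` by the edge `ab`. -/
def suppress (G : SimpleGraph V) (s a b : V) : SimpleGraph V :=
  SimpleGraph.fromRel fun u v => (G.Adj u v ∧ u ≠ s ∧ v ≠ s) ∨ (u = a ∧ v = b)

theorem suppress_adj {G : SimpleGraph V} {s a b : V} (hab : a ≠ b) {u v : V} :
    (suppress G s a b).Adj u v ↔
      (G.Adj u v ∧ u ≠ s ∧ v ≠ s) ∨ (u = a ∧ v = b) ∨ (u = b ∧ v = a) := by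
  rw [suppress, SimpleGraph.fromRel_adj]
  constructor
  · rintro ⟨-, (h | h) | (h | h)⟩
    · exact Or.inl h
    · exact Or.inr (Or.inl h)
    · exact Or.inl ⟨h.1.symm, h.2.2, h.2.1⟩
    · exact Or.inr (Or.inr ⟨h.2, h.1⟩)
  · rintro (h | ⟨rfl, rfl⟩ | ⟨rfl, rfl⟩)
    · exact ⟨h.1.ne, Or.inl (Or.inl h)⟩
    · exact ⟨hab, Or.inl (Or.inr ⟨rfl, rfl⟩)⟩
    · exact ⟨hab.symm, Or.inr (Or.inr ⟨rfl, rfl⟩)⟩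

/-- The vertices `a` and `b` trade `s` for each other. Their nonadjacency keeps both degrees at
three. -/
theorem NearCubicOn.cubicOn_suppress [Finite V] {G : SimpleGraph V} {W : Set V} {s a b : V}
    (h : NearCubicOn G W s) (hs : ∀ w, G.Adj s w ↔ w = a ∨ w = b) (hab : a ≠ b)
    (hnab : ¬ G.Adj a b) : CubicOn (suppress G s a b) (W \ {s}) := by
  have hsa : G.Adj s a := (hs a).2 (Or.inl rfl)
  have hsb : G.Adj s b := (hs b).2 (Or.inr rfl)
  have haW := h.closed s h.mem a hsa
  have hbW := h.closed s h.mem b hsb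
  refine ⟨?_, ?_⟩
  · rintro v ⟨hv, hvs⟩
    rw [← h.three v hv hvs]
    by_cases hva : v = a
    · subst hva
      have : (suppress G s v b).neighborSet v = insert b (G.neighborSet v \ {s}) := by
        ext w
        simp only [SimpleGraph.mem_neighborSet, suppress_adj hab, Set.mem_insert_iff, Set.mem_sdiff,
          Set.mem_singleton_iff]
        have := hsa.ne
        grind
      rw [this]
      exact Set.ncard_exchange hnab hsa.symm
    by_cases hvb : v = b
    · subst hvb
      have : (suppress G s a v).neighborSet v = insert a (G.neighborSet v \ {s}) := by
        ext w
        simp only [SimpleGraph.mem_neighborSet, suppress_adj hab, Set.mem_insert_iff, Set.mem_sdiff,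
          Set.mem_singleton_iff]
        have := hsb.ne
        grind
      rw [this]
      exact Set.ncard_exchange (fun h' => hnab h'.symm) hsb.symm
    · congr 1
      ext w
      simp only [SimpleGraph.mem_neighborSet, suppress_adj hab]
      have h1 : ¬ G.Adj v s := fun h' => ((hs v).1 h'.symm).elim hva hvb
      constructor
      · rintro (h' | h' | h')
        · exact h'.1
        · exact absurd h'.1 hva
        · exact absurd h'.1 hvb
      · intro h'
        exact Or.inl ⟨h', hvs, fun h'' => h1 (h'' ▸ h')⟩
  · rintro v ⟨hv, hvs⟩ w hvw
    rw [suppress_adj hab] at hvw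
    rcases hvw with h' | h' | h'
    · exact ⟨h.closed v hv w h'.1, h'.2.2⟩
    · exact ⟨h'.2 ▸ hbW, fun h'' => hsb.ne (h''.symm.trans h'.2)⟩
    · exact ⟨h'.2 ▸ haW, fun h'' => hsa.ne (h''.symm.trans h'.2)⟩

/-- Once `ab` is horizontal, `s` is put in its interior away from finitely many bad positions. The
cap is flat, and no other vertex has the column of `s`. -/
theorem exists_capDrawing_of_suppress [Finite V] {G : SimpleGraph V} {W : Set V} {s a b : V}
    (h : NearCubicOn G W s) (hs : ∀ w, G.Adj s w ↔ w = a ∨ w = b) (hab : a ≠ b)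
    (hnab : ¬ G.Adj a b) {x y : V → ℝ} (hv : ValidOn (suppress G s a b).Adj (W \ {s}) x y) :
    ∃ x' y', CapDrawing G W s x' y' := by
  classical
  have hsa : G.Adj s a := (hs a).2 (Or.inl rfl)
  have hsb : G.Adj s b := (hs b).2 (Or.inr rfl)
  have haW : a ∈ W \ {s} := ⟨h.closed s h.mem a hsa, hsa.ne'⟩
  have hbW : b ∈ W \ {s} := ⟨h.closed s h.mem b hsb, hsb.ne'⟩
  have hadj : (suppress G s a b).Adj a b := (suppress_adj hab).2 (Or.inr (Or.inl ⟨rfl, rfl⟩))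
  have hrot := hv.exists_horizontal (hv.slope a haW b hbW hadj)
  clear hv
  obtain ⟨x, y, hv, hy⟩ := hrot
  have hxne : x a ≠ x b := fun h' => hab (hv.inj a haW b hbW h' hy)
  wlog hx : x a < x b generalizing a b
  · have hadj' : ∀ u v, (suppress G s b a).Adj u v ↔ (suppress G s a b).Adj u v := fun u v => by
      rw [suppress_adj hab, suppress_adj hab.symm]; tauto
    exact this (fun w => by rw [hs, or_comm]) hab.symm (fun h' => hnab h'.symm)
      hsb hsa hbW haW ((hadj' b a).2 hadj.symm)
      (hv.mono subset_rfl fun u _ v _ => (hadj' u v).1) hy.symm hxne.symm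
      (lt_of_le_of_ne (not_lt.1 hx) hxne.symm)
  -- The second part holds the places where the line through a pair of vertices meets the line of
  -- `ab`. For a horizontal pair, division by zero yields a column of a vertex, which is excluded
  -- anyway.
  set S : Set ℝ := Set.range x ∪
    Set.range (fun p : V × V => x p.1 + (y a - y p.1) / (y p.2 - y p.1) * (x p.2 - x p.1)) with hS
  have hSfin : S.Finite := (Set.finite_range _).union (Set.finite_range _)
  obtain ⟨X, ⟨hXa, hXb⟩, hXS⟩ := ((Set.Ioo_infinite hx).sdiff hSfin).nonempty
  have hXx : ∀ w, x w ≠ X := fun w h' => hXS (Or.inl ⟨w, h'⟩)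
  have hfree : ∀ u ∈ W \ {s}, ∀ v ∈ W \ {s}, G.Adj u v → ∀ t : ℝ, 0 ≤ t → t ≤ 1 →
      X = x u + t * (x v - x u) → y a = y u + t * (y v - y u) → False := by
    -- A horizontal edge through the point would overlap `ab`, and one of the two would contain an
    -- end of the other. Only `ab` itself remains, which is not an edge of `G`.
    have key : ∀ u ∈ W \ {s}, ∀ v ∈ W \ {s}, G.Adj u v → y u = y a → y v = y a →
        x u < X → X < x v → False := by
      intro u hu v hv' huv hyu hyv h1 h2
      have huv' : (suppress G s a b).Adj u v := (suppress_adj hab).2 (Or.inl ⟨huv, hu.2, hv'.2⟩)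
      have hvna : v ≠ a := fun h' => by rw [h'] at h2; linarith
      have hunb : u ≠ b := fun h' => by rw [h'] at h1; linarith
      by_cases hua : u = a
      · subst hua
        have hvb : v ≠ b := fun h' => hnab (h' ▸ huv)
        rcases le_total (x v) (x b) with h3 | h3
        · exact hv.noSeg u haW b hbW v hv' hadj hvna hvb
            (onSeg_of_horizontal hyv (hyv.trans hy) (by linarith) h3 hx)
        · exact hv.noSeg u hu v hv' b hbW huv' hab.symm hvb.symm
            (onSeg_of_horizontal hy.symm (hy.symm.trans hyv.symm) hx.le h3 (by linarith))
      · rcases le_total (x u) (x a) with h3 | h3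
        · exact hv.noSeg u hu v hv' a haW huv' (Ne.symm hua) hvna.symm
            (onSeg_of_horizontal hyu.symm hyv.symm h3 (by linarith) (by linarith))
        · exact hv.noSeg a haW b hbW u hu hadj hua hunb
            (onSeg_of_horizontal hyu (hyu.trans hy) h3 (by linarith) hx)
    intro u hu v hv' huv t h0 h1 hX hY
    by_cases hyuv : y u = y v
    · have hyu : y u = y a := by rw [hY, hyuv]; ring
      have hxu := hXx u
      have hxv := hXx v
      rcases lt_or_gt_of_ne hxu with h2 | h2
      · refine key u hu v hv' huv hyu (hyuv ▸ hyu) h2 (lt_of_le_of_ne ?_ hxv.symm)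
        have h3 : 0 < t * (x v - x u) := by linarith
        have h4 : 0 < x v - x u := pos_of_mul_pos_of_nonneg h3 h0
        nlinarith
      · refine key v hv' u hu huv.symm (hyuv ▸ hyu) hyu (lt_of_le_of_ne ?_ hxv) h2
        have h3 : 0 < t * (x u - x v) := by linarith
        have h4 : 0 < x u - x v := pos_of_mul_pos_of_nonneg h3 h0
        nlinarith
    · refine hXS (Or.inr ⟨(u, v), ?_⟩)
      simp only
      have : (y a - y u) / (y v - y u) = t := by
        rw [div_eq_iff (sub_ne_zero.2 (Ne.symm hyuv))]; linarith
      rw [this, ← hX]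
  have hxs : Function.update x s X s = X := Function.update_self _ _ _
  have hys : Function.update y s (y a) s = y a := Function.update_self _ _ _
  have hxo : ∀ w, w ≠ s → Function.update x s X w = x w := fun w hw => Function.update_of_ne hw _ _
  have hyo : ∀ w, w ≠ s → Function.update y s (y a) w = y w := fun w hw =>
    Function.update_of_ne hw _ _
  have hnew : ∀ v, G.Adj s v → ∀ w ∈ W, w ≠ s → w ≠ v →
      ¬ OnSeg (Function.update x s X) (Function.update y s (y a)) s v w := by
    intro v hsv w hw hws hwv hseg
    have hvs : v ≠ s := hsv.ne'
    have hyv : y v = y a := by rcases (hs v).1 hsv with rfl | rfl <;> [rfl; exact hy.symm]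
    have e1 := hseg.y_le hys.le (by rw [hyo v hvs, hyv])
    have e2 := hseg.le_y hys.ge (by rw [hyo v hvs, hyv])
    have e3 := hseg.x_mem
    rw [hyo w hws] at e1 e2
    rw [hxs, hxo v hvs, hxo w hws] at e3
    have hyw : y w = y a := le_antisymm e1 e2
    rcases (hs v).1 hsv with rfl | rfl
    · rw [min_eq_right hXa.le, max_eq_left hXa.le] at e3
      exact hv.noSeg v haW b hbW w ⟨hw, hws⟩ hadj hwv (fun h' => by rw [h'] at e3; linarith)
        (onSeg_of_horizontal hyw (hyw.trans hy) e3.1 (by linarith) hx)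
    · rw [min_eq_left hXb.le, max_eq_right hXb.le] at e3
      exact hv.noSeg a haW v hbW w ⟨hw, hws⟩ hadj (fun h' => by rw [h'] at e3; linarith) hwv
        (onSeg_of_horizontal hyw (hyw.trans hy) (by linarith) e3.2 hx)
  refine ⟨Function.update x s X, Function.update y s (y a), ⟨?_, ?_, ?_⟩, ?_, 0, a, b, Or.inl rfl,
    hs, ?_⟩
  · intro u hu v hv' h1 h2
    by_cases hus : u = s <;> by_cases hvs : v = s
    · exact hus.trans hvs.symm
    · rw [hus, hxs, hxo v hvs] at h1; exact absurd h1.symm (hXx v)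
    · rw [hvs, hxs, hxo u hus] at h1; exact absurd h1 (hXx u)
    · rw [hxo u hus, hxo v hvs] at h1
      rw [hyo u hus, hyo v hvs] at h2
      exact hv.inj u ⟨hu, hus⟩ v ⟨hv', hvs⟩ h1 h2
  · have hsl : ∀ v, G.Adj s v → SlopeOK (Function.update x s X s) (Function.update y s (y a) s)
        (Function.update x s X v) (Function.update y s (y a) v) := by
      intro v hsv
      rw [hys, hyo v hsv.ne']
      rcases (hs v).1 hsv with rfl | rfl
      · exact Or.inr (Or.inl rfl)
      · exact Or.inr (Or.inl hy)
    intro u hu v hv' huv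
    by_cases hus : u = s
    · subst hus; exact hsl v huv
    by_cases hvs : v = s
    · subst hvs; exact (hsl u huv.symm).symm
    rw [hxo u hus, hxo v hvs, hyo u hus, hyo v hvs]
    exact hv.slope u ⟨hu, hus⟩ v ⟨hv', hvs⟩ ((suppress_adj hab).2 (Or.inl ⟨huv, hus, hvs⟩))
  · intro u hu v hv' w hw huv hwu hwv hseg
    by_cases hus : u = s
    · subst hus; exact hnew v huv w hw hwu hwv hseg
    by_cases hvs : v = s
    · subst hvs; exact hnew u huv.symm w hw hwv hwu hseg.symm
    by_cases hws : w = s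
    · subst hws
      obtain ⟨t, h0, h1, h2, h3⟩ := hseg
      rw [hxs, hxo u hus, hxo v hvs] at h2
      rw [hys, hyo u hus, hyo v hvs] at h3
      exact hfree u ⟨hu, hus⟩ v ⟨hv', hvs⟩ huv t h0 h1 h2 h3
    · exact hv.noSeg u ⟨hu, hus⟩ v ⟨hv', hvs⟩ w ⟨hw, hws⟩
        ((suppress_adj hab).2 (Or.inl ⟨huv, hus, hvs⟩)) hwu hwv
        (hseg.congr (hxo u hus) (hyo u hus) (hxo v hvs) (hyo v hvs) (hxo w hws) (hyo w hws))
  · intro w hw hws h'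
    rw [hxs, hxo w hws] at h'
    exact absurd h' (hXx w)
  · rw [hxs, hys, hxo a hsa.ne', hxo b hsb.ne', hyo a hsa.ne', hyo b hsb.ne', hy]
    exact ⟨hXa, hXb, by ring, by ring⟩

end Caps

/-! ### Cutting bridges, diamonds and contracted triangles -/

section Bridges

variable {V : Type*}

/-- Only the edge `zd` leaves `W`, so its removal closes `W` and costs `z` one neighbour. -/
theorem nearCubicOn_deleteEdges [Finite V] {G : SimpleGraph V} {W : Set V} {z d : V} (hz : z ∈ W)
    (hd : d ∉ W) (hadj : G.Adj z d) (hcut : ∀ u ∈ W, ∀ v ∉ W, G.Adj u v → u = z ∧ v = d)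
    (h3 : ∀ v ∈ W, (G.neighborSet v).ncard = 3) :
    NearCubicOn (G.deleteEdges {s(z, d)}) W z where
  mem := hz
  two := by
    have : (G.deleteEdges {s(z, d)}).neighborSet z = G.neighborSet z \ {d} := by
      ext w
      simp only [SimpleGraph.mem_neighborSet, SimpleGraph.deleteEdges_adj, Set.mem_sdiff,
        Set.mem_singleton_iff, Sym2.eq_iff]
      have := hadj.ne
      grind
    rw [this, Set.ncard_sdiff_singleton_of_mem (show d ∈ G.neighborSet z from hadj), h3 z hz]
  three v hv hvz := by
    rw [← h3 v hv]
    congr 1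
    ext w
    simp only [SimpleGraph.mem_neighborSet, SimpleGraph.deleteEdges_adj,
      Set.mem_singleton_iff, Sym2.eq_iff]
    grind
  closed v hv w hvw := by
    rw [SimpleGraph.deleteEdges_adj] at hvw
    by_contra hw
    obtain ⟨rfl, rfl⟩ := hcut v hv w hw hvw.1
    exact hvw.2 rfl

/-- The four vertices form a square standing on its corner `d`, above everything else and in the
column of `z`, so the bridge `zd` is vertical. The top corner `s` has a right-angled cap. -/
theorem exists_capDrawing_of_diamond [Finite V] {G : SimpleGraph V} {W : Set V} {s a b d z : V}
    (hs : ∀ w, G.Adj s w ↔ w = a ∨ w = b) (ha : ∀ w, G.Adj a w ↔ w = s ∨ w = b ∨ w = d)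
    (hb : ∀ w, G.Adj b w ↔ w = s ∨ w = a ∨ w = d) (hd : ∀ w, G.Adj d w ↔ w = a ∨ w = b ∨ w = z)
    (hds : d ≠ s) (hz : z ∈ W \ {s, a, b, d}) {x y : V → ℝ}
    (hv : ValidOn G.Adj (W \ {s, a, b, d}) x y)
    (hnorth : ∀ w ∈ W \ {s, a, b, d}, w ≠ z → x w = x z → y w < y z) :
    ∃ x' y', CapDrawing G W s x' y' := by
  classical
  have hsa : s ≠ a := ((hs a).2 (Or.inl rfl)).ne
  have hsb : s ≠ b := ((hs b).2 (Or.inr rfl)).ne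
  have hab : a ≠ b := ((ha b).2 (Or.inr (Or.inl rfl))).ne
  have had : a ≠ d := ((ha d).2 (Or.inr (Or.inr rfl))).ne
  have hbd : b ≠ d := ((hb d).2 (Or.inr (Or.inr rfl))).ne
  obtain ⟨B, hB0, hB⟩ := exists_abs_le y
  set C : Set V := {s, a, b, d} with hC
  set f : V → Fin 4 := fun v => if v = d then 0 else if v = b then 1 else if v = s then 2 else 3
    with hf
  have hfd : f d = 0 := by simp [hf]
  have hfb : f b = 1 := by simp [hf, hbd]
  have hfs : f s = 2 := by simp [hf, hds.symm, hsb]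
  have hfa : f a = 3 := by simp [hf, had, hab, hsa.symm]
  have hvC := ((validOn_square.rotate.comap (B := G.Adj) (C := C) (f := f) (fun _ _ => trivial) (by
    rintro u (rfl | rfl | rfl | rfl) v (rfl | rfl | rfl | rfl) huv <;>
      simp [hfd, hfb, hfs, hfa] at huv ⊢) fun _ _ _ _ _ => trivial).translate (x z) (B + 1))
  set X : V → ℝ := fun v => ![(0 : ℝ), 1, 1, 0] (f v) - ![(0 : ℝ), 0, 1, 1] (f v) + x z with hX
  set Y : V → ℝ := fun v => ![(0 : ℝ), 1, 1, 0] (f v) + ![(0 : ℝ), 0, 1, 1] (f v) + (B + 1) with hY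
  have hXd : X d = x z := by simp [hX, hfd]
  have hXs : X s = x z := by simp [hX, hfs]
  have hXa : X a = x z - 1 := by simp [hX, hfa]; ring
  have hXb : X b = x z + 1 := by simp [hX, hfb]; ring
  have hYd : Y d = B + 1 := by simp [hY, hfd]
  have hYs : Y s = B + 3 := by simp [hY, hfs]; ring
  have hYa : Y a = B + 2 := by simp [hY, hfa]; ring
  have hYb : Y b = B + 2 := by simp [hY, hfb]; ring
  have hPx : ∀ v ∈ W \ C, glue C X x v = x v := fun v hv => glue_notMem hv.2
  have hPy : ∀ v ∈ W \ C, glue C Y y v = y v := fun v hv => glue_notMem hv.2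
  have hCx : ∀ v ∈ C, glue C X x v = X v := fun v hv => glue_mem hv
  have hCy : ∀ v ∈ C, glue C Y y v = Y v := fun v hv => glue_mem hv
  have hsC : s ∈ C := by simp [hC]
  have haC : a ∈ C := by simp [hC]
  have hbC : b ∈ C := by simp [hC]
  have hdC : d ∈ C := by simp [hC]
  have hlt : ∀ u ∈ W \ C, ∀ v ∈ C, glue C Y y u < glue C Y y v := by
    intro u hu v hv
    rw [hPy u hu, hCy v hv]
    have := (abs_le.1 (hB u)).2
    rcases hv with rfl | rfl | rfl | rfl <;> linarith
  have hval : ValidOn G.Adj (W \ C ∪ C) (glue C X x) (glue C Y y) := by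
    refine ValidOn.stack (fun _ _ => SimpleGraph.Adj.symm) (hv.congr hPx hPy) (hvC.congr hCx hCy)
      hlt ?_
    intro u hu v hv huv
    left
    have huC := hu.2
    simp only [hC, Set.mem_insert_iff, Set.mem_singleton_iff, not_or] at huC
    obtain ⟨rfl, rfl⟩ : u = z ∧ v = d := by
      have := huv.symm
      rcases hv with rfl | rfl | rfl | rfl
      · rw [hs] at this; tauto
      · rw [ha] at this; tauto
      · rw [hb] at this; tauto
      · rw [hd] at this; tauto
    refine ⟨by rw [hPx u hu, hCx v hv, hXd], ?_, ?_⟩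
    · intro w hw hwu hxw
      rw [hPx u hu, hPx w hw] at hxw
      rw [hPy u hu, hPy w hw]
      exact hnorth w hw hwu hxw
    · intro w hw hwv _
      rw [hCy v hv, hCy w hw]
      rcases hw with rfl | rfl | rfl | rfl
      · linarith
      · linarith
      · linarith
      · exact absurd rfl hwv
  refine ⟨_, _, hval.mono ?_ fun _ _ _ _ h => h, ?_, 1, a, b, Or.inr rfl, hs, ?_⟩
  · intro v hv
    by_cases h : v ∈ C
    · exact Or.inr h
    · exact Or.inl ⟨hv, h⟩
  · intro w hw hws _
    by_cases h : w ∈ C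
    · rw [hCy w h, hCy s hsC]
      rcases h with rfl | rfl | rfl | rfl
      · exact absurd rfl hws
      · linarith
      · linarith
      · linarith
    · exact hlt w ⟨hw, h⟩ s hsC
  · rw [hCx s hsC, hCx a haC, hCx b hbC, hCy s hsC, hCy a haC, hCy b hbC, hXs, hXa, hXb, hYs, hYa,
      hYb]
    exact ⟨by linarith, by linarith, by ring, by ring⟩

/-- A point outside of finitely many segments has a neighbourhood that avoids them. -/
theorem exists_clearance [Finite V] (R : V → V → Prop) (x y : V → ℝ) (X Y : ℝ)
    (h : ∀ u v, R u v → ∀ t : ℝ, 0 ≤ t → t ≤ 1 → X = x u + t * (x v - x u) →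
      Y = y u + t * (y v - y u) → False) :
    ∃ δ : ℝ, 0 < δ ∧ ∀ u v, R u v → ∀ t : ℝ, 0 ≤ t → t ≤ 1 →
      |x u + t * (x v - x u) - X| < δ → |y u + t * (y v - y u) - Y| < δ → False := by
  classical
  set K : {p : V × V // R p.1 p.2} → Set (ℝ × ℝ) := fun p =>
    (fun t : ℝ => (x p.1.1 + t * (x p.1.2 - x p.1.1), y p.1.1 + t * (y p.1.2 - y p.1.1))) ''
      Set.Icc 0 1 with hK
  have hclosed : IsClosed (⋃ p, K p) := by
    refine isClosed_iUnion_of_finite fun p => ?_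
    refine (isCompact_Icc.image ?_).isClosed
    fun_prop
  have hmem : ((X, Y) : ℝ × ℝ) ∈ (⋃ p, K p)ᶜ := by
    intro h'
    obtain ⟨p, t, ht, hp⟩ := Set.mem_iUnion.1 h'
    exact h _ _ p.2 t ht.1 ht.2 (congrArg Prod.fst hp).symm (congrArg Prod.snd hp).symm
  obtain ⟨δ, hδ, hball⟩ := Metric.isOpen_iff.1 hclosed.isOpen_compl _ hmem
  refine ⟨δ, hδ, fun u v huv t h0 h1 hx hy => ?_⟩
  refine hball (a := (x u + t * (x v - x u), y u + t * (y v - y u))) ?_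
    (Set.mem_iUnion.2 ⟨⟨(u, v), huv⟩, t, ⟨h0, h1⟩, rfl⟩)
  rw [Metric.mem_ball, Prod.dist_eq, max_lt_iff, Real.dist_eq, Real.dist_eq]
  exact ⟨hx, hy⟩

/-- The graph obtained by contracting the triangle `s a b` to `s`. -/
def collapse (G : SimpleGraph V) (s a b a' b' : V) : SimpleGraph V :=
  SimpleGraph.fromRel fun u v =>
    (G.Adj u v ∧ u ∉ ({s, a, b} : Set V) ∧ v ∉ ({s, a, b} : Set V)) ∨ (u = s ∧ (v = a' ∨ v = b'))

theorem collapse_adj {G : SimpleGraph V} {s a b a' b' : V} (ha' : a' ≠ s) (hb' : b' ≠ s) {u v : V} :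
    (collapse G s a b a' b').Adj u v ↔
      (G.Adj u v ∧ u ∉ ({s, a, b} : Set V) ∧ v ∉ ({s, a, b} : Set V)) ∨
        (u = s ∧ (v = a' ∨ v = b')) ∨ (v = s ∧ (u = a' ∨ u = b')) := by
  rw [collapse, SimpleGraph.fromRel_adj]
  constructor
  · rintro ⟨-, (h | h) | (h | h)⟩
    · exact Or.inl h
    · exact Or.inr (Or.inl h)
    · exact Or.inl ⟨h.1.symm, h.2.2, h.2.1⟩
    · exact Or.inr (Or.inr h)
  · rintro (h | ⟨rfl, h⟩ | ⟨rfl, h⟩)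
    · exact ⟨h.1.ne, Or.inl (Or.inl h)⟩
    · exact ⟨by rintro rfl; tauto, Or.inl (Or.inr ⟨rfl, h⟩)⟩
    · exact ⟨by rintro rfl; tauto, Or.inr (Or.inr ⟨rfl, h⟩)⟩

/-- The vertex `s` inherits `a'` and `b'`, whose distinctness gives it degree two; these two trade
`a` and `b` for `s`. -/
theorem NearCubicOn.nearCubicOn_collapse [Finite V] {G : SimpleGraph V} {W : Set V}
    {s a b a' b' : V} (h : NearCubicOn G W s) (hs : ∀ w, G.Adj s w ↔ w = a ∨ w = b)
    (ha : ∀ w, G.Adj a w ↔ w = s ∨ w = b ∨ w = a') (hb : ∀ w, G.Adj b w ↔ w = s ∨ w = a ∨ w = b')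
    (has : a' ∉ ({s, a, b} : Set V)) (hbs : b' ∉ ({s, a, b} : Set V)) (hab' : a' ≠ b') :
    NearCubicOn (collapse G s a b a' b') (W \ {a, b}) s := by
  have hsa : s ≠ a := ((hs a).2 (Or.inl rfl)).ne
  have hsb : s ≠ b := ((hs b).2 (Or.inr rfl)).ne
  have haa' : G.Adj a a' := (ha _).2 (Or.inr (Or.inr rfl))
  have hbb' : G.Adj b b' := (hb _).2 (Or.inr (Or.inr rfl))
  have haW := h.closed s h.mem a ((hs a).2 (Or.inl rfl))
  have hbW := h.closed s h.mem b ((hs b).2 (Or.inr rfl))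
  have ha'W := h.closed a haW a' haa'
  have hb'W := h.closed b hbW b' hbb'
  have has' := has
  have hbs' := hbs
  simp only [Set.mem_insert_iff, Set.mem_singleton_iff, not_or] at has' hbs'
  have hadj : ∀ u v, (collapse G s a b a' b').Adj u v ↔ _ := fun u v =>
    collapse_adj has'.1 hbs'.1
  simp only [Set.mem_insert_iff, Set.mem_singleton_iff, not_or] at hadj
  refine ⟨⟨h.mem, by simp [hsa, hsb]⟩, ?_, ?_, ?_⟩
  · have : (collapse G s a b a' b').neighborSet s = {a', b'} := by
      ext w
      simp only [SimpleGraph.mem_neighborSet, hadj, Set.mem_insert_iff, Set.mem_singleton_iff]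
      grind
    rw [this, Set.ncard_pair hab']
  · rintro v ⟨hv, hvab⟩ hvs
    simp only [Set.mem_insert_iff, Set.mem_singleton_iff, not_or] at hvab
    rw [← h.three v hv hvs]
    have hvsn : ¬ G.Adj v s := fun h' => by have := (hs v).1 h'.symm; tauto
    have hva : G.Adj v a ↔ v = a' := by rw [G.adj_comm, ha]; tauto
    have hvb : G.Adj v b ↔ v = b' := by rw [G.adj_comm, hb]; tauto
    by_cases hva' : v = a'
    · have : (collapse G s a b a' b').neighborSet v = insert s (G.neighborSet v \ {a}) := by
        ext w
        simp only [SimpleGraph.mem_neighborSet, hadj, Set.mem_insert_iff, Set.mem_sdiff,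
          Set.mem_singleton_iff]
        grind
      rw [this]
      exact Set.ncard_exchange hvsn (hva.2 hva')
    by_cases hvb' : v = b'
    · have : (collapse G s a b a' b').neighborSet v = insert s (G.neighborSet v \ {b}) := by
        ext w
        simp only [SimpleGraph.mem_neighborSet, hadj, Set.mem_insert_iff, Set.mem_sdiff,
          Set.mem_singleton_iff]
        grind
      rw [this]
      exact Set.ncard_exchange hvsn (hvb.2 hvb')
    · congr 1
      ext w
      simp only [SimpleGraph.mem_neighborSet, hadj]
      grind
  · rintro v ⟨hv, hvab⟩ w hvw
    rw [hadj] at hvw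
    simp only [Set.mem_sdiff, Set.mem_insert_iff, Set.mem_singleton_iff, not_or]
    rcases hvw with h' | ⟨-, rfl | rfl⟩ | ⟨rfl, -⟩
    · exact ⟨h.closed v hv w h'.1, h'.2.2.2⟩
    · exact ⟨ha'W, has'.2⟩
    · exact ⟨hb'W, hbs'.2⟩
    · exact ⟨h.mem, hsa, hsb⟩

end Bridges

/-! ### Cutting a triangle off a cap -/

section Triangles

variable {V : Type*}

/-- Moving an end of a segment inwards. -/
theorem OnSeg.of_shorten {x y x' y' : V → ℝ} {u u' v w : V} {r : ℝ} (h0 : 0 ≤ r) (h1 : r ≤ 1)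
    (h : OnSeg x' y' u' v w) (hxu : x' u' = x u + r * (x v - x u))
    (hyu : y' u' = y u + r * (y v - y u)) (hxv : x' v = x v) (hyv : y' v = y v)
    (hxw : x' w = x w) (hyw : y' w = y w) : OnSeg x y u v w := by
  obtain ⟨t, ht0, ht1, hx, hy⟩ := h
  rw [hxw, hxu, hxv] at hx
  rw [hyw, hyu, hyv] at hy
  refine ⟨r + t * (1 - r), by nlinarith, by nlinarith, by rw [hx]; ring, by rw [hy]; ring⟩

/-- Replacing the vertex of a cap by a small triangle. -/
theorem exists_capDrawing_of_cap [Finite V] {G : SimpleGraph V} {W : Set V} {s a b a' b' : V}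
    (hsW : s ∈ W) (hs : ∀ w, G.Adj s w ↔ w = a ∨ w = b)
    (ha : ∀ w, G.Adj a w ↔ w = s ∨ w = b ∨ w = a') (hb : ∀ w, G.Adj b w ↔ w = s ∨ w = a ∨ w = b')
    (has : a' ∉ ({s, a, b} : Set V)) (hbs : b' ∉ ({s, a, b} : Set V))
    (ha'W : a' ∈ W) (hb'W : b' ∈ W) {x y : V → ℝ}
    (hv : ValidOn (collapse G s a b a' b').Adj (W \ {a, b}) x y)
    (hnorth : ∀ w ∈ W \ {a, b}, w ≠ s → x w = x s → y w < y s) {κ : ℝ} (hκ : κ = 0 ∨ κ = 1)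
    (hxp : x a' < x s) (hxq : x s < x b') (hyp : y s - y a' = κ * (x s - x a'))
    (hyq : y s - y b' = κ * (x b' - x s)) : ∃ x' y', CapDrawing G W s x' y' := by
  classical
  have hsa : s ≠ a := ((hs a).2 (Or.inl rfl)).ne
  have hsb : s ≠ b := ((hs b).2 (Or.inr rfl)).ne
  have hab : a ≠ b := ((ha b).2 (Or.inr (Or.inl rfl))).ne
  have has' := has
  have hbs' := hbs
  simp only [Set.mem_insert_iff, Set.mem_singleton_iff, not_or] at has' hbs'
  have hadj : ∀ u v, (collapse G s a b a' b').Adj u v ↔ _ := fun u v =>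
    collapse_adj has'.1 hbs'.1
  have hsa' : (collapse G s a b a' b').Adj s a' := (hadj _ _).2 (Or.inr (Or.inl ⟨rfl, Or.inl rfl⟩))
  have hsb' : (collapse G s a b a' b').Adj s b' := (hadj _ _).2 (Or.inr (Or.inl ⟨rfl, Or.inr rfl⟩))
  have hsO : s ∈ W \ {a, b} := ⟨hsW, by simp [hsa, hsb]⟩
  have hold : ∀ w ∈ W, w ≠ s → w ≠ a → w ≠ b → w ∈ W \ {a, b} := fun w hw _ h2 h3 =>
    ⟨hw, by simp [h2, h3]⟩
  have hpO := hold a' ha'W has'.1 has'.2.1 has'.2.2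
  have hqO := hold b' hb'W hbs'.1 hbs'.2.1 hbs'.2.2
  -- The degenerate pairs `u = v` are included, so that the clearance keeps away vertices as well as
  -- edges.
  obtain ⟨δ, hδ, hclear⟩ := exists_clearance
    (fun u v => u ∈ W \ {a, b} ∧ v ∈ W \ {a, b} ∧ u ≠ s ∧ v ≠ s ∧
      ((collapse G s a b a' b').Adj u v ∨ u = v)) x y (x s) (y s) (by
    rintro u v ⟨hu, hv', hus, hvs, huv | rfl⟩ t h0 h1 hx hy
    · exact hv.noSeg u hu v hv' s hsO huv hus.symm hvs.symm ⟨t, h0, h1, hx, hy⟩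
    · exact hus (hv.inj u hu s hsO (by rw [hx]; ring) (by rw [hy]; ring)))
  obtain ⟨e, he0, heδ, hep, heq⟩ : ∃ e : ℝ, 0 < e ∧ e < δ ∧ e < x s - x a' ∧ e < x b' - x s := by
    have h1 : 0 < min δ (min (x s - x a') (x b' - x s)) :=
      lt_min hδ (lt_min (by linarith) (by linarith))
    obtain ⟨e, he0, he⟩ := exists_between h1
    exact ⟨e, he0, he.trans_le (min_le_left _ _),
      he.trans_le ((min_le_right _ _).trans (min_le_left _ _)),
      he.trans_le ((min_le_right _ _).trans (min_le_right _ _))⟩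
  have hκ0 : 0 ≤ κ * e ∧ κ * e ≤ e := by rcases hκ with rfl | rfl <;> constructor <;> linarith
  set x' : V → ℝ := fun w => if w = a then x s - e else if w = b then x s + e else x w with hx'
  -- The corners `a` and `b` sit on the old legs at horizontal distance `e`. A flat cap lifts `s` by
  -- `e`, a right-angled one leaves it in place. In both cases the new cap is right-angled over a
  -- horizontal base.
  set y' : V → ℝ := fun w => if w = a then y s - κ * e else if w = b then y s - κ * e else
    if w = s then y s + (1 - κ) * e else y w with hy'
  have hx'a : x' a = x s - e := by simp [hx']
  have hx'b : x' b = x s + e := by simp [hx', hab.symm]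
  have hx's : x' s = x s := by simp [hx', hsa, hsb]
  have hy'a : y' a = y s - κ * e := by simp [hy']
  have hy'b : y' b = y s - κ * e := by simp [hy', hab.symm]
  have hy's : y' s = y s + e - κ * e := by simp [hy', hsa, hsb]; ring
  have hx'o : ∀ w, w ≠ a → w ≠ b → x' w = x w := fun w h1 h2 => by simp [hx', h1, h2]
  have hy'o : ∀ w, w ≠ s → w ≠ a → w ≠ b → y' w = y w := fun w h0 h1 h2 => by
    simp [hy', h0, h1, h2]
  have hbox : ∀ w ∈ W, w ≠ s → w ≠ a → w ≠ b → x s - e ≤ x' w → x' w ≤ x s + e →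
      y s - κ * e ≤ y' w → y' w ≤ y s + e - κ * e → False := by
    intro w hw h1 h2 h3 e1 e2 e3 e4
    rw [hx'o w h2 h3] at e1 e2
    rw [hy'o w h1 h2 h3] at e3 e4
    have hwO := hold w hw h1 h2 h3
    refine hclear w w ⟨hwO, hwO, h1, h1, Or.inr rfl⟩ 0 le_rfl zero_le_one ?_ ?_
    · rw [abs_lt]; constructor <;> linarith
    · rw [abs_lt]; constructor <;> linarith
  set A : V → V → Prop := fun u v =>
    (G.Adj u v ∧ u ∉ ({s, a, b} : Set V) ∧ v ∉ ({s, a, b} : Set V)) ∨ (u = a ∧ v = a') ∨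
      (u = b ∧ v = b') ∨ (u = s ∧ v = a) ∨ (u = s ∧ v = b) ∨ (u = a ∧ v = b) with hA
  have hGA : ∀ u v, G.Adj u v → A u v ∨ A v u := by
    intro u v huv
    by_cases hu : u ∈ ({s, a, b} : Set V)
    · rcases hu with rfl | rfl | rfl
      · rcases (hs v).1 huv with rfl | rfl <;> simp [hA]
      · rcases (ha v).1 huv with rfl | rfl | rfl <;> simp [hA]
      · rcases (hb v).1 huv with rfl | rfl | rfl <;> simp [hA]
    by_cases hv' : v ∈ ({s, a, b} : Set V)
    · rcases hv' with rfl | rfl | rfl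
      · rcases (hs u).1 huv.symm with rfl | rfl <;> simp [hA]
      · rcases (ha u).1 huv.symm with rfl | rfl | rfl <;> simp [hA]
      · rcases (hb u).1 huv.symm with rfl | rfl | rfl <;> simp [hA]
    · exact Or.inl (Or.inl ⟨huv, hu, hv'⟩)
  have hval : ValidOn A W x' y' := by
    refine ⟨?_, ?_, ?_⟩
    · have hnew : ∀ w ∈ W, w ≠ s → w ≠ a → w ≠ b → ∀ u ∈ ({s, a, b} : Set V), x' w = x' u →
          y' w = y' u → False := by
        intro w hw h1 h2 h3 u hu hxu hyu
        refine hbox w hw h1 h2 h3 ?_ ?_ ?_ ?_ <;> rcases hu with rfl | rfl | rfl <;> linarith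
      intro u hu v hv' h1 h2
      by_cases hu' : u ∈ ({s, a, b} : Set V) <;> by_cases hv'' : v ∈ ({s, a, b} : Set V)
      · rcases hu' with rfl | rfl | rfl <;> rcases hv'' with rfl | rfl | rfl <;>
          first | rfl | (exfalso; linarith)
      · simp only [Set.mem_insert_iff, Set.mem_singleton_iff, not_or] at hv''
        exact (hnew v hv' hv''.1 hv''.2.1 hv''.2.2 u hu' h1.symm h2.symm).elim
      · have hu'' := hu'
        simp only [Set.mem_insert_iff, Set.mem_singleton_iff, not_or] at hu''
        exact (hnew u hu hu''.1 hu''.2.1 hu''.2.2 v hv'' h1 h2).elim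
      · simp only [Set.mem_insert_iff, Set.mem_singleton_iff, not_or] at hu' hv''
        rw [hx'o u hu'.2.1 hu'.2.2, hx'o v hv''.2.1 hv''.2.2] at h1
        rw [hy'o u hu'.1 hu'.2.1 hu'.2.2, hy'o v hv''.1 hv''.2.1 hv''.2.2] at h2
        exact hv.inj u (hold u hu hu'.1 hu'.2.1 hu'.2.2) v
          (hold v hv' hv''.1 hv''.2.1 hv''.2.2) h1 h2
    · rintro u hu v hv' (⟨huv, hu', hv''⟩ | ⟨rfl, rfl⟩ | ⟨rfl, rfl⟩ | ⟨rfl, rfl⟩ | ⟨rfl, rfl⟩ |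
        ⟨rfl, rfl⟩)
      · have h1 : (collapse G s a b a' b').Adj u v := (hadj _ _).2 (Or.inl ⟨huv, hu', hv''⟩)
        simp only [Set.mem_insert_iff, Set.mem_singleton_iff, not_or] at hu' hv''
        rw [hx'o u hu'.2.1 hu'.2.2, hx'o v hv''.2.1 hv''.2.2, hy'o u hu'.1 hu'.2.1 hu'.2.2,
          hy'o v hv''.1 hv''.2.1 hv''.2.2]
        exact hv.slope u (hold u hu hu'.1 hu'.2.1 hu'.2.2) v
          (hold v hv' hv''.1 hv''.2.1 hv''.2.2) h1
      · rw [hx'a, hy'a, hx'o v has'.2.1 has'.2.2, hy'o v has'.1 has'.2.1 has'.2.2]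
        rcases hκ with rfl | rfl
        · exact Or.inr (Or.inl (by linarith))
        · exact Or.inr (Or.inr (Or.inl (by linarith)))
      · rw [hx'b, hy'b, hx'o v hbs'.2.1 hbs'.2.2, hy'o v hbs'.1 hbs'.2.1 hbs'.2.2]
        rcases hκ with rfl | rfl
        · exact Or.inr (Or.inl (by linarith))
        · exact Or.inr (Or.inr (Or.inr (by linarith)))
      · rw [hx'a, hy'a, hx's, hy's]
        exact Or.inr (Or.inr (Or.inl (by ring)))
      · rw [hx'b, hy'b, hx's, hy's]
        exact Or.inr (Or.inr (Or.inr (by ring)))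
      · exact Or.inr (Or.inl (by rw [hy'a, hy'b]))
    · have hin : ∀ u ∈ ({s, a, b} : Set V), ∀ v ∈ ({s, a, b} : Set V), ∀ w ∈ W,
          w ≠ s → w ≠ a → w ≠ b → ¬ OnSeg x' y' u v w := by
        intro u hu v hv' w hw h1 h2 h3 hseg
        have hux : x s - e ≤ x' u ∧ x' u ≤ x s + e ∧ y s - κ * e ≤ y' u ∧
            y' u ≤ y s + e - κ * e := by
          rcases hu with rfl | rfl | rfl <;> refine ⟨?_, ?_, ?_, ?_⟩ <;> linarith
        have hvx : x s - e ≤ x' v ∧ x' v ≤ x s + e ∧ y s - κ * e ≤ y' v ∧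
            y' v ≤ y s + e - κ * e := by
          rcases hv' with rfl | rfl | rfl <;> refine ⟨?_, ?_, ?_, ?_⟩ <;> linarith
        exact hbox w hw h1 h2 h3 (hseg.le_x hux.1 hvx.1) (hseg.x_le hux.2.1 hvx.2.1)
          (hseg.le_y hux.2.2.1 hvx.2.2.1) (hseg.y_le hux.2.2.2 hvx.2.2.2)
      have hsm : s ∈ ({s, a, b} : Set V) := by simp
      have ham : a ∈ ({s, a, b} : Set V) := by simp
      have hbm : b ∈ ({s, a, b} : Set V) := by simp
      rintro u hu v hv' w hw (⟨huv, hu', hv''⟩ | ⟨rfl, rfl⟩ | ⟨rfl, rfl⟩ | ⟨rfl, rfl⟩ | ⟨rfl, rfl⟩ |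
        ⟨rfl, rfl⟩) hwu hwv hseg
      · have h1 : (collapse G s a b a' b').Adj u v := (hadj _ _).2 (Or.inl ⟨huv, hu', hv''⟩)
        simp only [Set.mem_insert_iff, Set.mem_singleton_iff, not_or] at hu' hv''
        have huO := hold u hu hu'.1 hu'.2.1 hu'.2.2
        have hvO := hold v hv' hv''.1 hv''.2.1 hv''.2.2
        by_cases hw' : w ∈ ({s, a, b} : Set V)
        · obtain ⟨t, h0, h1', hx, hy⟩ := hseg
          rw [hx'o u hu'.2.1 hu'.2.2, hx'o v hv''.2.1 hv''.2.2] at hx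
          rw [hy'o u hu'.1 hu'.2.1 hu'.2.2, hy'o v hv''.1 hv''.2.1 hv''.2.2] at hy
          refine hclear u v ⟨huO, hvO, hu'.1, hv''.1, Or.inl h1⟩ t h0 h1' ?_ ?_
          · rw [← hx, abs_lt]
            rcases hw' with rfl | rfl | rfl <;> constructor <;> linarith
          · rw [← hy, abs_lt]
            rcases hw' with rfl | rfl | rfl <;> constructor <;> linarith
        · simp only [Set.mem_insert_iff, Set.mem_singleton_iff, not_or] at hw'
          exact hv.noSeg u huO v hvO w (hold w hw hw'.1 hw'.2.1 hw'.2.2) h1 hwu hwv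
            (hseg.congr (hx'o u hu'.2.1 hu'.2.2) (hy'o u hu'.1 hu'.2.1 hu'.2.2)
              (hx'o v hv''.2.1 hv''.2.2) (hy'o v hv''.1 hv''.2.1 hv''.2.2)
              (hx'o w hw'.2.1 hw'.2.2) (hy'o w hw'.1 hw'.2.1 hw'.2.2))
      · have hxv := hx'o v has'.2.1 has'.2.2
        have hyv := hy'o v has'.1 has'.2.1 has'.2.2
        have e1 := hseg.x_le (b := x s - e) hx'a.le (by rw [hxv]; linarith)
        by_cases hws : w = s
        · subst hws; linarith
        by_cases hwb : w = b
        · subst hwb; linarith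
        -- The edge from the new corner is a piece of the old leg at `s`, cut off at the parameter
        -- `e / (x s - x v)`.
        refine hv.noSeg s hsO v hpO w (hold w hw hws hwu hwb) hsa' hws hwv
          (hseg.of_shorten (r := e / (x s - x v)) (div_nonneg he0.le (by linarith))
            ((div_le_one (by linarith)).2 hep.le) ?_ ?_ hxv hyv (hx'o w hwu hwb)
            (hy'o w hws hwu hwb))
        · rw [hx'a, show x v - x s = -(x s - x v) by ring, mul_neg, div_mul_cancel₀ _ (by linarith)]
          ring
        · rw [hy'a, show y v - y s = -(κ * (x s - x v)) by linarith]
          have : e / (x s - x v) * (x s - x v) = e := div_mul_cancel₀ _ (by linarith)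
          linear_combination κ * this
      · have hxv := hx'o v hbs'.2.1 hbs'.2.2
        have hyv := hy'o v hbs'.1 hbs'.2.1 hbs'.2.2
        have e1 := hseg.le_x (b := x s + e) hx'b.ge (by rw [hxv]; linarith)
        by_cases hws : w = s
        · subst hws; linarith
        by_cases hwa : w = a
        · subst hwa; linarith
        refine hv.noSeg s hsO v hqO w (hold w hw hws hwa hwu) hsb' hws hwv
          (hseg.of_shorten (r := e / (x v - x s)) (div_nonneg he0.le (by linarith))
            ((div_le_one (by linarith)).2 heq.le) ?_ ?_ hxv hyv (hx'o w hwa hwu)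
            (hy'o w hws hwa hwu))
        · rw [hx'b, div_mul_cancel₀ _ (by linarith)]
        · rw [hy'b, show y v - y s = -(κ * (x v - x s)) by linarith]
          have : e / (x v - x s) * (x v - x s) = e := div_mul_cancel₀ _ (by linarith)
          linear_combination κ * this
      · by_cases hwb : w = b
        · subst hwb
          have := hseg.x_le (b := x u) hx's.le (by linarith)
          linarith
        · exact hin u hsm v ham w hw hwu hwv hwb hseg
      · by_cases hwa : w = a
        · subst hwa
          have := hseg.le_x (b := x u) hx's.ge (by linarith)
          linarith
        · exact hin u hsm v hbm w hw hwu hwa hwv hseg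
      · by_cases hws : w = s
        · subst hws
          have := hseg.y_le (b := y w - κ * e) hy'a.le hy'b.le
          linarith
        · exact hin u ham v hbm w hw hws hwu hwv hseg
  refine ⟨x', y', hval.symmetrize.mono subset_rfl fun u _ v _ => hGA u v, ?_, 1, a, b, Or.inr rfl,
    hs, ?_⟩
  · intro w hw hws hxw
    have hwa : w ≠ a := fun h' => by rw [h'] at hxw; linarith
    have hwb : w ≠ b := fun h' => by rw [h'] at hxw; linarith
    rw [hx'o w hwa hwb, hx's] at hxw
    have := hnorth w (hold w hw hws hwa hwb) hws hxw
    rw [hy'o w hws hwa hwb]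
    linarith
  · rw [hx's, hx'a, hx'b, hy's, hy'a, hy'b]
    exact ⟨by linarith, by linarith, by ring, by ring⟩

/-- The left leg of the given cap may end at `a'` or at `b'`; the second case exchanges the names.
-/
theorem exists_capDrawing_of_collapse [Finite V] {G : SimpleGraph V} {W : Set V} {s a b a' b' : V}
    (hsW : s ∈ W) (hs : ∀ w, G.Adj s w ↔ w = a ∨ w = b)
    (ha : ∀ w, G.Adj a w ↔ w = s ∨ w = b ∨ w = a') (hb : ∀ w, G.Adj b w ↔ w = s ∨ w = a ∨ w = b')
    (has : a' ∉ ({s, a, b} : Set V)) (hbs : b' ∉ ({s, a, b} : Set V))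
    (ha'W : a' ∈ W) (hb'W : b' ∈ W) {x y : V → ℝ}
    (hv : CapDrawing (collapse G s a b a' b') (W \ {a, b}) s x y) :
    ∃ x' y', CapDrawing G W s x' y' := by
  have ha's : a' ≠ s := fun h => has (by simp [h])
  have hb's : b' ≠ s := fun h => hbs (by simp [h])
  obtain ⟨κ, p, q, hκ, hpq, hxp, hxq, hyp, hyq⟩ := hv.cap
  have hiff : ∀ w, w = p ∨ w = q ↔ w = a' ∨ w = b' := by
    intro w
    rw [← hpq, collapse_adj ha's hb's]
    simp only [Set.mem_insert_iff, true_or, not_true, false_and, and_false, true_and, false_or]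
    constructor
    · rintro (h | h)
      · exact h
      · rcases h.2 with h' | h'
        · exact absurd h'.symm ha's
        · exact absurd h'.symm hb's
    · exact Or.inl
  have hpne : p ≠ q := fun h => by rw [h] at hxp; linarith
  have hp := (hiff p).1 (Or.inl rfl)
  have hq := (hiff q).1 (Or.inr rfl)
  rcases hp with rfl | rfl
  · obtain rfl := hq.resolve_left hpne.symm
    exact exists_capDrawing_of_cap hsW hs ha hb has hbs ha'W hb'W hv.valid hv.north hκ hxp hxq hyp
      hyq
  · obtain rfl := hq.resolve_right hpne.symm
    have hcol : collapse G s b a p q = collapse G s a b q p := by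
      ext u v
      rw [collapse_adj ha's hb's, collapse_adj hb's ha's, Set.pair_comm b a, or_comm (a := v = p),
        or_comm (a := u = p)]
    refine exists_capDrawing_of_cap (a := b) (b := a) (a' := p) (b' := q) hsW
      (fun w => by rw [hs, or_comm]) hb ha (by rwa [Set.pair_comm]) (by rwa [Set.pair_comm]) hb'W
      ha'W ?_ ?_ hκ hxp hxq hyp hyq
    · rw [hcol, Set.pair_comm b a]; exact hv.valid
    · rw [Set.pair_comm b a]; exact hv.north

end Triangles

/-! ### The induction over cuts -/

section Cubic

variable {V : Type*}

theorem exists_third_neighbor {G : SimpleGraph V} {v p q : V} (h : (G.neighborSet v).ncard = 3)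
    (hp : G.Adj v p) (hq : G.Adj v q) (hpq : p ≠ q) :
    ∃ r, r ≠ p ∧ r ≠ q ∧ ∀ w, G.Adj v w ↔ w = p ∨ w = q ∨ w = r := by
  have h1 : ((G.neighborSet v \ {p}) \ {q}).ncard = 1 := by
    rw [Set.ncard_sdiff_singleton_of_mem (show q ∈ G.neighborSet v \ {p} from ⟨hq, hpq.symm⟩),
      Set.ncard_sdiff_singleton_of_mem (show p ∈ G.neighborSet v from hp), h]
  obtain ⟨r, hr⟩ := Set.ncard_eq_one.1 h1
  have hmem : ∀ w, (G.Adj v w ∧ w ≠ p) ∧ w ≠ q ↔ w = r := fun w => by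
    rw [← Set.mem_singleton_iff (b := r), ← hr]; rfl
  have hr' := (hmem r).2 rfl
  refine ⟨r, hr'.1.2, hr'.2, fun w => ⟨fun hw => ?_, ?_⟩⟩
  · by_cases h2 : w = p
    · exact Or.inl h2
    by_cases h3 : w = q
    · exact Or.inr (Or.inl h3)
    · exact Or.inr (Or.inr ((hmem w).1 ⟨⟨hw, h2⟩, h3⟩))
  · rintro (rfl | rfl | rfl)
    · exact hp
    · exact hq
    · exact hr'.left.left

/-- Near-cubic graphs have cap drawings if smaller cubic graphs can be drawn. -/
theorem exists_capDrawing [Finite V] (n : ℕ)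
    (hmain : ∀ (G : SimpleGraph V) (W : Set V), W.ncard < n → CubicOn G W →
      ∃ x y, ValidOn G.Adj W x y) (G : SimpleGraph V) (W : Set V) (s : V) (hn : W.ncard = n)
    (h : NearCubicOn G W s) : ∃ x y, CapDrawing G W s x y := by
  induction n using Nat.strong_induction_on generalizing G W s with
  | _ n ih =>
  have ih' : ∀ (G' : SimpleGraph V) (W' : Set V) (s' : V), W' ⊂ W → NearCubicOn G' W' s' →
      ∃ x y, CapDrawing G' W' s' x y := by
    intro G' W' s' hW' h'
    have hlt : W'.ncard < n := hn ▸ Set.ncard_lt_ncard hW'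
    exact ih _ hlt (fun G'' W'' hW'' => hmain G'' W'' (hW''.trans hlt)) G' W' s' rfl h'
  obtain ⟨a, b, hab, hN⟩ := Set.ncard_eq_two.1 h.two
  have hs : ∀ w, G.Adj s w ↔ w = a ∨ w = b := fun w => by
    rw [← SimpleGraph.mem_neighborSet, hN]; rfl
  have hsa : G.Adj s a := (hs a).2 (Or.inl rfl)
  have hsb : G.Adj s b := (hs b).2 (Or.inr rfl)
  have haW := h.closed s h.mem a hsa
  have hbW := h.closed s h.mem b hsb
  -- For adjacent `a` and `b`, suppression of `s` would create a double edge, so the triangle is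
  -- contracted instead. That in turn fails if the third neighbours of `a` and `b` coincide, which
  -- is the diamond.
  by_cases hadj : G.Adj a b
  · obtain ⟨a', ha's, ha'b, ha⟩ := exists_third_neighbor (h.three a haW hsa.ne') hsa.symm hadj
      hsb.ne
    obtain ⟨b', hb's, hb'a, hb⟩ := exists_third_neighbor (h.three b hbW hsb.ne') hsb.symm hadj.symm
      hsa.ne
    have haa' : G.Adj a a' := (ha a').2 (Or.inr (Or.inr rfl))
    have hbb' : G.Adj b b' := (hb b').2 (Or.inr (Or.inr rfl))
    have ha'W := h.closed a haW a' haa'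
    have hb'W := h.closed b hbW b' hbb'
    by_cases hab' : a' = b'
    · subst hab'
      obtain ⟨z, hza, hzb, hd⟩ := exists_third_neighbor (h.three a' ha'W ha's) haa'.symm hbb'.symm
        hab
      have hdz : G.Adj a' z := (hd z).2 (Or.inr (Or.inr rfl))
      have hzs : z ≠ s := by
        rintro rfl
        rcases (hs a').1 hdz.symm with h' | h'
        · exact haa'.ne' h'
        · exact hbb'.ne' h'
      have hzW : z ∈ W \ {s, a, b, a'} :=
        ⟨h.closed a' ha'W z hdz, by simp [hzs, hza, hzb, hdz.ne']⟩
      have hss : W \ {s, a, b, a'} ⊂ W :=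
        Set.ssubset_iff_subset_ne.2 ⟨Set.sdiff_subset, fun h' => by
          have := h'.symm ▸ h.mem
          exact this.2 (by simp)⟩
      -- The third edge of `a'` is the only one that leaves the diamond, hence a bridge to a smaller
      -- near-cubic part.
      have hnear : NearCubicOn (G.deleteEdges {s(z, a')}) (W \ {s, a, b, a'}) z := by
        refine nearCubicOn_deleteEdges hzW (by simp) hdz.symm ?_ ?_
        · rintro u ⟨hu, hu'⟩ v hv huv
          have hvW := h.closed u hu v huv
          have hv' : v = s ∨ v = a ∨ v = b ∨ v = a' := by
            by_contra h'
            exact hv ⟨hvW, by simpa using h'⟩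
          simp only [Set.mem_insert_iff, Set.mem_singleton_iff, not_or] at hu'
          have huv' := huv.symm
          rcases hv' with rfl | rfl | rfl | rfl
          · rw [hs] at huv'; tauto
          · rw [ha] at huv'; tauto
          · rw [hb] at huv'; tauto
          · rw [hd] at huv'; tauto
        · rintro v ⟨hv, hv'⟩
          exact h.three v hv fun h' => hv' (by simp [h'])
      obtain ⟨x, y, hcap⟩ := ih' _ _ z hss hnear
      refine exists_capDrawing_of_diamond hs ha hb hd ha's hzW (hcap.valid.mono subset_rfl ?_)
        hcap.north
      intro u hu v hv huv
      rw [SimpleGraph.deleteEdges_adj]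
      refine ⟨huv, fun h' => ?_⟩
      rw [Set.mem_singleton_iff, Sym2.eq_iff] at h'
      rcases h' with ⟨-, h'⟩ | ⟨h', -⟩
      · exact hv.2 (by simp [h'])
      · exact hu.2 (by simp [h'])
    · have has : a' ∉ ({s, a, b} : Set V) := by simp [ha's, ha'b, haa'.ne']
      have hbs : b' ∉ ({s, a, b} : Set V) := by simp [hb's, hb'a, hbb'.ne']
      obtain ⟨x, y, hcap⟩ := ih' _ _ s
        (Set.ssubset_iff_subset_ne.2 ⟨Set.sdiff_subset, fun h' => by
          have := h'.symm ▸ haW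
          exact this.2 (by simp)⟩) (h.nearCubicOn_collapse hs ha hb has hbs hab')
      exact exists_capDrawing_of_collapse h.mem hs ha hb has hbs ha'W hb'W hcap
  · obtain ⟨x, y, hv⟩ := hmain _ (W \ {s}) (by
      rw [Set.ncard_sdiff_singleton_of_mem h.mem, hn]
      have := Set.ncard_pos (Set.toFinite W) |>.2 ⟨s, h.mem⟩
      omega) (h.cubicOn_suppress hs hab hadj)
    exact exists_capDrawing_of_suppress h hs hab hadj hv

theorem CubicOn.of_subset {G : SimpleGraph V} {W Z : Set V} (h : CubicOn G W) (hZ : Z ⊆ W)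
    (hcut : ∀ u ∈ Z, ∀ v ∉ Z, ¬ G.Adj u v) : CubicOn G Z where
  three v hv := h.three v (hZ hv)
  closed v hv w hvw := by
    by_contra hw
    exact hcut v hv w hw hvw

/-- Passage to the induced graph on `W`: closedness preserves the degrees and the cuts, and the
values chosen outside of `W` are irrelevant. -/
theorem CubicOn.exists_validOn_of_cut [Finite V] {G : SimpleGraph V} {W : Set V} (h : CubicOn G W)
    (hcut : ∀ Z ⊆ W, Z.Nonempty → (W \ Z).Nonempty → 2 ≤ (cutEdges G Z).ncard) :
    ∃ x y, ValidOn G.Adj W x y := by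
  classical
  obtain ⟨x, y, hv⟩ := _root_.exists_validOn_of_cut (G := G.induce W) (fun v => by
    rw [← h.three v v.2, ← Set.ncard_image_of_injective _ Subtype.val_injective]
    congr 1
    ext w
    simp only [Set.mem_image, SimpleGraph.mem_neighborSet, SimpleGraph.comap_adj,
      Function.Embedding.subtype_apply, Subtype.exists, exists_and_left, exists_prop,
      exists_eq_right_right, and_iff_left_iff_imp]
    exact h.closed v v.2 w) (fun Z hZ hZ' => by
    have := hcut (Subtype.val '' Z) (by rintro _ ⟨v, -, rfl⟩; exact v.2) (hZ.image _) (by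
      obtain ⟨v, hv⟩ := hZ'
      exact ⟨v, v.2, by rintro ⟨w, hw, hwv⟩; exact hv (Subtype.ext hwv ▸ hw)⟩)
    refine this.trans (le_of_eq ?_)
    rw [← Set.ncard_image_of_injective (cutEdges (G.induce W) Z)
      (Subtype.val_injective.prodMap Subtype.val_injective)]
    congr 1
    ext ⟨u, v⟩
    constructor
    · rintro ⟨⟨u', hu', rfl⟩, hv, huv⟩
      have hvW := h.closed u' u'.2 v huv
      exact ⟨(u', ⟨v, hvW⟩), ⟨hu', fun h' => hv ⟨_, h', rfl⟩, huv⟩, rfl⟩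
    · rintro ⟨⟨u', v'⟩, ⟨hu', hv', huv⟩, heq⟩
      obtain ⟨rfl, rfl⟩ := Prod.mk.inj heq
      exact ⟨⟨u', hu', rfl⟩, fun ⟨w, hw, hwv⟩ => hv' (Subtype.ext hwv ▸ hw), huv⟩)
  refine ⟨fun v => if hv : v ∈ W then x ⟨v, hv⟩ else 0,
    fun v => if hv : v ∈ W then y ⟨v, hv⟩ else 0, ?_, ?_, ?_⟩
  · intro u hu v hv' h1 h2
    simp only [hu, hv', dif_pos] at h1 h2
    exact congrArg Subtype.val (hv.inj ⟨u, hu⟩ trivial ⟨v, hv'⟩ trivial h1 h2)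
  · intro u hu v hv' huv
    simp only [hu, hv', dif_pos]
    exact hv.slope ⟨u, hu⟩ trivial ⟨v, hv'⟩ trivial huv
  · rintro u hu v hv' w hw huv hwu hwv ⟨t, h0, h1, h2, h3⟩
    simp only [hu, hv', hw, dif_pos] at h2 h3
    exact hv.noSeg ⟨u, hu⟩ trivial ⟨v, hv'⟩ trivial ⟨w, hw⟩ trivial huv
      (fun h' => hwu (congrArg Subtype.val h')) (fun h' => hwv (congrArg Subtype.val h'))
      ⟨t, h0, h1, h2, h3⟩

/-- Joining two cap drawings, or two drawings without edges between them. -/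
theorem exists_validOn_union [Finite V] {G : SimpleGraph V} {P C : Set V} (hPC : ∀ v ∈ C, v ∉ P)
    {x₁ y₁ x₂ y₂ : V → ℝ} (hP : ValidOn G.Adj P x₁ y₁) (hC : ValidOn G.Adj C x₂ y₂) (s t : V)
    (hcut : ∀ u ∈ P, ∀ v ∈ C, G.Adj u v → u = s ∧ v = t ∧
      (∀ w ∈ P, w ≠ s → x₁ w = x₁ s → y₁ w < y₁ s) ∧
      (∀ w ∈ C, w ≠ t → x₂ w = x₂ t → y₂ w < y₂ t)) :
    ∃ x y, ValidOn G.Adj (P ∪ C) x y := by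
  obtain ⟨B₁, -, hB₁⟩ := exists_abs_le y₁
  obtain ⟨B₂, -, hB₂⟩ := exists_abs_le y₂
  have hPx : ∀ v ∈ P, glue C (fun v => x₂ v + (x₁ s - x₂ t)) x₁ v = x₁ v := fun v hv =>
    glue_notMem fun h' => hPC v h' hv
  have hPy : ∀ v ∈ P, glue C (fun v => B₁ + B₂ + 1 - y₂ v + 0) y₁ v = y₁ v := fun v hv =>
    glue_notMem fun h' => hPC v h' hv
  have hCx : ∀ v ∈ C, glue C (fun v => x₂ v + (x₁ s - x₂ t)) x₁ v = x₂ v + (x₁ s - x₂ t) :=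
    fun v hv => glue_mem hv
  have hCy : ∀ v ∈ C, glue C (fun v => B₁ + B₂ + 1 - y₂ v + 0) y₁ v = B₁ + B₂ + 1 - y₂ v + 0 :=
    fun v hv => glue_mem hv
  -- The second drawing is turned upside down, so that `t` sees downwards, and shifted to put `t`
  -- into the column of `s`.
  refine ⟨_, _, ValidOn.stack (fun _ _ => SimpleGraph.Adj.symm) (hP.congr hPx hPy)
    (((hC.flip _).translate _ _).congr hCx hCy) ?_ ?_⟩
  · intro u hu v hv
    rw [hPy u hu, hCy v hv]
    have h1 := (abs_le.1 (hB₁ u)).2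
    have h2 := (abs_le.1 (hB₂ v)).2
    linarith
  · intro u hu v hv huv
    obtain ⟨rfl, rfl, h1, h2⟩ := hcut u hu v hv huv
    left
    refine ⟨by rw [hPx u hu, hCx v hv]; ring, ?_, ?_⟩
    · intro w hw hwu hxw
      rw [hPx u hu, hPx w hw] at hxw
      rw [hPy u hu, hPy w hw]
      exact h1 w hw hwu hxw
    · intro w hw hwv hxw
      rw [hCx v hv, hCx w hw] at hxw
      rw [hCy v hv, hCy w hw]
      have := h2 w hw hwv (by linarith)
      linarith

/-- Every cubic graph can be drawn with the four basic slopes. -/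
theorem CubicOn.exists_validOn [Finite V] (n : ℕ) (G : SimpleGraph V) (W : Set V) (hn : W.ncard = n)
    (h : CubicOn G W) : ∃ x y, ValidOn G.Adj W x y := by
  induction n using Nat.strong_induction_on generalizing G W with
  | _ n ih =>
  by_cases hcut : ∀ Z ⊆ W, Z.Nonempty → (W \ Z).Nonempty → 2 ≤ (cutEdges G Z).ncard
  · exact h.exists_validOn_of_cut hcut
  push Not at hcut
  obtain ⟨Z, hZW, hZ, hZ', hlt⟩ := hcut
  have hlt1 : Z.ncard < n := by
    rw [← hn]
    refine Set.ncard_lt_ncard (Set.ssubset_iff_subset_ne.2 ⟨hZW, ?_⟩)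
    rintro rfl
    simp at hZ'
  have hlt2 : (W \ Z).ncard < n := by
    rw [← hn]
    refine Set.ncard_lt_ncard (Set.ssubset_iff_subset_ne.2 ⟨Set.sdiff_subset, fun h' => ?_⟩)
    obtain ⟨v, hv⟩ := hZ
    have := h'.symm ▸ hZW hv
    exact this.2 hv
  have hunion : Z ∪ W \ Z = W := Set.union_sdiff_cancel hZW
  have hdisj : ∀ v ∈ W \ Z, v ∉ Z := fun v hv => hv.2
  have hmemcut : ∀ u ∈ Z, ∀ v ∉ Z, G.Adj u v → (u, v) ∈ cutEdges G Z := fun u hu v hv huv =>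
    ⟨hu, hv, huv⟩
  rcases Nat.lt_or_ge 0 (cutEdges G Z).ncard with hpos | hzero
  · obtain ⟨⟨s, t⟩, hst⟩ := Set.ncard_eq_one.1 (show (cutEdges G Z).ncard = 1 by omega)
    have hstmem : (s, t) ∈ cutEdges G Z := by rw [hst]; rfl
    obtain ⟨hsZ, htZ, hadj⟩ := hstmem
    simp only at hsZ htZ hadj
    have hcut1 : ∀ u ∈ Z, ∀ v ∉ Z, G.Adj u v → u = s ∧ v = t := by
      intro u hu v hv huv
      have := hmemcut u hu v hv huv
      rw [hst] at this
      exact Prod.mk.inj this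
    have htW : t ∈ W \ Z := ⟨h.closed s (hZW hsZ) t hadj, htZ⟩
    have hsZ' : s ∉ W \ Z := fun h' => h'.2 hsZ
    have hcut2 : ∀ u ∈ W \ Z, ∀ v ∉ W \ Z, G.Adj u v → u = t ∧ v = s := by
      intro u hu v hv huv
      have hvZ : v ∈ Z := by
        by_contra h'
        exact hv ⟨h.closed u hu.1 v huv, h'⟩
      exact (hcut1 v hvZ u hu.2 huv.symm).symm
    obtain ⟨x₁, y₁, h1⟩ := exists_capDrawing _
      (fun G' W' hW' h' => ih _ (hW'.trans hlt1) G' W' rfl h') _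
      Z s rfl (nearCubicOn_deleteEdges hsZ htZ hadj hcut1 fun v hv => h.three v (hZW hv))
    obtain ⟨x₂, y₂, h2⟩ := exists_capDrawing _
      (fun G' W' hW' h' => ih _ (hW'.trans hlt2) G' W' rfl h') _
      (W \ Z) t rfl (nearCubicOn_deleteEdges htW hsZ' hadj.symm hcut2 fun v hv => h.three v hv.1)
    rw [← hunion]
    refine exists_validOn_union hdisj (h1.valid.mono subset_rfl ?_) (h2.valid.mono subset_rfl ?_)
      s t fun u hu v hv huv => ?_
    · intro u hu v hv huv
      rw [SimpleGraph.deleteEdges_adj]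
      refine ⟨huv, fun h' => ?_⟩
      rw [Set.mem_singleton_iff, Sym2.eq_iff] at h'
      rcases h' with ⟨-, rfl⟩ | ⟨rfl, -⟩
      · exact htZ hv
      · exact htZ hu
    · intro u hu v hv huv
      rw [SimpleGraph.deleteEdges_adj]
      refine ⟨huv, fun h' => ?_⟩
      rw [Set.mem_singleton_iff, Sym2.eq_iff] at h'
      rcases h' with ⟨-, rfl⟩ | ⟨rfl, -⟩
      · exact hsZ' hv
      · exact hsZ' hu
    · obtain ⟨h3, h4⟩ := hcut1 u hu v hv.2 huv
      exact ⟨h3, h4, h1.north, h2.north⟩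
  · have hempty : cutEdges G Z = ∅ := (Set.ncard_eq_zero).1 (by omega)
    have hno : ∀ u ∈ Z, ∀ v ∉ Z, ¬ G.Adj u v := fun u hu v hv huv => by
      have := hmemcut u hu v hv huv
      rw [hempty] at this
      exact this
    have hno' : ∀ u ∈ W \ Z, ∀ v ∉ W \ Z, ¬ G.Adj u v := by
      intro u hu v hv huv
      by_cases hvZ : v ∈ Z
      · exact hno v hvZ u hu.2 huv.symm
      · exact hv ⟨h.closed u hu.1 v huv, hvZ⟩
    obtain ⟨x₁, y₁, h1⟩ := ih _ hlt1 G Z rfl (h.of_subset hZW hno)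
    obtain ⟨x₂, y₂, h2⟩ := ih _ hlt2 G (W \ Z) rfl (h.of_subset Set.sdiff_subset hno')
    -- Without joining edges the two distinguished vertices are arbitrary.
    obtain ⟨v, -⟩ := hZ
    rw [← hunion]
    exact exists_validOn_union hdisj h1 h2 v v fun u hu w hw huw => absurd huw (hno u hu w hw.2)

end Cubic

/-! ### From coordinates to straight-line drawings -/

section Conversion

variable {V : Type*} {G : SimpleGraph V} {x y : V → ℝ}

/-- The straight-line drawing given by coordinates. -/
noncomputable def ValidOn.toDrawing (h : ValidOn G.Adj Set.univ x y) : StraightLineDrawing G where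
  pos v := !₂[x v, y v]
  pos_injective u v huv := by
    have h0 := congrArg (fun p : EuclideanSpace ℝ (Fin 2) => p 0) huv
    have h1 := congrArg (fun p : EuclideanSpace ℝ (Fin 2) => p 1) huv
    exact h.inj u trivial v trivial (by simpa using h0) (by simpa using h1)
  not_mem_segment u v w huv hwu hwv hw := by
    rw [segment_eq_image'] at hw
    obtain ⟨t, ht, hw⟩ := hw
    have h0 := congrArg (fun p : EuclideanSpace ℝ (Fin 2) => p 0) hw
    have h1 := congrArg (fun p : EuclideanSpace ℝ (Fin 2) => p 1) hw
    simp at h0 h1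
    exact h.noSeg u trivial v trivial w trivial huv hwu hwv
      ⟨t, ht.1, ht.2, by linarith, by linarith⟩

theorem ValidOn.usesOnlySlopes (h : ValidOn G.Adj Set.univ x y) :
    h.toDrawing.UsesOnlySlopes basicSlopes := by
  intro u v huv
  have hne : h.toDrawing.pos u ≠ h.toDrawing.pos v := fun h' =>
    huv.ne (h.toDrawing.pos_injective h')
  have hpos : ∀ w, h.toDrawing.pos w = !₂[x w, y w] := fun w => rfl
  have key : ∀ θ ∈ basicSlopes, (∃ t : ℝ, x v - x u = t * Real.cos θ ∧ y v - y u = t * Real.sin θ) →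
      ∃ θ ∈ basicSlopes, HasSlope (h.toDrawing.pos u) (h.toDrawing.pos v) θ := by
    rintro θ hθ ⟨t, h1, h2⟩
    refine ⟨θ, hθ, hne, t, ?_⟩
    rw [hpos, hpos]
    ext i
    fin_cases i
    · simpa using h1
    · simpa using h2
  have hsq : Real.sqrt 2 * (Real.sqrt 2 / 2) = 1 := by
    rw [← mul_div_assoc, Real.mul_self_sqrt (by norm_num)]; norm_num
  have h34 : 3 * Real.pi / 4 = Real.pi - Real.pi / 4 := by ring
  rcases h.slope u trivial v trivial huv with h1 | h1 | h1 | h1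
  · exact key (Real.pi / 2) (by simp [basicSlopes])
      ⟨y v - y u, by rw [Real.cos_pi_div_two, h1]; ring, by rw [Real.sin_pi_div_two]; ring⟩
  · exact key 0 (by simp [basicSlopes])
      ⟨x v - x u, by rw [Real.cos_zero]; ring, by rw [Real.sin_zero, h1]; ring⟩
  · refine key (Real.pi / 4) (by simp [basicSlopes]) ⟨(x v - x u) * Real.sqrt 2, ?_, ?_⟩
    · rw [Real.cos_pi_div_four]; linear_combination -(x v - x u) * hsq
    · rw [Real.sin_pi_div_four]; linear_combination h1 - (x v - x u) * hsq
  · refine key (3 * Real.pi / 4) (by simp [basicSlopes]) ⟨-(x v - x u) * Real.sqrt 2, ?_, ?_⟩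
    · rw [h34, Real.cos_pi_sub, Real.cos_pi_div_four]; linear_combination -(x v - x u) * hsq
    · rw [h34, Real.sin_pi_sub, Real.sin_pi_div_four]; linear_combination h1 + (x v - x u) * hsq

end Conversion

theorem theorem1p1 {V : Type*} [Finite V] (G : SimpleGraph V) [G.LocallyFinite]
    (hG : G.IsRegularOfDegree 3) :
    ∃ D : StraightLineDrawing G, D.UsesOnlySlopes basicSlopes := by
  have h : CubicOn G Set.univ := by
    refine ⟨fun v _ => ?_, fun _ _ _ _ => trivial⟩
    rw [← hG v, ← SimpleGraph.card_neighborSet_eq_degree, Set.ncard_eq_toFinset_card',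
      Set.toFinset_card]
  obtain ⟨x, y, hv⟩ := CubicOn.exists_validOn _ G Set.univ rfl h
  exact ⟨hv.toDrawing, hv.usesOnlySlopes⟩
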